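/- Let $X\in\mathbb R^{d_0}$ and $Y=m(X)+\eta$ with $\mathbb E(\eta\mid X)=0$, let $g:\mathbb R^{d_0}\to\mathbb R^d$ be measurable, and let $\mathcal M=\{g(x)^\top\beta:\beta\in\mathbb R^d\}$. Assume that $A:=\mathbb E[g(X)g(X)^\top]$ is invertible (I), and put $\tilde\beta_0:=A^{-1}\mathbb E[m(X)g(X)]$ (the unique minimizer of $\beta\mapsto \mathbb E[(m(X)-g(X)^\top\beta)^2]$), $\epsilon:=m(X)-g(X)^\top\tilde\beta_0+\eta$, $W:=(X,\epsilon)$, with i.i.d. copies $W_i=(X_i,\epsilon_i)$. (K) Let $k$ on $\mathbb R^{d_0}$ and $l$ on $\mathbb R$ be characteristic kernels, i.e. positive (semi)definite symmetric kernels whose mean embedding $P\mapsto\int k(\cdot,u)\,dP(u)$ is injective on the Borel probability measures with $\int k(u,u)\,dP(u)<\infty$ (likewise for $l$). Let $k$ be continuous and $l$ twice continuously differentiable with $l_{xx},l_{xy},l_{yy}$ Lipschitz. (M$'$) Assume $\mathbb E|g(X)|_\infty^2<\infty$, $\mathbb E\,m(X)^2<\infty$, $\mathbb E\,\eta^2<\infty$,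 $\mathbb E[|g(X)|_\infty^2\epsilon^2]<\infty$, and, for all $1\le q,r,s,t\le4$, that the following are finite: $$\mathbb E[k^2(X_q,X_r)\,l^2(\epsilon_s,\epsilon_t)],\qquad \mathbb E[|k(X_q,X_r)|\,|\nabla l(\epsilon_s,\epsilon_t)|_\infty(|g(X_s)|_\infty+|g(X_t)|_\infty)],$$ $$\mathbb E[|k(X_q,X_r)|(|g(X_s)|_\infty^3+|g(X_t)|_\infty^3)],\qquad \mathbb E[|k(X_q,X_r)|\,|\mathrm{Hess}(l)(\epsilon_s,\epsilon_t)|_\infty(|g(X_s)|_\infty^2+|g(X_t)|_\infty^2)].$$ Suppose that one of the following alternatives holds, where membership of $m$ in $\mathcal M$ is understood almost surely: $H_1$: $X$ and $\eta$ are dependent and $m\in\mathcal M$; $H_2$: $X$ and $\eta$ are independent and $m\notin\mathcal M$; $H_3$: $X$ and $\eta$ are dependent and $m\notin\mathcal M$. Under $H_2$ assume further that $m(X)-g(X)^\top\tilde\beta_0$ is not almost surely constant. Let $(X_i,Y_i)_{i\ge1}$ be i.i.d. copies of $(X,Y)$, $\hat\beta_n\in\operatorname{argmin}_\beta\sum_{i=1}^n(Y_i-g(X_i)^\top\beta)^2$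 a least squares estimator, $e_i=Y_i-g(X_i)^\top\hat\beta_n$ the residuals, and, with $k_{ij}=k(X_i,X_j)$, $l_{ij}=l(e_i,e_j)$ and all indices running over $1,\dots,n$, $$T_n=\frac1{n^2}\sum_{i,j}k_{ij}l_{ij}+\frac1{n^4}\sum_{i,j,q,r}k_{ij}l_{qr}-\frac2{n^3}\sum_{i,j,q}k_{ij}l_{iq}.$$ Let $\theta:=\mathbb E[k(X_1,X_2)l(\epsilon_1,\epsilon_2)]+\mathbb E[k(X_1,X_2)]\,\mathbb E[l(\epsilon_1,\epsilon_2)]-2\,\mathbb E[k(X_1,X_2)l(\epsilon_1,\epsilon_3)]$, the Hilbert--Schmidt independence criterion of $(X,\epsilon)$. Then $\theta>0$ and $$\sqrt n\,(T_n-\theta)\to_d N(0,\sigma^2),\qquad \sigma^2=\operatorname{Var}\!\big(4\,h^{(0)}_1(W)+\gamma^\top A^{-1}g(X)\,\epsilon\big)<\infty.$$ Here, for $p=0,1$, $$h^{(p)}(W_1,\dots,W_4)=\frac1{4!}\sum_{(i,j,u,v)}k(X_i,X_j)\big(l^{(p)}_{ij}+l^{(p)}_{uv}-2\,l^{(p)}_{iu}\big),$$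 the sum being over all permutations $(i,j,u,v)$ of $(1,2,3,4)$, with $l^{(0)}_{ij}=l(\epsilon_i,\epsilon_j)$ and $l^{(1)}_{ij}=-\big(l_x(\epsilon_i,\epsilon_j)g(X_i)+l_y(\epsilon_i,\epsilon_j)g(X_j)\big)$; moreover $h^{(0)}_1(w)=\mathbb E[h^{(0)}(w,W_2,W_3,W_4)]-\theta$ and $\gamma=\mathbb E[h^{(1)}(W_1,\dots,W_4)]$. All expectations occurring in these definitions are finite. (If $\sigma^2=0$, $N(0,0)$ is the point mass at $0$.) -/

import Mathlib

open MeasureTheory ProbabilityTheory Filter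
open scoped Matrix NNReal Topology

noncomputable section

namespace HSICReg

/-! ### Kernels -/

/-- A characteristic kernel on `U`: symmetric and positive semidefinite (that is, the kernel of a
reproducing kernel Hilbert space of functions on `U`), and such that the mean embedding
`P ↦ ∫ k(·, u) dP(u)` is injective on the probability measures with `∫ k(u, u) dP(u) < ∞`.
The embedding is written as a function on `U`. -/
structure IsCharacteristicKernel {U : Type*} [MeasurableSpace U] (k : U → U → ℝ) : Prop where
  posSemidef : (Matrix.of k).PosSemidef
  injective : ∀ P Q : Measure U, IsProbabilityMeasure P → IsProbabilityMeasure Q →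
    Integrable (fun u => k u u) P → Integrable (fun u => k u u) Q →
    (∀ v, ∫ u, k v u ∂P = ∫ u, k v u ∂Q) → P = Q

/-- The partial derivative `f_x`. -/
def dx (f : ℝ → ℝ → ℝ) (x y : ℝ) : ℝ := deriv (fun s => f s y) x

/-- The partial derivative `f_y`. -/
def dy (f : ℝ → ℝ → ℝ) (x y : ℝ) : ℝ := deriv (fun s => f x s) y

/-- `|∇ l|_∞`. -/
def gradSup (l : ℝ → ℝ → ℝ) (x y : ℝ) : ℝ := max |dx l x y| |dy l x y|

/-- `|Hess(l)|_∞`. -/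
def hessSup (l : ℝ → ℝ → ℝ) (x y : ℝ) : ℝ :=
  max |dx (dx l) x y| (max |dx (dy l) x y| |dy (dy l) x y|)

/-- Condition (K) on the two kernels. The norm on `ℝ × ℝ` is the sup norm. -/
structure KernelConditions {d₀ : ℕ} (k : (Fin d₀ → ℝ) → (Fin d₀ → ℝ) → ℝ) (l : ℝ → ℝ → ℝ) :
    Prop where
  char_k : IsCharacteristicKernel k
  char_l : IsCharacteristicKernel l
  continuous_k : Continuous (Function.uncurry k)
  contDiff_l : ContDiff ℝ 2 (Function.uncurry l)
  lipschitz_l : ∃ L : ℝ≥0, LipschitzWith L (Function.uncurry (dx (dx l))) ∧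
    LipschitzWith L (Function.uncurry (dx (dy l))) ∧
    LipschitzWith L (Function.uncurry (dy (dy l)))

/-! ### HSIC and its empirical version -/

/-- The HSIC `θ(U, V)` of the law `Q` of `(U, V)`:
`E[k(U,U') l(V,V')] + E[k(U,U')] E[l(V,V')] - 2 E[k(U,U') l(V,V'')]`. -/
def hsic {U V : Type*} [MeasurableSpace U] [MeasurableSpace V]
    (k : U → U → ℝ) (l : V → V → ℝ) (Q : Measure (U × V)) : ℝ :=
  (∫ p, k p.1.1 p.2.1 * l p.1.2 p.2.2 ∂(Q.prod Q))
    + (∫ p, k p.1.1 p.2.1 ∂(Q.prod Q)) * (∫ p, l p.1.2 p.2.2 ∂(Q.prod Q))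
    - 2 * ∫ p, k p.1.1 p.2.1.1 * l p.1.2 p.2.2.2 ∂(Q.prod (Q.prod Q))

/-- The (biased) empirical HSIC of the points `(u i, v i)`. -/
def empiricalHSIC {U V : Type*} (k : U → U → ℝ) (l : V → V → ℝ) (n : ℕ)
    (u : Fin n → U) (v : Fin n → V) : ℝ :=
  1 / (n : ℝ) ^ 2 * ∑ i, ∑ j, k (u i) (u j) * l (v i) (v j)
    + 1 / (n : ℝ) ^ 4 * ∑ i, ∑ j, ∑ q, ∑ r, k (u i) (u j) * l (v q) (v r)
    - 2 * (1 / (n : ℝ) ^ 3) * ∑ i, ∑ j, ∑ q, k (u i) (u j) * l (v i) (v q)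

/-! ### The regression model: population quantities

`P` is the law of `Z = (X, η)`, `g` the vector of predictor functions and `m` the regression
function, so that `Y = m(X) + η`. -/

/-- `A = E[g(X) g(X)ᵀ]`. -/
def designMatrix {d₀ d : ℕ} (P : Measure ((Fin d₀ → ℝ) × ℝ)) (g : (Fin d₀ → ℝ) → Fin d → ℝ) :
    Matrix (Fin d) (Fin d) ℝ :=
  Matrix.of fun a b => ∫ z, g z.1 a * g z.1 b ∂P

/-- `β̃₀ = A⁻¹ E[m(X) g(X)]`, the minimizer of `β ↦ E[(m(X) - g(X)ᵀ β)²]`. -/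
def bestCoef {d₀ d : ℕ} (P : Measure ((Fin d₀ → ℝ) × ℝ)) (g : (Fin d₀ → ℝ) → Fin d → ℝ)
    (m : (Fin d₀ → ℝ) → ℝ) : Fin d → ℝ :=
  (designMatrix P g)⁻¹ *ᵥ (fun a => ∫ z, m z.1 * g z.1 a ∂P)

/-- The misfit `m(x) - g(x)ᵀ β̃₀`. -/
def misfit {d₀ d : ℕ} (P : Measure ((Fin d₀ → ℝ) × ℝ)) (g : (Fin d₀ → ℝ) → Fin d → ℝ)
    (m : (Fin d₀ → ℝ) → ℝ) (x : Fin d₀ → ℝ) : ℝ :=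
  m x - g x ⬝ᵥ bestCoef P g m

/-- The law of `W = (X, ε)`, where `ε = m(X) - g(X)ᵀ β̃₀ + η` is the error under model
misspecification. -/
def errorLaw {d₀ d : ℕ} (P : Measure ((Fin d₀ → ℝ) × ℝ)) (g : (Fin d₀ → ℝ) → Fin d → ℝ)
    (m : (Fin d₀ → ℝ) → ℝ) : Measure ((Fin d₀ → ℝ) × ℝ) :=
  P.map fun z => (z.1, misfit P g m z.1 + z.2)

/-- `m ∈ M_β = {g(x)ᵀ β : β ∈ ℝᵈ}`, up to a null set of the law of `X`. -/
def InModel {d₀ d : ℕ} (P : Measure ((Fin d₀ → ℝ) × ℝ)) (g : (Fin d₀ → ℝ) → Fin d → ℝ)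
    (m : (Fin d₀ → ℝ) → ℝ) : Prop :=
  ∃ β : Fin d → ℝ, ∀ᵐ z ∂P, m z.1 = g z.1 ⬝ᵥ β

/-- `X` and `η` are independent. -/
def ErrorIndep {d₀ : ℕ} (P : Measure ((Fin d₀ → ℝ) × ℝ)) : Prop :=
  IndepFun (fun z : (Fin d₀ → ℝ) × ℝ => z.1) (fun z => z.2) P

/-- The alternative `H₁`. -/
def H1 {d₀ d : ℕ} (P : Measure ((Fin d₀ → ℝ) × ℝ)) (g : (Fin d₀ → ℝ) → Fin d → ℝ)
    (m : (Fin d₀ → ℝ) → ℝ) : Prop :=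
  ¬ ErrorIndep P ∧ InModel P g m

/-- The alternative `H₂`. -/
def H2 {d₀ d : ℕ} (P : Measure ((Fin d₀ → ℝ) × ℝ)) (g : (Fin d₀ → ℝ) → Fin d → ℝ)
    (m : (Fin d₀ → ℝ) → ℝ) : Prop :=
  ErrorIndep P ∧ ¬ InModel P g m

/-- The alternative `H₃`. -/
def H3 {d₀ d : ℕ} (P : Measure ((Fin d₀ → ℝ) × ℝ)) (g : (Fin d₀ → ℝ) → Fin d → ℝ)
    (m : (Fin d₀ → ℝ) → ℝ) : Prop :=
  ¬ ErrorIndep P ∧ ¬ InModel P g m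

/-- The moment conditions (M'). Expectations over i.i.d. copies `W₁, …, W₄` of `W = (X, ε)` are
taken under the fourfold product of the law of `W`; the norm on `Fin d → ℝ` is the sup norm. -/
structure MomentConditions {d₀ d : ℕ} (P : Measure ((Fin d₀ → ℝ) × ℝ))
    (g : (Fin d₀ → ℝ) → Fin d → ℝ) (m : (Fin d₀ → ℝ) → ℝ)
    (k : (Fin d₀ → ℝ) → (Fin d₀ → ℝ) → ℝ) (l : ℝ → ℝ → ℝ) : Prop where
  a_g : Integrable (fun z => ‖g z.1‖ ^ 2) P
  a_m : Integrable (fun z => m z.1 ^ 2) P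
  b_eta : Integrable (fun z => z.2 ^ 2) P
  b_eps : Integrable (fun w => ‖g w.1‖ ^ 2 * w.2 ^ 2) (errorLaw P g m)
  c_i : ∀ q r s t : Fin 4,
    Integrable (fun w : Fin 4 → (Fin d₀ → ℝ) × ℝ =>
      k (w q).1 (w r).1 ^ 2 * l (w s).2 (w t).2 ^ 2) (Measure.pi fun _ => errorLaw P g m)
  c_ii : ∀ q r s t : Fin 4,
    Integrable (fun w : Fin 4 → (Fin d₀ → ℝ) × ℝ =>
      |k (w q).1 (w r).1| * gradSup l (w s).2 (w t).2 * (‖g (w s).1‖ + ‖g (w t).1‖))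
      (Measure.pi fun _ => errorLaw P g m)
  c_iii : ∀ q r s t : Fin 4,
    Integrable (fun w : Fin 4 → (Fin d₀ → ℝ) × ℝ =>
      |k (w q).1 (w r).1| * (‖g (w s).1‖ ^ 3 + ‖g (w t).1‖ ^ 3))
      (Measure.pi fun _ => errorLaw P g m)
  c_iv : ∀ q r s t : Fin 4,
    Integrable (fun w : Fin 4 → (Fin d₀ → ℝ) × ℝ =>
      |k (w q).1 (w r).1| * hessSup l (w s).2 (w t).2 * (‖g (w s).1‖ ^ 2 + ‖g (w t).1‖ ^ 2))
      (Measure.pi fun _ => errorLaw P g m)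

/-! ### The asymptotic variance -/

/-- The symmetrized kernel of order four
`(1/4!) ∑ (k_{ij} ℓ_{ij} + k_{ij} ℓ_{uv} - 2 k_{ij} ℓ_{iu})`, the sum being over the
permutations `(i, j, u, v)` of the four arguments. -/
def symKernel {U V E : Type*} [AddCommGroup E] [Module ℝ E] (k : U → U → ℝ)
    (ℓ : U × V → U × V → E) (w : Fin 4 → U × V) : E :=
  (1 / 24 : ℝ) • ∑ σ : Equiv.Perm (Fin 4), k (w (σ 0)).1 (w (σ 1)).1 •
    (ℓ (w (σ 0)) (w (σ 1)) + ℓ (w (σ 2)) (w (σ 3)) - (2 : ℝ) • ℓ (w (σ 0)) (w (σ 2)))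

/-- The kernel `h⁽⁰⁾`, with `ℓ⁽⁰⁾ = l(ε, ε')`. -/
def h0 {d₀ : ℕ} (k : (Fin d₀ → ℝ) → (Fin d₀ → ℝ) → ℝ) (l : ℝ → ℝ → ℝ) :
    (Fin 4 → (Fin d₀ → ℝ) × ℝ) → ℝ :=
  symKernel k fun w w' => l w.2 w'.2

/-- The kernel `h⁽¹⁾`, with `ℓ⁽¹⁾ = -(l_x(ε, ε') g(X) + l_y(ε, ε') g(X'))`. -/
def h1 {d₀ d : ℕ} (g : (Fin d₀ → ℝ) → Fin d → ℝ)
    (k : (Fin d₀ → ℝ) → (Fin d₀ → ℝ) → ℝ) (l : ℝ → ℝ → ℝ) :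
    (Fin 4 → (Fin d₀ → ℝ) × ℝ) → Fin d → ℝ :=
  symKernel k fun w w' => -(dx l w.2 w'.2 • g w.1 + dy l w.2 w'.2 • g w'.1)

/-- The first projection `h₁⁽⁰⁾(w) = E[h⁽⁰⁾(w, W₂, W₃, W₄)] - θ(X, ε)`. -/
def h0proj {d₀ : ℕ} (k : (Fin d₀ → ℝ) → (Fin d₀ → ℝ) → ℝ) (l : ℝ → ℝ → ℝ)
    (Q : Measure ((Fin d₀ → ℝ) × ℝ)) (w : (Fin d₀ → ℝ) × ℝ) : ℝ :=
  (∫ v : Fin 3 → (Fin d₀ → ℝ) × ℝ, h0 k l (Matrix.vecCons w v) ∂(Measure.pi fun _ => Q))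
    - hsic k l Q

/-- `γ = E[h⁽¹⁾(W₁, W₂, W₃, W₄)]`. -/
def gammaVec {d₀ d : ℕ} (g : (Fin d₀ → ℝ) → Fin d → ℝ)
    (k : (Fin d₀ → ℝ) → (Fin d₀ → ℝ) → ℝ) (l : ℝ → ℝ → ℝ)
    (Q : Measure ((Fin d₀ → ℝ) × ℝ)) : Fin d → ℝ :=
  ∫ w, h1 g k l w ∂(Measure.pi fun _ => Q)

/-- The influence function `4 h₁⁽⁰⁾(W) + γᵀ A⁻¹ g(X) ε`. The factor `4` is the order of the
V-statistic with kernel `h⁽⁰⁾`. -/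
def influence {d₀ d : ℕ} (P : Measure ((Fin d₀ → ℝ) × ℝ)) (g : (Fin d₀ → ℝ) → Fin d → ℝ)
    (m : (Fin d₀ → ℝ) → ℝ) (k : (Fin d₀ → ℝ) → (Fin d₀ → ℝ) → ℝ) (l : ℝ → ℝ → ℝ)
    (w : (Fin d₀ → ℝ) × ℝ) : ℝ :=
  4 * h0proj k l (errorLaw P g m) w
    + gammaVec g k l (errorLaw P g m) ⬝ᵥ ((designMatrix P g)⁻¹ *ᵥ g w.1) * w.2

/-! ### Least squares and the test statistic -/

/-- `b` is a least squares estimate from the data `(x i, y i)`: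
`b ∈ argmin_β ∑ (y i - g(x i)ᵀ β)²`. -/
def IsLSE {d₀ d : ℕ} (g : (Fin d₀ → ℝ) → Fin d → ℝ) (n : ℕ) (x : Fin n → Fin d₀ → ℝ)
    (y : Fin n → ℝ) (b : Fin d → ℝ) : Prop :=
  IsMinOn (fun β : Fin d → ℝ => ∑ i, (y i - g (x i) ⬝ᵥ β) ^ 2) Set.univ b

/-- The test statistic `T_n`: the empirical HSIC between the covariates and the residuals
`e i = y i - g(x i)ᵀ b`. -/
def testStat {d₀ d : ℕ} (g : (Fin d₀ → ℝ) → Fin d → ℝ)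
    (k : (Fin d₀ → ℝ) → (Fin d₀ → ℝ) → ℝ) (l : ℝ → ℝ → ℝ) (n : ℕ)
    (x : Fin n → Fin d₀ → ℝ) (y : Fin n → ℝ) (b : Fin d → ℝ) : ℝ :=
  empiricalHSIC k l n x fun i => y i - g (x i) ⬝ᵥ b

end HSICReg

end

open HSICReg

/-! Write `δ` for the difference between the least squares estimate and `bestCoef`, so that the
residuals are `ε i - g (X i) ⬝ᵥ δ`. There are two independent claims: positivity of the criterion,
and asymptotic normality.

Positivity. The criterion is the squared Hilbert space distance between the mean embeddings, under
the product kernel, of the law of `(X, ε)` and of the product of its marginals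
(`hsic_nonneg_and_integral_mul_eq`). If it vanishes, the covariances of all `k a X` and `l b ε`
vanish. Injectivity of the embedding, extended to signed measures of mass zero
(`IsCharacteristicKernel.setIntegral_eq_zero`) and used once for each kernel, upgrades this to
independence (`eq_prod_of_hsic_eq_zero`). Under each alternative `X` and `ε` are dependent
(`errorLaw_ne_prod`): independence would force the misfit to be uncorrelated with `ε`, hence to have
variance zero, so that `η` is `ε` minus a constant.

Normality. The statistic is a V-statistic of order four in the residuals. A Taylor expansion of `l`
in `δ` (`abs_vstat_expansion_le`) splits it into the V-statistic of the true errors, a term linear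
in `δ` whose coefficients are again V-statistics, and a remainder of order `|δ|² + |δ|³` times
V-statistics bounded in probability. The first term is linearized by the Hoeffding projection
(`nullInProb_hoeffding`), the coefficients of the second converge to `γ` by a law of large numbers
(`nullInProb_vstat_sub`), and `√n δ` is `A⁻¹` times a normalized sum of `g(X) ε`, up to `o_P(1)`
(`leastSquares_expansion`). Together (`nullInProb_sqrt_mul_sub_influence`) the statistic is a
normalized sum of i.i.d. centred square integrable variables, so the classical central limit theorem
and Slutsky's lemma finish.

A V-statistic also runs over tuples with repeated indices; this is why integrability is tracked
under every identification of the four arguments (`PatternIntegrable`), matching the quantifier over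
`q r s t` in the moment conditions. -/

namespace HSICReg

set_option linter.unusedSectionVars false

/-! ### Feature maps of positive semidefinite kernels -/

section FeatureMap

universe u

/-- A positive semidefinite kernel is the Gram matrix of a map into a Hilbert space. -/
theorem exists_featureMap {U : Type u} {k : U → U → ℝ} (hk : (Matrix.of k).PosSemidef) :
    ∃ (H : Type u) (_ : NormedAddCommGroup H) (_ : InnerProductSpace ℝ H) (_ : CompleteSpace H)
      (φ : U → H), ∀ x y, inner ℝ (φ x) (φ y) = k x y := by
  classical
  let K : Matrix U U (ℝ →L[ℝ] ℝ) := Matrix.of fun x y => k x y • ContinuousLinearMap.id ℝ ℝ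
  have hKs : ∀ x y, k x y = k y x := fun x y => by
    have := hk.1.apply x y
    simpa using this.symm
  have hK : K.PosSemidef := by
    apply ((RKHS.posSemidef_tfae (K := K)).out 0 2).mpr
    refine ⟨?_, fun v => ?_⟩
    · ext x y
      have h1 : star (ContinuousLinearMap.id ℝ ℝ) = ContinuousLinearMap.id ℝ ℝ :=
        IsSelfAdjoint.one (ℝ →L[ℝ] ℝ)
      simp [K, hKs y x, h1]
    · have := hk.2 v
      refine this.trans_eq ?_
      simp only [Finsupp.sum, K, RCLike.re_to_real, star_trivial, Matrix.of_apply]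
      refine Finset.sum_congr rfl fun x _ => Finset.sum_congr rfl fun y _ => ?_
      simp [hKs y x]
      ring
  have : Fact K.PosSemidef := ⟨hK⟩
  refine ⟨RKHS.OfKernel K, inferInstance, inferInstance, inferInstance,
    fun x => RKHS.kerFun (RKHS.OfKernel K) x 1, fun x y => ?_⟩
  rw [RKHS.kerFun_inner, RKHS.kerFun_apply, RKHS.OfKernel.kernel_ofKernel]
  simp [K]

variable {U : Type*} {k : U → U → ℝ}

lemma kernel_self_nonneg (hk : (Matrix.of k).PosSemidef) (x : U) : 0 ≤ k x x := by
  obtain ⟨H, _, _, _, φ, hφ⟩ := exists_featureMap hk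
  rw [← hφ]
  exact real_inner_self_nonneg

/-- Cauchy–Schwarz in the feature space. -/
lemma abs_kernel_le (hk : (Matrix.of k).PosSemidef) (x y : U) :
    |k x y| ≤ √(k x x) * √(k y y) := by
  obtain ⟨H, _, _, _, φ, hφ⟩ := exists_featureMap hk
  rw [← hφ x y, ← hφ x x, ← hφ y y, ← norm_eq_sqrt_real_inner, ← norm_eq_sqrt_real_inner]
  exact abs_real_inner_le_norm _ _

lemma sqrt_le_one_add {a : ℝ} (ha : 0 ≤ a) : √a ≤ 1 + a := by
  rw [Real.sqrt_le_left (by linarith)]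
  nlinarith

/-- This form is affine in `k y y`, so integrability of the diagonal alone makes every section `k x
·` integrable. -/
lemma abs_kernel_le_one_add (hk : (Matrix.of k).PosSemidef) (x y : U) :
    |k x y| ≤ √(k x x) * (1 + k y y) :=
  (abs_kernel_le hk x y).trans
    (mul_le_mul_of_nonneg_left (sqrt_le_one_add (kernel_self_nonneg hk y)) (Real.sqrt_nonneg _))

/-- The squared distance `‖φ y - φ x‖²` is a combination of values of `k`. Continuity is what makes
`φ` strongly measurable, hence Bochner integrable, on second countable spaces. -/
lemma continuous_featureMap [TopologicalSpace U] {H : Type*} [NormedAddCommGroup H]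
    [InnerProductSpace ℝ H] {φ : U → H} (hφ : ∀ x y, inner ℝ (φ x) (φ y) = k x y)
    (hc : Continuous (Function.uncurry k)) : Continuous φ := by
  rw [continuous_iff_continuousAt]
  intro x
  have h1 : ∀ y, ‖φ y - φ x‖ = √(k y y - 2 * k y x + k x x) := fun y => by
    rw [norm_eq_sqrt_real_inner, real_inner_sub_sub_self, hφ, hφ, hφ]
  rw [ContinuousAt, tendsto_iff_norm_sub_tendsto_zero]
  simp_rw [h1]
  have h2 : Continuous fun y => √(k y y - 2 * k y x + k x x) := by
    have a1 : Continuous fun y => k y y := hc.comp (continuous_id.prodMk continuous_id)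
    have a2 : Continuous fun y => k y x := hc.comp (continuous_id.prodMk continuous_const)
    fun_prop
  have h3 := h2.tendsto x
  have h4 : k x x - 2 * k x x + k x x = 0 := by ring
  simpa [h4] using h3

end FeatureMap

/-! ### Characteristic kernels and signed measures -/

section Characteristic

variable {U Ω : Type*} [MeasurableSpace U] {mΩ : MeasurableSpace Ω} {k : U → U → ℝ}

/-- A characteristic kernel separates the signed measures of mass zero. -/
theorem IsCharacteristicKernel.setIntegral_eq_zero (hk : IsCharacteristicKernel k)
    (hkm : Measurable (Function.uncurry k)) {ν : Measure Ω} [IsFiniteMeasure ν] {u : Ω → U}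
    (hu : Measurable u) {f : Ω → ℝ} (hfm : Measurable f) (hf : Integrable f ν)
    (hkf : Integrable (fun ω => k (u ω) (u ω) * f ω) ν) (h0 : ∫ ω, f ω ∂ν = 0)
    (hkf0 : ∀ a, ∫ ω, k a (u ω) * f ω ∂ν = 0) {B : Set U} (hB : MeasurableSet B) :
    ∫ ω in u ⁻¹' B, f ω ∂ν = 0 := by
  have hdiag : Measurable fun x => k x x := hkm.comp (measurable_id.prodMk measurable_id)
  have hrow : ∀ a, Measurable fun x => k a x := fun a =>
    hkm.comp (measurable_const.prodMk measurable_id)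
  have hfm' : Measurable fun ω => -f ω := hfm.neg
  -- the positive and negative parts of `f dν`, pushed forward
  let α : (Ω → ℝ) → Measure U := fun h => (ν.withDensity fun ω => ENNReal.ofReal (h ω)).map u
  have hint : ∀ h : Ω → ℝ, Measurable h → ∀ F : U → ℝ, Measurable F →
      ∫ x, F x ∂(α h) = ∫ ω, max (h ω) 0 * F (u ω) ∂ν := by
    intro h hh F hF
    rw [integral_map hu.aemeasurable hF.aestronglyMeasurable,
      integral_withDensity_eq_integral_toReal_smul (by fun_prop) (by simp)]
    simp [ENNReal.toReal_ofReal']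
  have hintegrable : ∀ h : Ω → ℝ, Measurable h → ∀ F : U → ℝ, Measurable F →
      Integrable (fun ω => F (u ω) * h ω) ν → Integrable F (α h) := by
    intro h hh F hF hi
    rw [integrable_map_measure hF.aestronglyMeasurable hu.aemeasurable,
      integrable_withDensity_iff_integrable_smul' (by fun_prop) (by simp)]
    refine hi.mono (by fun_prop) (ae_of_all _ fun ω => ?_)
    simp only [ENNReal.toReal_ofReal', Function.comp_apply, smul_eq_mul, norm_mul, Real.norm_eq_abs]
    rw [mul_comm]
    refine mul_le_mul_of_nonneg_left ?_ (abs_nonneg _)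
    rw [abs_of_nonneg (le_max_right _ _)]
    exact max_le (le_abs_self _) (abs_nonneg _)
  have hset : ∀ h : Ω → ℝ, Measurable h → ∀ C : Set U, MeasurableSet C →
      α h C = ∫⁻ ω in u ⁻¹' C, ENNReal.ofReal (h ω) ∂ν := by
    intro h hh C hC
    rw [Measure.map_apply hu hC, withDensity_apply _ (hu hC)]
  have hfp : Integrable (fun ω => max (f ω) 0) ν := hf.pos_part
  have hfn : Integrable (fun ω => max (-f ω) 0) ν := hf.neg_part
  have hfeq : ∀ ω, f ω = max (f ω) 0 - max (-f ω) 0 := fun ω => by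
    rcases le_total 0 (f ω) with h | h
    · rw [max_eq_left h, max_eq_right (by linarith)]; ring
    · rw [max_eq_right h, max_eq_left (by linarith)]; ring
  have hlint : ∀ h : Ω → ℝ, Integrable (fun ω => max (h ω) 0) ν → ∀ C : Set Ω,
      ∫⁻ ω in C, ENNReal.ofReal (h ω) ∂ν = ENNReal.ofReal (∫ ω in C, max (h ω) 0 ∂ν) := by
    intro h hh C
    rw [ofReal_integral_eq_lintegral_ofReal hh.integrableOn (ae_of_all _ fun ω => le_max_right _ _)]
    refine lintegral_congr fun ω => ?_
    simp [ENNReal.ofReal_max]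
  set c : ℝ := ∫ ω, max (f ω) 0 ∂ν with hc
  have hc' : ∫ ω, max (-f ω) 0 ∂ν = c := by
    have : ∫ ω, f ω ∂ν = c - ∫ ω, max (-f ω) 0 ∂ν := by
      rw [hc, ← integral_sub hfp hfn]
      exact integral_congr_ae (ae_of_all _ hfeq)
    linarith
  have hc0 : 0 ≤ c := integral_nonneg fun ω => le_max_right _ _
  have hmass : α f Set.univ = ENNReal.ofReal c := by
    rw [hset f hfm _ MeasurableSet.univ, hlint f hfp]; simp [hc]
  have hmass' : α (fun ω => -f ω) Set.univ = ENNReal.ofReal c := by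
    rw [hset _ hfm' _ MeasurableSet.univ, hlint _ hfn]; simp [hc']
  -- The two parts have the same mass `c`. If `c = 0` both are the zero measure; otherwise dividing
  -- by `c` gives two probability measures with equal embeddings, to which injectivity applies.
  have hmain : α f = α (fun ω => -f ω) := by
    rcases hc0.eq_or_lt with h | h
    · rw [← h, ENNReal.ofReal_zero, Measure.measure_univ_eq_zero] at hmass hmass'
      rw [hmass, hmass']
    · have hne : ENNReal.ofReal c ≠ 0 := by simpa using h
      have hne' : ENNReal.ofReal c ≠ ⊤ := ENNReal.ofReal_ne_top
      have key := hk.injective ((ENNReal.ofReal c)⁻¹ • α f)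
        ((ENNReal.ofReal c)⁻¹ • α fun ω => -f ω)
        ⟨by simp [hmass, ENNReal.inv_mul_cancel hne hne']⟩
        ⟨by simp [hmass', ENNReal.inv_mul_cancel hne hne']⟩
        ((hintegrable f hfm _ hdiag hkf).smul_measure (by simpa using h))
        ((hintegrable _ hfm.neg _ hdiag (by simpa using hkf.neg)).smul_measure (by simpa using h))
        (fun v => by
          rw [integral_smul_measure, integral_smul_measure, hint f hfm _ (hrow v),
            hint _ hfm' _ (hrow v)]
          congr 1
          have i0 : Integrable (fun ω => k v (u ω) * f ω) ν := by
            have hb : Integrable (fun ω => √(k v v) * (|f ω| + |k (u ω) (u ω) * f ω|)) ν :=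
              (hf.abs.add hkf.abs).const_mul _
            refine hb.mono' (((hrow v).comp hu).mul hfm).aestronglyMeasurable
              (ae_of_all _ fun ω => ?_)
            rw [Real.norm_eq_abs, abs_mul, abs_mul,
              abs_of_nonneg (kernel_self_nonneg hk.posSemidef (u ω))]
            calc _ ≤ √(k v v) * (1 + k (u ω) (u ω)) * |f ω| :=
                  mul_le_mul_of_nonneg_right (abs_kernel_le_one_add hk.posSemidef _ _)
                    (abs_nonneg _)
              _ = _ := by ring
          have i1 : Integrable (fun ω => max (f ω) 0 * k v (u ω)) ν := by
            refine i0.mono (by have := (hrow v).comp hu; fun_prop) (ae_of_all _ fun ω => ?_)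
            rw [norm_mul, norm_mul, mul_comm]
            refine mul_le_mul_of_nonneg_left ?_ (norm_nonneg _)
            rw [Real.norm_eq_abs, Real.norm_eq_abs, abs_of_nonneg (le_max_right _ _)]
            exact max_le (le_abs_self _) (abs_nonneg _)
          have i2 : Integrable (fun ω => max (-f ω) 0 * k v (u ω)) ν := by
            refine i0.mono (by have := (hrow v).comp hu; fun_prop) (ae_of_all _ fun ω => ?_)
            rw [norm_mul, norm_mul, mul_comm]
            refine mul_le_mul_of_nonneg_left ?_ (norm_nonneg _)
            rw [Real.norm_eq_abs, Real.norm_eq_abs, abs_of_nonneg (le_max_right _ _)]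
            exact max_le (neg_le_abs _) (abs_nonneg _)
          rw [← sub_eq_zero, ← integral_sub i1 i2]
          refine (integral_congr_ae (ae_of_all _ fun ω => ?_)).trans (hkf0 v)
          change max (f ω) 0 * k v (u ω) - max (-f ω) 0 * k v (u ω) = k v (u ω) * f ω
          rw [← sub_mul, ← hfeq ω, mul_comm])
      have := congrArg (fun ρ : Measure U => ENNReal.ofReal c • ρ) key
      simpa [smul_smul, ENNReal.mul_inv_cancel hne hne'] using this
  have h1 : α f B = α (fun ω => -f ω) B := by rw [hmain]
  rw [hset f hfm B hB, hset _ hfm' B hB, hlint f hfp, hlint _ hfn,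
    ENNReal.ofReal_eq_ofReal_iff (integral_nonneg (fun ω => le_max_right (f ω) 0))
      (integral_nonneg (fun ω => le_max_right (-f ω) 0))] at h1
  calc ∫ ω in u ⁻¹' B, f ω ∂ν
      = ∫ ω in u ⁻¹' B, (max (f ω) 0 - max (-f ω) 0) ∂ν :=
        integral_congr_ae (ae_of_all _ hfeq)
    _ = 0 := by rw [integral_sub hfp.integrableOn hfn.integrableOn, h1, sub_self]

end Characteristic

/-- Bochner integrals commute with the inner product. Applied to a feature map, this turns inner
products of mean embeddings into double integrals of the kernel and supplies their integrability. -/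
lemma inner_integral_integral {S H : Type*} [MeasurableSpace S] [NormedAddCommGroup H]
    [InnerProductSpace ℝ H] [CompleteSpace H] {α β : Measure S} [SFinite α] [SFinite β]
    {Φ : S → H} (hα : Integrable Φ α) (hβ : Integrable Φ β) :
    Integrable (fun p : S × S => inner ℝ (Φ p.1) (Φ p.2)) (α.prod β) ∧
    inner ℝ (∫ x, Φ x ∂α) (∫ x, Φ x ∂β) = ∫ p, inner ℝ (Φ p.1) (Φ p.2) ∂(α.prod β) := by
  have hi : Integrable (fun p : S × S => inner ℝ (Φ p.1) (Φ p.2)) (α.prod β) := by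
    refine (hα.norm.mul_prod hβ.norm).mono' ?_ (ae_of_all _ fun p => norm_inner_le_norm _ _)
    exact hα.aestronglyMeasurable.comp_fst.inner hβ.aestronglyMeasurable.comp_snd
  refine ⟨hi, ?_⟩
  rw [integral_prod _ hi]
  have : ∀ x, ∫ y, inner ℝ (Φ x) (Φ y) ∂β = inner ℝ (Φ x) (∫ y, Φ y ∂β) := fun x =>
    integral_inner hβ (Φ x)
  simp_rw [this]
  rw [real_inner_comm, ← integral_inner hα]
  simp_rw [real_inner_comm]

/-- Passing through the feature map, Fubini needs only integrability of the diagonal of `κ`. -/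
lemma integral_integral_map_kernel {T S : Type*} [MeasurableSpace T] {Q : Measure T}
    [IsProbabilityMeasure Q] [TopologicalSpace S] [MeasurableSpace S] [BorelSpace S]
    [SecondCountableTopology S] {κ : S → S → ℝ} {f : T → S} (hf : Measurable f)
    (hκ : (Matrix.of κ).PosSemidef) (hκc : Continuous (Function.uncurry κ))
    (hκi : Integrable (fun x => κ x x) (Q.map f)) :
    ∫ x, ∫ x', κ x x' ∂(Q.map f) ∂(Q.map f) = ∫ p, κ (f p.1) (f p.2) ∂(Q.prod Q) := by
  obtain ⟨G, _, _, _, φ, hφ⟩ := exists_featureMap hκ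
  have hφc := continuous_featureMap hφ hκc
  have := Measure.isProbabilityMeasure_map (μ := Q) hf.aemeasurable
  have hφi : Integrable φ (Q.map f) := by
    refine (hκi.add (integrable_const (1 : ℝ))).mono' hφc.aestronglyMeasurable
      (ae_of_all _ fun w => ?_)
    rw [norm_eq_sqrt_real_inner, hφ]
    refine (sqrt_le_one_add (kernel_self_nonneg hκ w)).trans_eq ?_
    simp [add_comm]
  have hi := (inner_integral_integral hφi hφi).1
  simp_rw [hφ] at hi
  rw [← integral_prod (fun p : S × S => κ p.1 p.2) hi, Measure.map_prod_map Q Q hf hf]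
  exact integral_map (hf.prodMap hf).aemeasurable hκc.aestronglyMeasurable

/-! ### The criterion as a squared distance, and its zeros -/

section Hsic

variable {U V : Type*} [TopologicalSpace U] [MeasurableSpace U] [BorelSpace U]
  [SecondCountableTopology U] [TopologicalSpace V] [MeasurableSpace V] [BorelSpace V]
  [SecondCountableTopology V] {k : U → U → ℝ} {l : V → V → ℝ} {Q : Measure (U × V)}
  [IsProbabilityMeasure Q]

/-- The HSIC is the squared distance between the mean embeddings of the joint law and of the
product of its marginals. -/
theorem hsic_nonneg_and_integral_mul_eq (hk : (Matrix.of k).PosSemidef)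
    (hl : (Matrix.of l).PosSemidef)
    (hkc : Continuous (Function.uncurry k)) (hlc : Continuous (Function.uncurry l))
    (hki : Integrable (fun w => k w.1 w.1) Q) (hli : Integrable (fun w => l w.2 w.2) Q)
    (hkl : Integrable (fun w => k w.1 w.1 * l w.2 w.2) Q) :
    0 ≤ hsic k l Q ∧ (hsic k l Q = 0 → ∀ a b, ∫ w, k a w.1 * l b w.2 ∂Q =
      (∫ w, k a w.1 ∂Q) * ∫ w, l b w.2 ∂Q) := by
  -- The product kernel is positive semidefinite by the Schur product theorem, so it has a feature
  -- map of its own.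
  let K : U × V → U × V → ℝ := fun w w' => k w.1 w'.1 * l w.2 w'.2
  have hK : (Matrix.of K).PosSemidef :=
    (hk.submatrix (Prod.fst : U × V → U)).hadamard (hl.submatrix (Prod.snd : U × V → V))
  have hKc : Continuous (Function.uncurry K) := by
    have h1 : Continuous fun p : (U × V) × (U × V) => k p.1.1 p.2.1 :=
      hkc.comp (continuous_fst.fst.prodMk continuous_snd.fst)
    have h2 : Continuous fun p : (U × V) × (U × V) => l p.1.2 p.2.2 :=
      hlc.comp (continuous_fst.snd.prodMk continuous_snd.snd)
    exact h1.mul h2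
  obtain ⟨H, _, _, _, Φ, hΦ⟩ := exists_featureMap hK
  have hΦc := continuous_featureMap hΦ hKc
  have hkf : Integrable (fun x => k x x) Q.fst := by
    rw [Measure.fst, integrable_map_measure _ measurable_fst.aemeasurable]
    · exact hki
    · exact (hkc.comp (continuous_id.prodMk continuous_id)).aestronglyMeasurable
  have hls : Integrable (fun x => l x x) Q.snd := by
    rw [Measure.snd, integrable_map_measure _ measurable_snd.aemeasurable]
    · exact hli
    · exact (hlc.comp (continuous_id.prodMk continuous_id)).aestronglyMeasurable
  have hΦi : ∀ R : Measure (U × V), IsProbabilityMeasure R →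
      Integrable (fun w => k w.1 w.1 * l w.2 w.2) R → Integrable Φ R := by
    intro R _ hR
    refine (hR.add (integrable_const (1 : ℝ))).mono' hΦc.aestronglyMeasurable
      (ae_of_all _ fun w => ?_)
    rw [norm_eq_sqrt_real_inner, hΦ]
    refine (sqrt_le_one_add (kernel_self_nonneg hK w)).trans_eq ?_
    simp [K, add_comm]
  set Q' := Q.fst.prod Q.snd with hQ'
  have h1 : Integrable Φ Q := hΦi Q inferInstance hkl
  have h2 : Integrable Φ Q' := hΦi Q' inferInstance (hkf.mul_prod hls)
  -- The difference of the two mean embeddings. The three terms of `‖M‖²` are the three terms of the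
  -- criterion.
  set M := ∫ w, Φ w ∂Q - ∫ w, Φ w ∂Q' with hM
  have hrow : ∀ w, ∫ w', K w w' ∂Q' = (∫ x, k w.1 x ∂Q.fst) * ∫ y, l w.2 y ∂Q.snd := fun w =>
    integral_prod_mul (fun x => k w.1 x) (fun y => l w.2 y)
  have hkcol : ∀ a, ∫ x, k a x ∂Q.fst = ∫ w, k a w.1 ∂Q := fun a => by
    rw [Measure.fst, integral_map measurable_fst.aemeasurable]
    exact (hkc.comp (continuous_const.prodMk continuous_id)).aestronglyMeasurable
  have hlcol : ∀ b, ∫ y, l b y ∂Q.snd = ∫ w, l b w.2 ∂Q := fun b => by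
    rw [Measure.snd, integral_map measurable_snd.aemeasurable]
    exact (hlc.comp (continuous_const.prodMk continuous_id)).aestronglyMeasurable
  -- A draw from the product of the marginals is obtained from two independent draws of `Q`, taking
  -- the first coordinate of one and the second of the other; this produces the triple integral in
  -- the criterion.
  have hQQ' : Q.prod Q' = (Q.prod (Q.prod Q)).map fun p => (p.1, (p.2.1.1, p.2.2.2)) := by
    have := Measure.map_prod_map Q (Q.prod Q) measurable_id
      (g := fun p : (U × V) × (U × V) => (p.1.1, p.2.2)) (by fun_prop)
    have h3 := Measure.map_prod_map Q Q (f := (Prod.fst : U × V → U))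
      (g := (Prod.snd : U × V → V)) measurable_fst measurable_snd
    rw [Measure.map_id] at this
    have h4 : Measure.map (fun p : (U × V) × (U × V) => (p.1.1, p.2.2)) (Q.prod Q) = Q' :=
      h3.symm
    rw [h4] at this
    exact this
  have hQ'Q' : ∫ p, K p.1 p.2 ∂(Q'.prod Q') =
      (∫ p, k p.1.1 p.2.1 ∂(Q.prod Q)) * ∫ p, l p.1.2 p.2.2 ∂(Q.prod Q) := by
    have hi := (inner_integral_integral h2 h2).1
    simp_rw [hΦ] at hi
    rw [integral_prod _ hi]
    simp_rw [hrow]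
    rw [hQ', integral_prod_mul (fun x => ∫ x', k x x' ∂Q.fst) (fun y => ∫ y', l y y' ∂Q.snd)]
    congr 1
    · exact integral_integral_map_kernel measurable_fst hk hkc hkf
    · exact integral_integral_map_kernel measurable_snd hl hlc hls
  have hnorm : hsic k l Q = inner ℝ M M := by
    rw [hM, real_inner_sub_sub_self, (inner_integral_integral h1 h1).2,
      (inner_integral_integral h1 h2).2, (inner_integral_integral h2 h2).2]
    simp_rw [hΦ]
    rw [hQ'Q', hQQ', integral_map (φ := fun p : (U × V) × (U × V) × (U × V) =>
      (p.1, (p.2.1.1, p.2.2.2))) (f := fun p : (U × V) × (U × V) => K p.1 p.2)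
      (by fun_prop) hKc.aestronglyMeasurable]
    simp only [hsic, K]
    ring
  refine ⟨hnorm ▸ real_inner_self_nonneg, fun h0 a b => ?_⟩
  rw [hnorm, inner_self_eq_zero] at h0
  -- Pairing `M = 0` with a single feature vector evaluates the embeddings at `(a, b)`.
  have h3 : inner ℝ (Φ (a, b)) M = 0 := by rw [h0, inner_zero_right]
  rw [hM, inner_sub_right, ← integral_inner h1, ← integral_inner h2, sub_eq_zero] at h3
  simp_rw [hΦ] at h3
  rw [hrow, hkcol, hlcol] at h3
  exact h3

/-- With characteristic kernels, the HSIC vanishes only under independence. -/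
theorem eq_prod_of_hsic_eq_zero (hk : IsCharacteristicKernel k) (hl : IsCharacteristicKernel l)
    (hkc : Continuous (Function.uncurry k)) (hlc : Continuous (Function.uncurry l))
    (hki : Integrable (fun w => k w.1 w.1) Q) (hli : Integrable (fun w => l w.2 w.2) Q)
    (hkl : Integrable (fun w => k w.1 w.1 * l w.2 w.2) Q) (h0 : hsic k l Q = 0) :
    Q = Q.fst.prod Q.snd := by
  have hmain :=
    (hsic_nonneg_and_integral_mul_eq hk.posSemidef hl.posSemidef hkc hlc hki hli hkl).2 h0
  have hkrow : ∀ a, Measurable fun x => k a x := fun a =>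
    (hkc.comp (continuous_const.prodMk continuous_id)).measurable
  have hlrow : ∀ a, Measurable fun x => l a x := fun a =>
    (hlc.comp (continuous_const.prodMk continuous_id)).measurable
  have hkdiag : Measurable fun x => k x x :=
    (hkc.comp (continuous_id.prodMk continuous_id)).measurable
  have hldiag : Measurable fun x => l x x :=
    (hlc.comp (continuous_id.prodMk continuous_id)).measurable
  have hk0 := kernel_self_nonneg hk.posSemidef
  have hl0 := kernel_self_nonneg hl.posSemidef
  have hla : ∀ b, Integrable (fun w : U × V => l b w.2) Q := fun b =>
    (((integrable_const (1 : ℝ)).add hli).const_mul (√(l b b))).mono'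
      ((hlrow b).comp measurable_snd).aestronglyMeasurable
      (ae_of_all _ fun w => abs_kernel_le_one_add hl.posSemidef b w.2)
  have hka : ∀ b, Integrable (fun w : U × V => k b w.1) Q := fun b =>
    (((integrable_const (1 : ℝ)).add hki).const_mul (√(k b b))).mono'
      ((hkrow b).comp measurable_fst).aestronglyMeasurable
      (ae_of_all _ fun w => abs_kernel_le_one_add hk.posSemidef b w.1)
  have hkla : ∀ a b, Integrable (fun w : U × V => k a w.1 * l b w.2) Q := fun a b => by
    refine ((((integrable_const (1 : ℝ)).add hki).add (hli.add hkl)).const_mul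
      (√(k a a) * √(l b b))).mono'
      (((hkrow a).comp measurable_fst).mul ((hlrow b).comp measurable_snd)).aestronglyMeasurable
      (ae_of_all _ fun w => ?_)
    rw [Real.norm_eq_abs, abs_mul]
    calc _ ≤ (√(k a a) * (1 + k w.1 w.1)) * (√(l b b) * (1 + l w.2 w.2)) :=
          mul_le_mul (abs_kernel_le_one_add hk.posSemidef _ _)
            (abs_kernel_le_one_add hl.posSemidef _ _) (abs_nonneg _)
            (mul_nonneg (Real.sqrt_nonneg _) (by linarith [hk0 w.1]))
      _ = _ := by simp only [Pi.add_apply]; ring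
  have hklb : ∀ b, Integrable (fun w : U × V => k w.1 w.1 * l b w.2) Q := fun b => by
    refine ((hki.add hkl).const_mul (√(l b b))).mono'
      ((hkdiag.comp measurable_fst).mul ((hlrow b).comp measurable_snd)).aestronglyMeasurable
      (ae_of_all _ fun w => ?_)
    rw [Real.norm_eq_abs, abs_mul, abs_of_nonneg (hk0 w.1)]
    calc _ ≤ k w.1 w.1 * (√(l b b) * (1 + l w.2 w.2)) :=
          mul_le_mul_of_nonneg_left (abs_kernel_le_one_add hl.posSemidef _ _) (hk0 _)
      _ = _ := by simp only [Pi.add_apply]; ring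
  -- the conditional mean embedding of the second coordinate is constant
  have step1 : ∀ b (B : Set U), MeasurableSet B →
      ∫ w in Prod.fst ⁻¹' B, (l b w.2 - ∫ w', l b w'.2 ∂Q) ∂Q = 0 := by
    intro b B hB
    refine hk.setIntegral_eq_zero hkc.measurable (u := Prod.fst) measurable_fst
      (f := fun w => l b w.2 - ∫ w', l b w'.2 ∂Q) (((hlrow b).comp measurable_snd).sub_const _)
      ((hla b).sub (integrable_const _)) ?_ ?_
      (fun a => ?_) hB
    · simp_rw [mul_sub]
      exact (hklb b).sub (hki.mul_const _)
    · rw [integral_sub (hla b) (integrable_const _)]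
      simp
    · simp_rw [mul_sub]
      rw [integral_sub (hkla a b) ((hka a).mul_const _), hmain, integral_mul_const, sub_self]
  refine (Measure.prod_eq fun B C hB hC => ?_).symm
  have hBm : MeasurableSet (Prod.fst ⁻¹' B : Set (U × V)) := measurable_fst hB
  have hCm : MeasurableSet (Prod.snd ⁻¹' C : Set (U × V)) := measurable_snd hC
  classical
  set χ : U × V → ℝ := (Prod.fst ⁻¹' B).indicator 1 with hχ
  have hχm : Measurable χ := measurable_one.indicator hBm
  have hχb : ∀ w, |χ w| ≤ 1 := fun w => by
    rw [hχ, Set.indicator_apply]; split_ifs <;> simp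
  have hχi : Integrable χ Q := (integrable_const (1 : ℝ)).mono' hχm.aestronglyMeasurable
    (ae_of_all _ hχb)
  have hχint : ∫ w, χ w ∂Q = Q.real (Prod.fst ⁻¹' B) := by
    rw [hχ, integral_indicator_one hBm]
  have hmulχ : ∀ f : U × V → ℝ, (fun w => f w * χ w) = (Prod.fst ⁻¹' B).indicator f := by
    intro f
    ext w
    rw [hχ, Set.indicator_apply, Set.indicator_apply]
    split_ifs <;> simp
  -- The roles are now exchanged: the signed density is `χ - Q(B)`, pushed forward by the second
  -- coordinate. By `step1` its embedding under `l` vanishes, so it integrates to zero over `C`,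
  -- which is the factorization on rectangles.
  have step2 := hl.setIntegral_eq_zero hlc.measurable (ν := Q) (u := Prod.snd) measurable_snd
    (f := fun w => χ w - Q.real (Prod.fst ⁻¹' B)) (hχm.sub_const _)
    (hχi.sub (integrable_const _)) (by
      simp_rw [mul_sub]
      refine Integrable.sub ?_ (hli.mul_const _)
      rw [hmulχ]
      exact hli.indicator hBm) (by
      rw [integral_sub hχi (integrable_const _), hχint]
      simp) (fun b => by
      simp_rw [mul_sub]
      have hi : Integrable (fun w => l b w.2 * χ w) Q := by
        rw [hmulχ]
        exact (hla b).indicator hBm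
      rw [integral_sub hi ((hla b).mul_const _), hmulχ, integral_indicator hBm, integral_mul_const]
      have := step1 b B hB
      rw [integral_sub (hla b).integrableOn (integrable_const _)] at this
      simp only [integral_const, MeasurableSet.univ, measureReal_restrict_apply, Set.univ_inter,
        smul_eq_mul] at this
      linarith) hC
  rw [integral_sub hχi.integrableOn (integrable_const _), hχ, integral_indicator_one hBm] at step2
  simp only [integral_const, MeasurableSet.univ, measureReal_restrict_apply, Set.univ_inter,
    smul_eq_mul, hBm] at step2
  have h3 : Q.real (B ×ˢ C) = Q.fst.real B * Q.snd.real C := by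
    rw [measureReal_def, measureReal_def, measureReal_def, Measure.fst_apply hB,
      Measure.snd_apply hC, Set.prod_eq]
    simp only [measureReal_def] at step2
    linarith
  rw [measureReal_def, measureReal_def, measureReal_def, ← ENNReal.toReal_mul,
    ENNReal.toReal_eq_toReal_iff' (measure_ne_top _ _)
      (ENNReal.mul_ne_top (measure_ne_top _ _) (measure_ne_top _ _))] at h3
  exact h3

end Hsic

/-! ### Stochastic order symbols -/

section StochasticOrder

variable {Ω : Type*} {mΩ : MeasurableSpace Ω} {μ : Measure Ω} {Z Z' : ℕ → Ω → ℝ}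

/-- `Z n = O_P(1)`. -/
def BoundedInProb (μ : Measure Ω) (Z : ℕ → Ω → ℝ) : Prop :=
  ∀ ε : ENNReal, 0 < ε → ∃ M : ℝ, 0 < M ∧ ∀ᶠ n in atTop, μ {ω | M ≤ |Z n ω|} ≤ ε

/-- `Z n = o_P(1)`. -/
def NullInProb (μ : Measure Ω) (Z : ℕ → Ω → ℝ) : Prop :=
  ∀ ε : ℝ, 0 < ε → Tendsto (fun n => μ {ω | ε ≤ |Z n ω|}) atTop (𝓝 0)

lemma nullInProb_iff_tendstoInMeasure : NullInProb μ Z ↔ TendstoInMeasure μ Z atTop 0 := by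
  rw [tendstoInMeasure_iff_norm]
  simp [NullInProb]

/-- Bounds need only hold on events `G n` of probability tending to one. Besides genuinely random
events, this is used to discard `n = 0`, where divisions by `n` take default values. -/
lemma NullInProb.mono_on (h : NullInProb μ Z) {G : ℕ → Set Ω}
    (hG : Tendsto (fun n => μ (G n)ᶜ) atTop (𝓝 0)) (hle : ∀ n, ∀ ω ∈ G n, |Z' n ω| ≤ |Z n ω|) :
    NullInProb μ Z' := by
  intro ε hε
  have h1 := (h ε hε).add hG
  rw [add_zero] at h1
  refine tendsto_of_tendsto_of_tendsto_of_le_of_le tendsto_const_nhds h1 (fun _ => zero_le)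
    fun n => ?_
  refine (measure_mono ?_).trans (measure_union_le _ _)
  intro ω hω
  by_cases hg : ω ∈ G n
  · exact Or.inl (le_trans hω (hle n ω hg))
  · exact Or.inr hg

lemma NullInProb.mono (h : NullInProb μ Z) (hle : ∀ n ω, |Z' n ω| ≤ |Z n ω|) :
    NullInProb μ Z' :=
  h.mono_on (G := fun _ => Set.univ) (by simp) fun n ω _ => hle n ω

lemma BoundedInProb.mono_on (h : BoundedInProb μ Z) {G : ℕ → Set Ω}
    (hG : Tendsto (fun n => μ (G n)ᶜ) atTop (𝓝 0)) (hle : ∀ n, ∀ ω ∈ G n, |Z' n ω| ≤ |Z n ω|) :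
    BoundedInProb μ Z' := by
  intro ε hε
  obtain ⟨M, hM, h1⟩ := h (ε / 2) (ENNReal.half_pos hε.ne')
  refine ⟨M, hM, ?_⟩
  filter_upwards [h1, hG.eventually (ge_mem_nhds (ENNReal.half_pos hε.ne'))] with n h2 h3
  rw [← ENNReal.add_halves ε]
  refine le_trans ?_ (add_le_add h2 h3)
  refine (measure_mono ?_).trans (measure_union_le _ _)
  intro ω hω
  by_cases hg : ω ∈ G n
  · exact Or.inl (le_trans hω (hle n ω hg))
  · exact Or.inr hg

lemma BoundedInProb.mono (h : BoundedInProb μ Z) (hle : ∀ n ω, |Z' n ω| ≤ |Z n ω|) :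
    BoundedInProb μ Z' :=
  h.mono_on (G := fun _ => Set.univ) (by simp) fun n ω _ => hle n ω

lemma NullInProb.add (h : NullInProb μ Z) (h' : NullInProb μ Z') :
    NullInProb μ fun n ω => Z n ω + Z' n ω := by
  intro ε hε
  have h1 := (h (ε / 2) (half_pos hε)).add (h' (ε / 2) (half_pos hε))
  rw [add_zero] at h1
  refine tendsto_of_tendsto_of_tendsto_of_le_of_le tendsto_const_nhds h1 (fun _ => zero_le)
    fun n => ?_
  refine (measure_mono ?_).trans (measure_union_le _ _)
  intro ω hω
  by_contra hc
  simp only [Set.mem_union, Set.mem_ofPred_eq, not_or, not_le] at hc hω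
  linarith [abs_add_le (Z n ω) (Z' n ω)]

lemma nullInProb_zero : NullInProb μ fun _ _ => 0 := by
  intro ε hε
  simp [not_le.mpr hε]

lemma NullInProb.sum {ι : Type*} (s : Finset ι) {Y : ι → ℕ → Ω → ℝ}
    (h : ∀ i ∈ s, NullInProb μ (Y i)) : NullInProb μ fun n ω => ∑ i ∈ s, Y i n ω := by
  classical
  induction s using Finset.induction_on with
  | empty => simpa using nullInProb_zero
  | insert a s ha ih =>
    simp_rw [Finset.sum_insert ha]
    exact (h a (by simp)).add (ih fun i hi => h i (by simp [hi]))

lemma BoundedInProb.add (h : BoundedInProb μ Z) (h' : BoundedInProb μ Z') :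
    BoundedInProb μ fun n ω => Z n ω + Z' n ω := by
  intro ε hε
  obtain ⟨M, hM, h1⟩ := h (ε / 2) (ENNReal.half_pos hε.ne')
  obtain ⟨M', hM', h1'⟩ := h' (ε / 2) (ENNReal.half_pos hε.ne')
  refine ⟨M + M', add_pos hM hM', ?_⟩
  filter_upwards [h1, h1'] with n h2 h3
  rw [← ENNReal.add_halves ε]
  refine le_trans ?_ (add_le_add h2 h3)
  refine (measure_mono ?_).trans (measure_union_le _ _)
  intro ω hω
  by_contra hc
  simp only [Set.mem_union, Set.mem_ofPred_eq, not_or, not_le] at hc hω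
  linarith [abs_add_le (Z n ω) (Z' n ω)]

lemma BoundedInProb.mul (h : BoundedInProb μ Z) (h' : BoundedInProb μ Z') :
    BoundedInProb μ fun n ω => Z n ω * Z' n ω := by
  intro ε hε
  obtain ⟨M, hM, h1⟩ := h (ε / 2) (ENNReal.half_pos hε.ne')
  obtain ⟨M', hM', h1'⟩ := h' (ε / 2) (ENNReal.half_pos hε.ne')
  refine ⟨M * M', mul_pos hM hM', ?_⟩
  filter_upwards [h1, h1'] with n h2 h3
  rw [← ENNReal.add_halves ε]
  refine le_trans ?_ (add_le_add h2 h3)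
  refine (measure_mono ?_).trans (measure_union_le _ _)
  intro ω hω
  by_contra hc
  simp only [Set.mem_union, Set.mem_ofPred_eq, not_or, not_le, abs_mul] at hc hω
  exact absurd (mul_lt_mul'' hc.1 hc.2 (abs_nonneg _) (abs_nonneg _)) (not_lt.mpr hω)

lemma NullInProb.mul (h : NullInProb μ Z) (h' : BoundedInProb μ Z') :
    NullInProb μ fun n ω => Z n ω * Z' n ω := by
  intro ε hε
  rw [ENNReal.tendsto_nhds_zero]
  intro δ hδ
  obtain ⟨M, hM, h1⟩ := h' (δ / 2) (ENNReal.half_pos hδ.ne')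
  filter_upwards [h1, (h (ε / M) (div_pos hε hM)).eventually
    (ge_mem_nhds (ENNReal.half_pos hδ.ne'))] with n h2 h3
  rw [← ENNReal.add_halves δ]
  refine le_trans ?_ (add_le_add h3 h2)
  refine (measure_mono ?_).trans (measure_union_le _ _)
  intro ω hω
  by_contra hc
  simp only [Set.mem_union, Set.mem_ofPred_eq, not_or, not_le, abs_mul] at hc hω
  have := mul_lt_mul'' hc.1 hc.2 (abs_nonneg _) (abs_nonneg _)
  rw [div_mul_cancel₀ _ hM.ne'] at this
  linarith

lemma NullInProb.boundedInProb (h : NullInProb μ Z) : BoundedInProb μ Z := fun _ hε =>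
  ⟨1, one_pos, (h 1 one_pos).eventually (ge_mem_nhds hε)⟩

lemma boundedInProb_const [IsFiniteMeasure μ] (c : ℝ) : BoundedInProb μ fun _ _ => c :=
  fun ε hε => ⟨|c| + 1, by positivity, Eventually.of_forall fun _ => by
    simp [show ¬ |c| + 1 ≤ |c| by linarith]⟩

lemma NullInProb.const_mul [IsFiniteMeasure μ] (h : NullInProb μ Z) (c : ℝ) :
    NullInProb μ fun n ω => c * Z n ω := by
  simpa [mul_comm] using h.mul (boundedInProb_const c)

lemma BoundedInProb.const_mul [IsFiniteMeasure μ] (h : BoundedInProb μ Z) (c : ℝ) :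
    BoundedInProb μ fun n ω => c * Z n ω := (boundedInProb_const c).mul h

lemma BoundedInProb.sum [IsFiniteMeasure μ] {ι : Type*} (s : Finset ι) {Y : ι → ℕ → Ω → ℝ}
    (h : ∀ i ∈ s, BoundedInProb μ (Y i)) : BoundedInProb μ fun n ω => ∑ i ∈ s, Y i n ω := by
  classical
  induction s using Finset.induction_on with
  | empty => simpa using boundedInProb_const (μ := μ) 0
  | insert a s ha ih =>
    simp_rw [Finset.sum_insert ha]
    exact (h a (by simp)).add (ih fun i hi => h i (by simp [hi]))

lemma BoundedInProb.abs (h : BoundedInProb μ Z) : BoundedInProb μ fun n ω => |Z n ω| :=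
  h.mono fun n ω => by simp

lemma NullInProb.abs (h : NullInProb μ Z) : NullInProb μ fun n ω => |Z n ω| :=
  h.mono fun n ω => by simp

/-- Markov's inequality. -/
lemma measure_le_abs_le {Y : Ω → ℝ} (hY : Integrable Y μ) {M : ℝ} (hM : 0 < M) :
    μ {ω | M ≤ |Y ω|} ≤ ENNReal.ofReal ((∫ ω, |Y ω| ∂μ) / M) := by
  have h1 := meas_ge_le_lintegral_div (μ := μ) (f := fun ω => ENNReal.ofReal |Y ω|)
    hY.abs.aemeasurable.ennreal_ofReal (ε := ENNReal.ofReal M) (by simpa using hM)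
    ENNReal.ofReal_ne_top
  rw [ENNReal.ofReal_div_of_pos hM,
    ofReal_integral_eq_lintegral_ofReal hY.abs (ae_of_all _ fun ω => abs_nonneg _)]
  refine le_trans (measure_mono fun ω hω => ?_) h1
  exact ENNReal.ofReal_le_ofReal hω

lemma boundedInProb_of_integral_le (hZ : ∀ n, Integrable (Z n) μ) {C : ℝ}
    (hC : ∀ n, ∫ ω, |Z n ω| ∂μ ≤ C) : BoundedInProb μ Z := by
  intro ε hε
  have hlim : Tendsto (fun M : ℝ => ENNReal.ofReal (C / M)) atTop (𝓝 0) := by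
    rw [← ENNReal.ofReal_zero]
    exact (ENNReal.continuous_ofReal.tendsto 0).comp (tendsto_const_nhds.div_atTop tendsto_id)
  obtain ⟨M, hM, hM0⟩ := ((hlim.eventually (ge_mem_nhds hε)).and (eventually_gt_atTop 0)).exists
  refine ⟨M, hM0, Eventually.of_forall fun n => ?_⟩
  refine (measure_le_abs_le (hZ n) hM0).trans (le_trans (ENNReal.ofReal_le_ofReal ?_) hM)
  gcongr
  exact hC n

lemma nullInProb_of_integral_tendsto (hZ : ∀ n, Integrable (Z n) μ)
    (hC : Tendsto (fun n => ∫ ω, |Z n ω| ∂μ) atTop (𝓝 0)) : NullInProb μ Z := by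
  intro ε hε
  have hlim : Tendsto (fun n => ENNReal.ofReal ((∫ ω, |Z n ω| ∂μ) / ε)) atTop (𝓝 0) := by
    rw [← ENNReal.ofReal_zero]
    refine (ENNReal.continuous_ofReal.tendsto 0).comp ?_
    simpa using hC.div_const ε
  exact tendsto_of_tendsto_of_tendsto_of_le_of_le tendsto_const_nhds hlim (fun _ => zero_le)
    fun n => measure_le_abs_le (hZ n) hε

lemma sq_integral_le [IsProbabilityMeasure μ] {Y : Ω → ℝ} (hY : MemLp Y 2 μ) :
    (∫ ω, Y ω ∂μ) ^ 2 ≤ ∫ ω, Y ω ^ 2 ∂μ := by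
  have h1 := variance_nonneg Y μ
  rw [variance_eq_sub hY] at h1
  simpa using h1

lemma integral_abs_le_sqrt [IsProbabilityMeasure μ] {Y : Ω → ℝ} (hY : MemLp Y 2 μ) :
    ∫ ω, |Y ω| ∂μ ≤ √(∫ ω, Y ω ^ 2 ∂μ) := by
  refine Real.le_sqrt_of_sq_le ?_
  have := sq_integral_le hY.abs
  simpa using this

/-- A sequence is `o_P(1)` if it can be approximated by such sequences, uniformly in `L¹`. -/
lemma nullInProb_of_approx {Y : ℕ → ℕ → Ω → ℝ} {c : ℕ → ℝ}
    (hY : ∀ M, NullInProb μ (Y M)) (hi : ∀ M n, Integrable (fun ω => Z n ω - Y M n ω) μ)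
    (hle : ∀ M n, ∫ ω, |Z n ω - Y M n ω| ∂μ ≤ c M) (hc : Tendsto c atTop (𝓝 0)) :
    NullInProb μ Z := by
  intro ε hε
  rw [ENNReal.tendsto_nhds_zero]
  intro δ hδ
  have hlim : Tendsto (fun M => ENNReal.ofReal (c M / (ε / 2))) atTop (𝓝 0) := by
    rw [← ENNReal.ofReal_zero]
    refine (ENNReal.continuous_ofReal.tendsto 0).comp ?_
    simpa using hc.div_const (ε / 2)
  obtain ⟨M, hM⟩ := (hlim.eventually (ge_mem_nhds (ENNReal.half_pos hδ.ne'))).exists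
  filter_upwards [(hY M (ε / 2) (half_pos hε)).eventually
    (ge_mem_nhds (ENNReal.half_pos hδ.ne'))] with n hn
  rw [← ENNReal.add_halves δ]
  refine le_trans ?_ (add_le_add hM hn)
  have h1 := (measure_le_abs_le (hi M n) (half_pos hε)).trans
    (ENNReal.ofReal_le_ofReal (div_le_div_of_nonneg_right (hle M n) (half_pos hε).le))
  refine le_trans ?_ (add_le_add h1 le_rfl)
  refine (measure_mono ?_).trans (measure_union_le _ _)
  intro ω hω
  by_contra hcon
  simp only [Set.mem_union, Set.mem_ofPred_eq, not_or, not_le] at hcon hω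
  have := abs_add_le (Z n ω - Y M n ω) (Y M n ω)
  rw [sub_add_cancel] at this
  linarith [hcon.1, hcon.2]

end StochasticOrder

/-! ### V-statistics of order four -/

section VStatistic

variable {E Ω : Type*} [MeasurableSpace E] {mΩ : MeasurableSpace Ω} {μ : Measure Ω}
  [IsProbabilityMeasure μ] {Q : Measure E} [IsProbabilityMeasure Q] {W : ℕ → Ω → E}
  {f : (Fin 4 → E) → ℝ}

/-- The V-statistic `n⁻⁴ ∑ f (w (a 0), …, w (a 3))`. -/
noncomputable def vstat {E : Type*} (f : (Fin 4 → E) → ℝ) (n : ℕ) (w : ℕ → E) : ℝ :=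
  ((n : ℝ) ^ 4)⁻¹ * ∑ a : Fin 4 → Fin n, f fun i => w (a i)

/-- `f` is integrable under the fourfold product, whichever arguments are identified. -/
def PatternIntegrable (Q : Measure E) (f : (Fin 4 → E) → ℝ) : Prop :=
  ∀ p : Fin 4 → Fin 4, Integrable (fun w : Fin 4 → E => f fun i => w (p i))
    (Measure.pi fun _ => Q)

/-- The sum of the `L¹` norms of `f` over all the identifications of its arguments. -/
noncomputable def patternNorm (Q : Measure E) (f : (Fin 4 → E) → ℝ) : ℝ :=
  ∑ p : Fin 4 → Fin 4, ∫ w : Fin 4 → E, |f fun i => w (p i)| ∂(Measure.pi fun _ => Q)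

lemma hasLaw_tuple (hW : ∀ i, HasLaw (W i) Q μ) (hind : iIndepFun W μ) {ι : Type*} [Fintype ι]
    {a : ι → ℕ} (ha : Function.Injective a) :
    HasLaw (fun ω i => W (a i) ω) (Measure.pi fun _ => Q) μ :=
  (hind.precomp ha).hasLaw_pi fun i => hW (a i)

/-- Enlarging the set of values of `a` to exactly four indices writes the tuple as an injective one
with arguments identified by `p`. The law of any four observations, repeated or not, is thus read
off the fourfold product. -/
lemma exists_pattern (a : Fin 4 → ℕ) :
    ∃ (p : Fin 4 → Fin 4) (a' : Fin 4 → ℕ), Function.Injective a' ∧ ∀ i, a i = a' (p i) := by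
  classical
  obtain ⟨S, hS, hcard⟩ := Infinite.exists_superset_card_eq (Finset.univ.image a) 4
    (Finset.card_image_le.trans (by simp))
  let e : S ≃ Fin 4 := Fintype.equivFinOfCardEq (by simpa using hcard)
  refine ⟨fun i => e ⟨a i, hS (Finset.mem_image_of_mem a (Finset.mem_univ i))⟩,
    fun i => (e.symm i : ℕ), fun i j h => e.symm.injective (Subtype.ext h), fun i => by simp⟩

lemma PatternIntegrable.integrable (hf : PatternIntegrable Q f) :
    Integrable f (Measure.pi fun _ => Q) := hf id

lemma PatternIntegrable.integrable_tuple (hf : PatternIntegrable Q f)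
    (hW : ∀ i, HasLaw (W i) Q μ) (hind : iIndepFun W μ) (a : Fin 4 → ℕ) :
    Integrable (fun ω => f fun i => W (a i) ω) μ := by
  obtain ⟨p, a', ha', h⟩ := exists_pattern a
  have hl := hasLaw_tuple hW hind ha'
  have h1 := hf p
  rw [← hl.map_eq] at h1
  simpa [h, Function.comp_def] using h1.comp_aemeasurable hl.aemeasurable

/-- The bound is uniform in the tuple because there are only finitely many patterns, and
`patternNorm` adds up all of them. -/
lemma PatternIntegrable.integral_abs_tuple_le (hf : PatternIntegrable Q f)
    (hW : ∀ i, HasLaw (W i) Q μ) (hind : iIndepFun W μ) (a : Fin 4 → ℕ) :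
    ∫ ω, |f fun i => W (a i) ω| ∂μ ≤ patternNorm Q f := by
  obtain ⟨p, a', ha', h⟩ := exists_pattern a
  have hl := hasLaw_tuple hW hind ha'
  have h1 := hl.integral_comp (f := fun w => |f fun i => w (p i)|) (hf p).abs.aestronglyMeasurable
  have h2 : ∫ ω, |f fun i => W (a i) ω| ∂μ =
      ∫ w : Fin 4 → E, |f fun i => w (p i)| ∂(Measure.pi fun _ => Q) := by
    rw [← h1]
    simp [h]
  rw [h2]
  exact Finset.single_le_sum (f := fun p : Fin 4 → Fin 4 =>
    ∫ w : Fin 4 → E, |f fun i => w (p i)| ∂(Measure.pi fun _ => Q))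
    (fun q _ => integral_nonneg fun w => abs_nonneg _) (Finset.mem_univ p)

lemma patternNorm_nonneg : 0 ≤ patternNorm Q f :=
  Finset.sum_nonneg fun _ _ => integral_nonneg fun _ => abs_nonneg _

lemma integral_abs_sum_tuple_le (hf : PatternIntegrable Q f)
    (hW : ∀ i, HasLaw (W i) Q μ) (hind : iIndepFun W μ) {n : ℕ} (s : Finset (Fin 4 → Fin n)) :
    ∫ ω, |∑ a ∈ s, f fun i => W (a i) ω| ∂μ ≤ s.card * patternNorm Q f := by
  have hi : ∀ a : Fin 4 → Fin n, Integrable (fun ω => f fun i => W (a i) ω) μ := fun a =>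
    hf.integrable_tuple hW hind fun i => (a i : ℕ)
  calc ∫ ω, |∑ a ∈ s, f fun i => W (a i) ω| ∂μ
      ≤ ∫ ω, ∑ a ∈ s, |f fun i => W (a i) ω| ∂μ :=
        integral_mono (integrable_finsetSum _ fun a _ => hi a).abs
          (integrable_finsetSum _ fun a _ => (hi a).abs)
          fun ω => Finset.abs_sum_le_sum_abs _ _
    _ = ∑ a ∈ s, ∫ ω, |f fun i => W (a i) ω| ∂μ :=
        integral_finsetSum _ fun a _ => (hi a).abs
    _ ≤ ∑ a ∈ s, patternNorm Q f := Finset.sum_le_sum fun a _ =>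
        hf.integral_abs_tuple_le hW hind fun i => (a i : ℕ)
    _ = _ := by simp

lemma PatternIntegrable.integrable_vstat (hf : PatternIntegrable Q f)
    (hW : ∀ i, HasLaw (W i) Q μ) (hind : iIndepFun W μ) (n : ℕ) :
    Integrable (fun ω => vstat f n fun i => W i ω) μ :=
  (integrable_finsetSum _ fun a _ =>
    hf.integrable_tuple hW hind fun i => ((a i : Fin n) : ℕ)).const_mul _

lemma PatternIntegrable.integral_abs_vstat_le (hf : PatternIntegrable Q f)
    (hW : ∀ i, HasLaw (W i) Q μ) (hind : iIndepFun W μ) (n : ℕ) :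
    ∫ ω, |vstat f n fun i => W i ω| ∂μ ≤ patternNorm Q f := by
  simp only [vstat, abs_mul, integral_const_mul]
  have h1 := integral_abs_sum_tuple_le hf hW hind (Finset.univ : Finset (Fin 4 → Fin n))
  have hc : ((Finset.univ : Finset (Fin 4 → Fin n)).card : ℝ) = (n : ℝ) ^ 4 := by simp
  rw [hc] at h1
  rw [abs_of_nonneg (by positivity)]
  calc _ ≤ ((n : ℝ) ^ 4)⁻¹ * ((n : ℝ) ^ 4 * patternNorm Q f) := by gcongr
    _ = (((n : ℝ) ^ 4)⁻¹ * (n : ℝ) ^ 4) * patternNorm Q f := by ring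
    _ ≤ 1 * patternNorm Q f :=
      mul_le_mul_of_nonneg_right (inv_mul_le_one) patternNorm_nonneg
    _ = _ := one_mul _

lemma PatternIntegrable.boundedInProb_vstat (hf : PatternIntegrable Q f)
    (hW : ∀ i, HasLaw (W i) Q μ) (hind : iIndepFun W μ) :
    BoundedInProb μ fun n ω => vstat f n fun i => W i ω :=
  boundedInProb_of_integral_le (hf.integrable_vstat hW hind) (hf.integral_abs_vstat_le hW hind)

lemma PatternIntegrable.sub {f' : (Fin 4 → E) → ℝ} (hf : PatternIntegrable Q f)
    (hf' : PatternIntegrable Q f') : PatternIntegrable Q fun w => f w - f' w :=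
  fun p => (hf p).sub (hf' p)

lemma PatternIntegrable.sum {ι : Type*} (s : Finset ι) {F : ι → (Fin 4 → E) → ℝ}
    (hf : ∀ i ∈ s, PatternIntegrable Q (F i)) : PatternIntegrable Q fun w => ∑ i ∈ s, F i w :=
  fun p => integrable_finsetSum s fun i hi => hf i hi p

lemma patternIntegrable_const (c : ℝ) : PatternIntegrable Q fun _ => c :=
  fun _ => integrable_const c

lemma patternIntegrable_coord {h : E → ℝ} (hh : Integrable h Q) (i : Fin 4) :
    PatternIntegrable Q fun w => h (w i) := fun p =>
  (measurePreserving_eval (fun _ : Fin 4 => Q) (p i)).integrable_comp_of_integrable hh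

lemma PatternIntegrable.mono {f' : (Fin 4 → E) → ℝ} (hf : PatternIntegrable Q f)
    (hm : Measurable f') (h : ∀ w, |f' w| ≤ |f w|) : PatternIntegrable Q f' := fun p =>
  (hf p).mono
    (hm.comp (measurable_pi_lambda _ fun i => measurable_pi_apply (p i))).aestronglyMeasurable
    (ae_of_all _ fun _ => h _)

/-! ### The Hoeffding projection -/

/-- The centred projection of `f` on its `i`-th argument. -/
noncomputable def proj (Q : Measure E) (f : (Fin 4 → E) → ℝ) (i : Fin 4) (x : E) : ℝ :=
  ∫ w, f (Function.update w i x) ∂(Measure.pi fun _ => Q) - ∫ w, f w ∂(Measure.pi fun _ => Q)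

/-- The remainder of `f` after projection. -/
noncomputable def projRem (Q : Measure E) (f : (Fin 4 → E) → ℝ) (w : Fin 4 → E) : ℝ :=
  f w - ∫ w, f w ∂(Measure.pi fun _ => Q) - ∑ i, proj Q f i (w i)

lemma measurable_update_pair (i : Fin 4) :
    Measurable fun p : (Fin 4 → E) × E => Function.update p.1 i p.2 := by
  refine measurable_pi_lambda _ fun j => ?_
  by_cases h : j = i
  · subst h
    simpa using measurable_snd
  · simp only [Function.update_of_ne h]
    exact (measurable_pi_apply j).comp measurable_fst

/-- Replacing one coordinate of an i.i.d. vector by an independent copy does not change its law. -/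
lemma measurePreserving_update (i : Fin 4) :
    MeasurePreserving (fun p : (Fin 4 → E) × E => Function.update p.1 i p.2)
      ((Measure.pi fun _ => Q).prod Q) (Measure.pi fun _ => Q) := by
  refine ⟨measurable_update_pair i, (Measure.pi_eq fun s hs => ?_).symm⟩
  rw [Measure.map_apply (measurable_update_pair i) (MeasurableSet.univ_pi hs)]
  have h1 : (fun p : (Fin 4 → E) × E => Function.update p.1 i p.2) ⁻¹' Set.univ.pi s =
      (Set.univ.pi (Function.update s i Set.univ)) ×ˢ s i := by
    ext ⟨w, x⟩
    simp only [Set.mem_preimage, Set.mem_pi, Set.mem_univ, true_imp_iff, Set.mem_prod]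
    constructor
    · intro h
      refine ⟨fun j => ?_, by simpa using h i⟩
      by_cases hj : j = i
      · subst hj; simp
      · simpa [hj] using h j
    · rintro ⟨h, hx⟩ j
      by_cases hj : j = i
      · subst hj; simpa using hx
      · simpa [hj] using h j
  rw [h1, Measure.prod_prod, Measure.pi_pi, ← Finset.mul_prod_erase _ _ (Finset.mem_univ i),
    ← Finset.mul_prod_erase _ (fun j => Q (s j)) (Finset.mem_univ i)]
  simp only [Function.update_self, measure_univ, one_mul]
  rw [mul_comm]
  congr 1
  refine Finset.prod_congr rfl fun j hj => ?_
  rw [Function.update_of_ne (Finset.ne_of_mem_erase hj)]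

lemma measurable_proj (hf : Measurable f) (i : Fin 4) : Measurable (proj Q f i) := by
  have h := (hf.comp (measurable_update_pair i)).stronglyMeasurable
  exact (h.integral_prod_left' (μ := Measure.pi fun _ => Q)).measurable.sub_const _

lemma measurable_projRem (hf : Measurable f) : Measurable (projRem Q f) := by
  refine (hf.sub_const _).sub (Finset.measurable_fun_sum _ fun i _ => ?_)
  exact (measurable_proj hf i).comp (measurable_pi_apply i)

/-- Conditional expectation contracts `L²`: Jensen's inequality on almost every section, then
Fubini. -/
lemma memLp_proj (hf : Measurable f) (h2 : MemLp f 2 (Measure.pi fun _ => Q)) (i : Fin 4) :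
    MemLp (proj Q f i) 2 Q := by
  have hmp := measurePreserving_update (Q := Q) i
  have h3 := h2.comp_measurePreserving hmp
  have hsq : Integrable (fun p : (Fin 4 → E) × E => f (Function.update p.1 i p.2) ^ 2)
      ((Measure.pi fun _ => Q).prod Q) := h3.integrable_sq
  have hae := hsq.prod_left_ae
  have h4 : MemLp (fun x => ∫ w, f (Function.update w i x) ∂(Measure.pi fun _ => Q)) 2 Q := by
    have hm := (measurable_proj (Q := Q) hf i).add_const (∫ w, f w ∂(Measure.pi fun _ => Q))
    simp only [proj, sub_add_cancel] at hm
    rw [memLp_two_iff_integrable_sq hm.aestronglyMeasurable]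
    refine hsq.integral_prod_right.mono' (hm.pow_const 2).aestronglyMeasurable ?_
    filter_upwards [hae] with x hx
    rw [Real.norm_eq_abs, abs_of_nonneg (sq_nonneg _)]
    refine sq_integral_le ((memLp_two_iff_integrable_sq ?_).mpr hx)
    exact (hf.comp ((measurable_update_pair i).comp
      (measurable_id.prodMk measurable_const))).aestronglyMeasurable
  exact h4.sub (memLp_const _)

lemma integral_proj (hf : Integrable f (Measure.pi fun _ => Q)) (i : Fin 4) :
    ∫ x, proj Q f i x ∂Q = 0 := by
  have hmp := measurePreserving_update (Q := Q) i
  have h1 := hmp.integrable_comp_of_integrable hf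
  have h2 : ∫ x, ∫ w, f (Function.update w i x) ∂(Measure.pi fun _ => Q) ∂Q =
      ∫ w, f w ∂(Measure.pi fun _ => Q) := by
    conv_rhs => rw [← hmp.map_eq]
    rw [integral_map hmp.measurable.aemeasurable
      (by rw [hmp.map_eq]; exact hf.aestronglyMeasurable)]
    exact (integral_prod_symm _ h1).symm
  have h3 : Integrable (fun x => ∫ w, f (Function.update w i x) ∂(Measure.pi fun _ => Q)) Q :=
    h1.integral_prod_right
  simp only [proj]
  rw [integral_sub h3 (integrable_const _), h2]
  simp

lemma integrable_coord {h : E → ℝ} (hh : Integrable h Q) (i : Fin 4) :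
    Integrable (fun w : Fin 4 → E => h (w i)) (Measure.pi fun _ => Q) :=
  (measurePreserving_eval (fun _ : Fin 4 => Q) i).integrable_comp_of_integrable hh

lemma integral_coord {h : E → ℝ} (hh : Integrable h Q) (i : Fin 4) :
    ∫ w : Fin 4 → E, h (w i) ∂(Measure.pi fun _ => Q) = ∫ x, h x ∂Q := by
  have hmp := measurePreserving_eval (fun _ : Fin 4 => Q) i
  conv_rhs => rw [← hmp.map_eq]
  rw [integral_map hmp.measurable.aemeasurable (by rw [hmp.map_eq]; exact hh.aestronglyMeasurable)]

/-- Complete degeneracy at first order: with argument `i` frozen, the mean of `f` minus its overall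
mean is exactly `proj Q f i x`, and the other projections are centred. -/
lemma integral_projRem_update (hf : Measurable f) (h2 : MemLp f 2 (Measure.pi fun _ => Q))
    (i : Fin 4) :
    ∀ᵐ x ∂Q, ∫ w, projRem Q f (Function.update w i x) ∂(Measure.pi fun _ => Q) = 0 := by
  have hfi := h2.integrable one_le_two
  have hmp := measurePreserving_update (Q := Q) i
  have hpi : ∀ j, Integrable (proj Q f j) Q := fun j => (memLp_proj hf h2 j).integrable one_le_two
  filter_upwards [(hmp.integrable_comp_of_integrable hfi).prod_left_ae] with x hx
  have hx' : Integrable (fun w => f (Function.update w i x)) (Measure.pi fun _ => Q) := hx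
  have hj : ∀ j, Integrable (fun w : Fin 4 → E => proj Q f j (Function.update w i x j))
      (Measure.pi fun _ => Q) ∧ ∫ w : Fin 4 → E, proj Q f j (Function.update w i x j)
        ∂(Measure.pi fun _ => Q) = if j = i then proj Q f i x else 0 := by
    intro j
    by_cases h : j = i
    · subst h; simp
    · simp only [Function.update_of_ne h, h, if_false]
      exact ⟨integrable_coord (hpi j) j, by rw [integral_coord (hpi j), integral_proj hfi]⟩
  have hx'' : Integrable (fun w => f (Function.update w i x) -
      ∫ w, f w ∂(Measure.pi fun _ => Q)) (Measure.pi fun _ => Q) := hx'.sub (integrable_const _)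
  simp only [projRem]
  rw [integral_sub hx'' (integrable_finsetSum _ fun j _ => (hj j).1),
    integral_sub hx' (integrable_const _), integral_finsetSum _ fun j _ => (hj j).1]
  simp only [(hj _).2, Finset.sum_ite_eq', Finset.mem_univ, if_true]
  simp [proj]

lemma memLp_projRem (hf : Measurable f) (h2 : MemLp f 2 (Measure.pi fun _ => Q)) :
    MemLp (projRem Q f) 2 (Measure.pi fun _ => Q) := by
  refine (h2.sub (memLp_const _)).sub (memLp_finsetSum _ fun i _ => ?_)
  exact (memLp_proj hf h2 i).comp_measurePreserving
    (measurePreserving_eval (fun _ : Fin 4 => Q) i)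

lemma patternIntegrable_projRem (hf : Measurable f) (h2 : MemLp f 2 (Measure.pi fun _ => Q))
    (hp : PatternIntegrable Q f) : PatternIntegrable Q (projRem Q f) := by
  refine (hp.sub (patternIntegrable_const _)).sub (PatternIntegrable.sum _ fun i _ => ?_)
  exact patternIntegrable_coord ((memLp_proj hf h2 i).integrable one_le_two) i

/-- Degenerate kernels are orthogonal along tuples that share at most one index. -/
lemma integral_mul_tuple_eq_zero {r : (Fin 4 → E) → ℝ} (hr : Measurable r)
    (hr2 : MemLp r 2 (Measure.pi fun _ => Q)) {i₀ : Fin 4}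
    (hr0 : ∀ᵐ x ∂Q, ∫ w, r (Function.update w i₀ x) ∂(Measure.pi fun _ => Q) = 0)
    (hW : ∀ i, HasLaw (W i) Q μ) (hind : iIndepFun W μ) {a b : Fin 4 → ℕ}
    (ha : Function.Injective a) (hb : Function.Injective b)
    (hab : ∀ i, i ≠ i₀ → ∀ j, a i ≠ b j) :
    ∫ ω, r (fun i => W (a i) ω) * r (fun i => W (b i) ω) ∂μ = 0 := by
  classical
  obtain ⟨m, hm⟩ := Infinite.exists_notMem_finset (Finset.univ.image a ∪ Finset.univ.image b)
  simp only [Finset.mem_union, Finset.mem_image, Finset.mem_univ, true_and, not_or,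
    not_exists] at hm
  -- The index at position `i₀` is replaced by a fresh one, which makes `a'` disjoint from `b` and
  -- from `a i₀`. The observations along `a'` are then independent of `T`, and those along `a` are
  -- recovered by writing the first component of `T` at position `i₀`.
  set a' : Fin 4 → ℕ := Function.update a i₀ m with ha'
  have ha'i : Function.Injective a' := by
    intro i j h
    simp only [ha', Function.update_apply] at h
    split_ifs at h with h1 h2 h2
    · rw [h1, h2]
    · exact absurd h.symm (hm.1 j)
    · exact absurd h (hm.1 i)
    · exact ha h
  have hla := hasLaw_tuple hW hind ha
  have hlb := hasLaw_tuple hW hind hb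
  have hla' := hasLaw_tuple hW hind ha'i
  let T : Ω → E × (Fin 4 → E) := fun ω => (W (a i₀) ω, fun i => W (b i) ω)
  have hT : AEMeasurable T μ := (hW _).aemeasurable.prodMk hlb.aemeasurable
  let S := Finset.univ.image a'
  let S' := insert (a i₀) (Finset.univ.image b)
  have hdisj : Disjoint S S' := by
    rw [Finset.disjoint_left]
    intro x hx hx'
    obtain ⟨i, -, rfl⟩ := Finset.mem_image.mp hx
    rw [Finset.mem_insert, Finset.mem_image] at hx'
    by_cases hi : i = i₀
    · subst hi
      simp only [ha', Function.update_self] at hx'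
      rcases hx' with h | ⟨j, -, h⟩
      · exact hm.1 _ h.symm
      · exact hm.2 j h
    · simp only [ha', Function.update_of_ne hi] at hx'
      rcases hx' with h | ⟨j, -, h⟩
      · exact hi (ha h)
      · exact hab i hi j h.symm
  have hindep : IndepFun (fun ω i => W (a' i) ω) T μ := by
    have h0 := hind.indepFun_finset₀ _ _ hdisj fun i => (hW i).aemeasurable
    have h1 : Measurable fun (v : S → E) (i : Fin 4) =>
        v ⟨a' i, Finset.mem_image_of_mem a' (Finset.mem_univ i)⟩ :=
      measurable_pi_lambda _ fun i => measurable_pi_apply _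
    have h2 : Measurable fun (v : S' → E) =>
        (v ⟨a i₀, Finset.mem_insert_self _ _⟩, fun i : Fin 4 =>
          v ⟨b i, Finset.mem_insert_of_mem (Finset.mem_image_of_mem b (Finset.mem_univ i))⟩) :=
      (measurable_pi_apply _).prodMk (measurable_pi_lambda _ fun i => measurable_pi_apply _)
    exact h0.comp h1 h2
  have hlaw : HasLaw (fun ω => ((fun i => W (a' i) ω), T ω))
      ((Measure.pi fun _ => Q).prod (μ.map T)) μ :=
    hindep.hasLaw_prod hla' ⟨hT, rfl⟩
  -- Integrating `G` over its first argument, with `T` fixed, gives zero by degeneracy.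
  let G : (Fin 4 → E) × (E × (Fin 4 → E)) → ℝ := fun q =>
    r (Function.update q.1 i₀ q.2.1) * r q.2.2
  have hGm : Measurable G := by
    refine Measurable.mul (hr.comp ?_) (hr.comp measurable_snd.snd)
    exact (measurable_update_pair i₀).comp (measurable_fst.prodMk measurable_snd.fst)
  have hGeq : ∀ ω, G ((fun i => W (a' i) ω), T ω) =
      r (fun i => W (a i) ω) * r (fun i => W (b i) ω) := by
    intro ω
    simp only [G, T]
    congr 2
    ext i
    by_cases hi : i = i₀
    · subst hi; simp
    · simp [ha', Function.update_of_ne hi]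
  have hGi : Integrable G ((Measure.pi fun _ => Q).prod (μ.map T)) := by
    rw [← hlaw.map_eq, integrable_map_measure hGm.aestronglyMeasurable hlaw.aemeasurable]
    have h1 : MemLp (fun ω => r fun i => W (a i) ω) 2 μ := by
      rw [← hla.map_eq] at hr2
      exact hr2.comp_of_map hla.aemeasurable
    have h2 : MemLp (fun ω => r fun i => W (b i) ω) 2 μ := by
      rw [← hlb.map_eq] at hr2
      exact hr2.comp_of_map hlb.aemeasurable
    exact (h1.integrable_mul h2).congr (ae_of_all _ fun ω => (hGeq ω).symm)
  have := Measure.isProbabilityMeasure_map hT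
  simp_rw [← hGeq]
  have h1 := hlaw.integral_comp hGm.aestronglyMeasurable
  simp only [Function.comp_def] at h1
  rw [h1, integral_prod_symm _ hGi]
  have h2 : ∀ᵐ t ∂(μ.map T), ∫ w, r (Function.update w i₀ t.1) ∂(Measure.pi fun _ => Q) = 0 := by
    have h3 : (μ.map T).map Prod.fst = Q := by
      rw [AEMeasurable.map_map_of_aemeasurable measurable_fst.aemeasurable hT]
      exact (hW (a i₀)).map_eq
    have h4 : ∀ᵐ x ∂((μ.map T).map Prod.fst),
        ∫ w, r (Function.update w i₀ x) ∂(Measure.pi fun _ => Q) = 0 := by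
      rw [h3]
      exact hr0
    exact ae_of_ae_map measurable_fst.aemeasurable h4
  refine integral_eq_zero_of_ae ?_
  filter_upwards [h2] with t ht
  simp only [G, integral_mul_const, ht, zero_mul, Pi.zero_apply]

end VStatistic

lemma tendsto_inv_sqrt : Tendsto (fun n : ℕ => (√(n : ℝ))⁻¹) atTop (𝓝 0) :=
  tendsto_inv_atTop_zero.comp (Real.tendsto_sqrt_atTop.comp tendsto_natCast_atTop_atTop)

/-! ### Counting tuples with coinciding indices -/

section Counting

variable {n : ℕ}

lemma card_filter_eq_le (i i' : Fin 4) (h : i ≠ i') :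
    ({a : Fin 4 → Fin n | a i = a i'} : Finset _).card ≤ n ^ 3 := by
  classical
  have hc : Fintype.card ({x : Fin 4 // x ≠ i'} → Fin n) = n ^ 3 := by
    simp [Fintype.card_subtype_compl]
  rw [← hc, ← Finset.card_univ]
  refine Finset.card_le_card_of_injOn (fun a x => a x.1)
    (fun _ _ => Finset.mem_coe.mpr (Finset.mem_univ _)) ?_
  intro a ha b hb hab
  simp only [Finset.coe_filter, Finset.mem_univ, true_and, Set.mem_ofPred_eq] at ha hb
  have h1 : ∀ x, x ≠ i' → a x = b x := fun x hx => congrFun hab ⟨x, hx⟩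
  ext x
  by_cases hx : x = i'
  · subst hx; rw [← ha, ← hb, h1 i h]
  · rw [h1 x hx]

lemma card_not_injective_le :
    ({a : Fin 4 → Fin n | ¬ Function.Injective a} : Finset _).card ≤ 16 * n ^ 3 := by
  classical
  have h1 : ({a : Fin 4 → Fin n | ¬ Function.Injective a} : Finset _) ⊆
      (Finset.univ.filter fun p : Fin 4 × Fin 4 => p.1 ≠ p.2).biUnion
        fun p => {a : Fin 4 → Fin n | a p.1 = a p.2} := by
    intro a ha
    simp only [Finset.mem_filter, Finset.mem_univ, true_and, Function.Injective, not_forall] at ha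
    obtain ⟨i, j, h, hij⟩ := ha
    simp only [Finset.mem_biUnion, Finset.mem_filter, Finset.mem_univ, true_and]
    exact ⟨(i, j), hij, h⟩
  refine (Finset.card_le_card h1).trans (Finset.card_biUnion_le.trans ?_)
  refine (Finset.sum_le_card_nsmul _ _ (n ^ 3) fun p hp => ?_).trans ?_
  · exact card_filter_eq_le _ _ (by simpa using hp)
  · rw [smul_eq_mul]
    refine Nat.mul_le_mul_right _ ?_
    exact (Finset.card_filter_le _ _).trans (by simp)

/-- The first tuple is free and determines two distinct entries of the second: of eight indices six
remain. -/
lemma card_filter_two_matches_le (i i' j j' : Fin 4) (hj : j ≠ j') :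
    ({p : (Fin 4 → Fin n) × (Fin 4 → Fin n) | p.1 i = p.2 j ∧ p.1 i' = p.2 j'} :
      Finset _).card ≤ n ^ 6 := by
  classical
  have hc : Fintype.card ((Fin 4 → Fin n) × ({x : Fin 4 // x ≠ j ∧ x ≠ j'} → Fin n)) = n ^ 6 := by
    have : Fintype.card {x : Fin 4 // x ≠ j ∧ x ≠ j'} = 2 := by
      revert j j'; decide
    rw [Fintype.card_prod, Fintype.card_fun, Fintype.card_fun, this]
    simp only [Fintype.card_fin]
    ring
  rw [← hc, ← Finset.card_univ]
  refine Finset.card_le_card_of_injOn (fun p => (p.1, fun x => p.2 x.1))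
    (fun _ _ => Finset.mem_coe.mpr (Finset.mem_univ _)) ?_
  rintro ⟨a, b⟩ ha ⟨a', b'⟩ hb hab
  simp only [Finset.coe_filter, Finset.mem_univ, true_and, Set.mem_ofPred_eq] at ha hb
  simp only [Prod.mk.injEq] at hab
  obtain ⟨rfl, h2⟩ := hab
  have h1 : ∀ x, x ≠ j → x ≠ j' → b x = b' x := fun x hx hx' => congrFun h2 ⟨x, hx, hx'⟩
  refine Prod.ext rfl (funext fun x => ?_)
  by_cases hx : x = j
  · subst hx; exact ha.1.symm.trans hb.1
  · by_cases hx' : x = j'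
    · subst hx'; exact ha.2.symm.trans hb.2
    · exact h1 x hx hx'

/-- Two injective quadruples sharing at least two indices. -/
lemma card_overlap_le :
    ({p : (Fin 4 → Fin n) × (Fin 4 → Fin n) | Function.Injective p.1 ∧ Function.Injective p.2 ∧
      ¬ ∃ i₀, ∀ i, i ≠ i₀ → ∀ j, p.1 i ≠ p.2 j} : Finset _).card ≤ 256 * n ^ 6 := by
  classical
  let I : Finset ((Fin 4 × Fin 4) × (Fin 4 × Fin 4)) := Finset.univ.filter fun q => q.2.1 ≠ q.2.2
  have h1 : ({p : (Fin 4 → Fin n) × (Fin 4 → Fin n) | Function.Injective p.1 ∧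
      Function.Injective p.2 ∧ ¬ ∃ i₀, ∀ i, i ≠ i₀ → ∀ j, p.1 i ≠ p.2 j} : Finset _) ⊆
      I.biUnion fun q => {p : (Fin 4 → Fin n) × (Fin 4 → Fin n) |
        p.1 q.1.1 = p.2 q.2.1 ∧ p.1 q.1.2 = p.2 q.2.2} := by
    rintro ⟨a, b⟩ hp
    simp only [Finset.mem_filter, Finset.mem_univ, true_and, not_exists, not_forall,
      not_not] at hp
    obtain ⟨ha, -, h⟩ := hp
    -- Failure of the single-overlap condition at `0` gives one match, and its failure at that
    -- match's position gives a second one elsewhere. Injectivity of the first tuple keeps the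
    -- matched positions in the second distinct.
    obtain ⟨i, hi0, j, hij⟩ := h 0
    obtain ⟨i', hi0', j', hij'⟩ := h i
    simp only [Finset.mem_biUnion, Finset.mem_filter, Finset.mem_univ, true_and, I]
    refine ⟨((i, i'), (j, j')), ?_, hij, hij'⟩
    intro hjj
    simp only at hjj
    exact hi0' (ha (by rw [hij, hij', hjj]))
  refine (Finset.card_le_card h1).trans (Finset.card_biUnion_le.trans ?_)
  refine (Finset.sum_le_card_nsmul _ _ (n ^ 6) fun p hp => ?_).trans ?_
  · exact card_filter_two_matches_le _ _ _ _ (by simpa [I] using hp)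
  · rw [smul_eq_mul]
    refine Nat.mul_le_mul_right _ ?_
    exact (Finset.card_filter_le _ _).trans (by simp)

end Counting

/-! ### Limit theorems for V-statistics -/

section Projection

variable {E Ω : Type*} [MeasurableSpace E] {mΩ : MeasurableSpace Ω} {μ : Measure Ω}
  [IsProbabilityMeasure μ] {Q : Measure E} [IsProbabilityMeasure Q] {W : ℕ → Ω → E}
  {f r : (Fin 4 → E) → ℝ}

lemma memLp_tuple (hr2 : MemLp r 2 (Measure.pi fun _ => Q)) (hW : ∀ i, HasLaw (W i) Q μ)
    (hind : iIndepFun W μ) {a : Fin 4 → ℕ} (ha : Function.Injective a) :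
    MemLp (fun ω => r fun i => W (a i) ω) 2 μ := by
  have hla := hasLaw_tuple hW hind ha
  rw [← hla.map_eq] at hr2
  exact hr2.comp_of_map hla.aemeasurable

lemma integral_sq_tuple (hr2 : MemLp r 2 (Measure.pi fun _ => Q)) (hW : ∀ i, HasLaw (W i) Q μ)
    (hind : iIndepFun W μ) {a : Fin 4 → ℕ} (ha : Function.Injective a) :
    ∫ ω, (r fun i => W (a i) ω) ^ 2 ∂μ = ∫ w, r w ^ 2 ∂(Measure.pi fun _ => Q) := by
  have hla := hasLaw_tuple hW hind ha
  exact hla.integral_comp (f := fun w => r w ^ 2) hr2.integrable_sq.aestronglyMeasurable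

/-- Of the roughly `n⁸` products in the squared sum, those whose tuples share at most one index have
mean zero. Only `256 n⁶` pairs can remain, each contributing at most the second moment. -/
lemma integral_sq_sum_injective_le (hr : Measurable r) (hr2 : MemLp r 2 (Measure.pi fun _ => Q))
    (hr0 : ∀ i₀, ∀ᵐ x ∂Q, ∫ w, r (Function.update w i₀ x) ∂(Measure.pi fun _ => Q) = 0)
    (hW : ∀ i, HasLaw (W i) Q μ) (hind : iIndepFun W μ) (n : ℕ) :
    ∫ ω, (∑ a : Fin 4 → Fin n with Function.Injective a, r fun i => W (a i) ω) ^ 2 ∂μ ≤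
      256 * (n : ℝ) ^ 6 * ∫ w, r w ^ 2 ∂(Measure.pi fun _ => Q) := by
  classical
  set C := ∫ w, r w ^ 2 ∂(Measure.pi fun _ => Q) with hC
  have hC0 : 0 ≤ C := integral_nonneg fun w => sq_nonneg _
  let I : Finset (Fin 4 → Fin n) := Finset.univ.filter fun a => Function.Injective a
  let R : (Fin 4 → Fin n) → Ω → ℝ := fun a ω => r fun i => W (a i) ω
  have hinj : ∀ a ∈ I, Function.Injective fun i => ((a i : Fin n) : ℕ) := fun a ha =>
    Fin.val_injective.comp (by simpa [I] using ha)
  have hR : ∀ a ∈ I, MemLp (R a) 2 μ := fun a ha => memLp_tuple hr2 hW hind (hinj a ha)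
  have hsq : ∀ a ∈ I, ∫ ω, R a ω ^ 2 ∂μ = C := fun a ha =>
    integral_sq_tuple hr2 hW hind (hinj a ha)
  have hmul : ∀ a ∈ I, ∀ b ∈ I, Integrable (fun ω => R a ω * R b ω) μ := fun a ha b hb =>
    (hR a ha).integrable_mul (hR b hb)
  -- The inequality `2xy ≤ x² + y²` suffices, since all tuples in `I` have the same second moment.
  have hle : ∀ a ∈ I, ∀ b ∈ I, ∫ ω, R a ω * R b ω ∂μ ≤ C := by
    intro a ha b hb
    have h1 : ∫ ω, R a ω * R b ω ∂μ ≤ ∫ ω, (R a ω ^ 2 + R b ω ^ 2) / 2 ∂μ :=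
      integral_mono (hmul a ha b hb)
        (((hR a ha).integrable_sq.add (hR b hb).integrable_sq).div_const 2)
        fun ω => by
          change R a ω * R b ω ≤ (R a ω ^ 2 + R b ω ^ 2) / 2
          nlinarith [sq_nonneg (R a ω - R b ω)]
    rw [integral_div, integral_add (hR a ha).integrable_sq (hR b hb).integrable_sq, hsq a ha,
      hsq b hb] at h1
    linarith
  let J : Finset ((Fin 4 → Fin n) × (Fin 4 → Fin n)) := Finset.univ.filter fun p =>
    Function.Injective p.1 ∧ Function.Injective p.2 ∧
      ¬ ∃ i₀, ∀ i, i ≠ i₀ → ∀ j, p.1 i ≠ p.2 j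
  have hJ : J ⊆ I ×ˢ I := by
    intro p hp
    simp only [J, Finset.mem_filter, Finset.mem_univ, true_and] at hp
    simp [I, hp.1, hp.2.1]
  calc ∫ ω, (∑ a ∈ I, R a ω) ^ 2 ∂μ
      = ∫ ω, ∑ p ∈ I ×ˢ I, R p.1 ω * R p.2 ω ∂μ := by
        refine integral_congr_ae (ae_of_all _ fun ω => ?_)
        simp only [sq, Finset.sum_mul_sum, Finset.sum_product]
    _ = ∑ p ∈ I ×ˢ I, ∫ ω, R p.1 ω * R p.2 ω ∂μ :=
        integral_finsetSum _ fun p hp => by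
          rw [Finset.mem_product] at hp
          exact hmul _ hp.1 _ hp.2
    _ = ∑ p ∈ J, ∫ ω, R p.1 ω * R p.2 ω ∂μ := by
        refine (Finset.sum_subset hJ fun p hp hpJ => ?_).symm
        rw [Finset.mem_product] at hp
        simp only [J, I, Finset.mem_filter, Finset.mem_univ, true_and, not_and, not_not] at hp hpJ
        obtain ⟨i₀, h⟩ := hpJ hp.1 hp.2
        exact integral_mul_tuple_eq_zero hr hr2 (hr0 i₀) hW hind
          (hinj p.1 (by simp [I, hp.1])) (hinj p.2 (by simp [I, hp.2]))
          fun i hi j hij => h i hi j (Fin.val_injective hij)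
    _ ≤ ∑ p ∈ J, C := Finset.sum_le_sum fun p hp => by
        have := Finset.mem_product.mp (hJ hp)
        exact hle _ this.1 _ this.2
    _ = (J.card : ℝ) * C := by simp
    _ ≤ 256 * (n : ℝ) ^ 6 * C := by
        gcongr
        exact_mod_cast card_overlap_le (n := n)

/-- The V-statistic of a degenerate kernel is `o_P(n^{-1/2})`. -/
theorem nullInProb_sqrt_mul_vstat (hr : Measurable r) (hr2 : MemLp r 2 (Measure.pi fun _ => Q))
    (hrp : PatternIntegrable Q r)
    (hr0 : ∀ i₀, ∀ᵐ x ∂Q, ∫ w, r (Function.update w i₀ x) ∂(Measure.pi fun _ => Q) = 0)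
    (hW : ∀ i, HasLaw (W i) Q μ) (hind : iIndepFun W μ) :
    NullInProb μ fun n ω => √(n : ℝ) * vstat r n fun i => W i ω := by
  classical
  let S : ℕ → Ω → ℝ := fun n ω =>
    ∑ a : Fin 4 → Fin n with Function.Injective a, r fun i => W (a i) ω
  let S' : ℕ → Ω → ℝ := fun n ω =>
    ∑ a : Fin 4 → Fin n with ¬ Function.Injective a, r fun i => W (a i) ω
  have hsplit : ∀ (n : ℕ) ω, √(n : ℝ) * vstat r n (fun i => W i ω) =
      √(n : ℝ) * ((n : ℝ) ^ 4)⁻¹ * S n ω + √(n : ℝ) * ((n : ℝ) ^ 4)⁻¹ * S' n ω := by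
    intro n ω
    rw [vstat, ← Finset.sum_filter_add_sum_filter_not Finset.univ
      (fun a : Fin 4 → Fin n => Function.Injective a)]
    ring
  have hinv := tendsto_inv_sqrt
  simp_rw [hsplit]
  refine NullInProb.add ?_ ?_
  -- Injective tuples: the `L²` bound `16 n³ √C`, where `16 = √256`, against the factor `n^(1/2)
  -- n⁻⁴`, leaves `n^(-1/2)`.
  · set C := ∫ w, r w ^ 2 ∂(Measure.pi fun _ => Q) with hC
    have hC0 : 0 ≤ C := integral_nonneg fun w => sq_nonneg _
    have hS2 : ∀ n, MemLp (S n) 2 μ := fun n => by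
      refine memLp_finsetSum _ fun a ha => ?_
      refine memLp_tuple (a := fun i => ((a i : Fin n) : ℕ)) hr2 hW hind ?_
      exact Fin.val_injective.comp (by simpa using ha)
    refine nullInProb_of_integral_tendsto
      (fun n => ((hS2 n).integrable one_le_two).const_mul _) ?_
    have hlim := (hinv.const_mul (16 * √C))
    rw [mul_zero] at hlim
    refine squeeze_zero (fun n => integral_nonneg fun ω => abs_nonneg _) (fun n => ?_) hlim
    simp only [abs_mul, integral_const_mul]
    have h1 : ∫ ω, |S n ω| ∂μ ≤ 16 * (n : ℝ) ^ 3 * √C := by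
      refine (integral_abs_le_sqrt (hS2 n)).trans ?_
      refine Real.sqrt_le_iff.mpr ⟨by positivity, ?_⟩
      refine (integral_sq_sum_injective_le hr hr2 hr0 hW hind n).trans_eq ?_
      rw [mul_pow, Real.sq_sqrt hC0]
      ring
    rcases Nat.eq_zero_or_pos n with rfl | hn
    · simp
    have hn' : (0 : ℝ) < n := by exact_mod_cast hn
    have hs : 0 < √(n : ℝ) := Real.sqrt_pos.mpr hn'
    have hss : √(n : ℝ) ^ 2 = n := Real.sq_sqrt hn'.le
    rw [abs_of_pos hs, abs_of_pos (by positivity : (0 : ℝ) < ((n : ℝ) ^ 4)⁻¹)]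
    calc √(n : ℝ) * ((n : ℝ) ^ 4)⁻¹ * ∫ ω, |S n ω| ∂μ
        ≤ √(n : ℝ) * ((n : ℝ) ^ 4)⁻¹ * (16 * (n : ℝ) ^ 3 * √C) := by gcongr
      _ = 16 * √C * (√(n : ℝ))⁻¹ := by
        field_simp
        rw [hss]
  -- Tuples with a repetition: there is no cancellation, but there are only `O(n³)` of them, so an
  -- `L¹` bound gives the same rate.
  · have hS1 : ∀ n, Integrable (S' n) μ := fun n => integrable_finsetSum _ fun a _ =>
      hrp.integrable_tuple hW hind fun i => ((a i : Fin n) : ℕ)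
    refine nullInProb_of_integral_tendsto (fun n => (hS1 n).const_mul _) ?_
    have hlim := (hinv.const_mul (16 * patternNorm Q r))
    rw [mul_zero] at hlim
    refine squeeze_zero (fun n => integral_nonneg fun ω => abs_nonneg _) (fun n => ?_) hlim
    simp only [abs_mul, integral_const_mul]
    have h1 : ∫ ω, |S' n ω| ∂μ ≤ 16 * (n : ℝ) ^ 3 * patternNorm Q r := by
      refine (integral_abs_sum_tuple_le hrp hW hind _).trans ?_
      refine mul_le_mul_of_nonneg_right ?_ patternNorm_nonneg
      exact_mod_cast card_not_injective_le (n := n)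
    rcases Nat.eq_zero_or_pos n with rfl | hn
    · simp
    have hn' : (0 : ℝ) < n := by exact_mod_cast hn
    have hs : 0 < √(n : ℝ) := Real.sqrt_pos.mpr hn'
    have hss : √(n : ℝ) ^ 2 = n := Real.sq_sqrt hn'.le
    rw [abs_of_pos hs, abs_of_pos (by positivity : (0 : ℝ) < ((n : ℝ) ^ 4)⁻¹)]
    calc √(n : ℝ) * ((n : ℝ) ^ 4)⁻¹ * ∫ ω, |S' n ω| ∂μ
        ≤ √(n : ℝ) * ((n : ℝ) ^ 4)⁻¹ * (16 * (n : ℝ) ^ 3 * patternNorm Q r) := by gcongr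
      _ = 16 * patternNorm Q r * (√(n : ℝ))⁻¹ := by
        field_simp
        rw [hss]

lemma sum_tuple_apply (n : ℕ) (h : ℕ → ℝ) (i : Fin 4) :
    ∑ a : Fin 4 → Fin n, h (a i) = (n : ℝ) ^ 3 * ∑ j : Fin n, h j := by
  have := Fintype.sum_piFinset_apply (fun j : Fin n => h j) Finset.univ i
  simpa using this

/-- The Hoeffding decomposition of a V-statistic with a square integrable kernel. -/
theorem nullInProb_hoeffding (hf : Measurable f) (h2 : MemLp f 2 (Measure.pi fun _ => Q))
    (hp : PatternIntegrable Q f) (hW : ∀ i, HasLaw (W i) Q μ) (hind : iIndepFun W μ) :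
    NullInProb μ fun n ω => √(n : ℝ) * ((vstat f n fun i => W i ω) -
      ∫ w, f w ∂(Measure.pi fun _ => Q) -
      (n : ℝ)⁻¹ * ∑ j : Fin n, ∑ i, proj Q f i (W j ω)) := by
  have h1 := nullInProb_sqrt_mul_vstat (μ := μ) (W := W) (measurable_projRem (Q := Q) hf)
    (memLp_projRem hf h2) (patternIntegrable_projRem hf h2 hp) (integral_projRem_update hf h2)
    hW hind
  refine h1.mono fun n ω => ?_
  rcases Nat.eq_zero_or_pos n with rfl | hn
  · simp
  have hn' : (n : ℝ) ≠ 0 := by exact_mod_cast hn.ne'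
  refine le_of_eq ?_
  congr 2
  have h3 : ∀ i, ∑ a : Fin 4 → Fin n, proj Q f i (W (a i) ω) =
      (n : ℝ) ^ 3 * ∑ j : Fin n, proj Q f i (W j ω) := fun i =>
    sum_tuple_apply n (fun j => proj Q f i (W j ω)) i
  have h4 : ∑ a : Fin 4 → Fin n, ∑ i, proj Q f i (W (a i) ω) =
      (n : ℝ) ^ 3 * ∑ j : Fin n, ∑ i, proj Q f i (W j ω) := by
    rw [Finset.sum_comm]
    simp_rw [h3]
    rw [← Finset.mul_sum, Finset.sum_comm]
  simp only [vstat, projRem, Finset.sum_sub_distrib, h4, Finset.sum_const, Finset.card_univ,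
    Fintype.card_fun, Fintype.card_fin, nsmul_eq_mul]
  push_cast
  field_simp

/-- The sum of centred i.i.d. square integrable variables is `O_P(√n)`. -/
lemma boundedInProb_inv_sqrt_mul_sum {h : E → ℝ} (hh : MemLp h 2 Q) (h0 : ∫ x, h x ∂Q = 0)
    (hW : ∀ i, HasLaw (W i) Q μ) (hind : iIndepFun W μ) (hm : Measurable h) :
    BoundedInProb μ fun n ω => (√(n : ℝ))⁻¹ * ∑ j : Fin n, h (W j ω) := by
  have hL : ∀ j, MemLp (fun ω => h (W j ω)) 2 μ := fun j => by
    rw [← (hW j).map_eq] at hh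
    exact hh.comp_of_map (hW j).aemeasurable
  have hmean : ∀ j, ∫ ω, h (W j ω) ∂μ = 0 := fun j => by
    have := (hW j).integral_comp (f := h) hm.aestronglyMeasurable
    rw [h0] at this
    exact this
  have hS : ∀ n : ℕ, MemLp (fun ω => ∑ j : Fin n, h (W j ω)) 2 μ := fun n =>
    memLp_finsetSum _ fun j _ => hL j
  have hsq : ∀ n : ℕ, ∫ ω, (∑ j : Fin n, h (W j ω)) ^ 2 ∂μ = n * ∫ x, h x ^ 2 ∂Q := by
    intro n
    have e1 : ∀ j, ∫ ω, h (W j ω) ^ 2 ∂μ = ∫ x, h x ^ 2 ∂Q := fun j =>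
      (hW j).integral_comp (f := fun x => h x ^ 2) (hm.pow_const 2).aestronglyMeasurable
    have e2 : ∀ i j, i ≠ j → ∫ ω, h (W i ω) * h (W j ω) ∂μ = 0 := fun i j hij => by
      have hi : IndepFun (fun ω => h (W i ω)) (fun ω => h (W j ω)) μ :=
        (hind.indepFun hij).comp hm hm
      rw [hi.integral_fun_mul_eq_mul_integral (hL i).aestronglyMeasurable
        (hL j).aestronglyMeasurable, hmean i, zero_mul]
    have hmul : ∀ i j, Integrable (fun ω => h (W i ω) * h (W j ω)) μ := fun i j =>
      (hL i).integrable_mul (hL j)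
    simp only [sq, Finset.sum_mul_sum]
    rw [integral_finsetSum _ fun (i : Fin n) _ => integrable_finsetSum _ fun (j : Fin n) _ =>
      hmul i j]
    have e3 : ∀ i : Fin n, ∫ ω, ∑ j : Fin n, h (W i ω) * h (W j ω) ∂μ = ∫ x, h x ^ 2 ∂Q := by
      intro i
      rw [integral_finsetSum _ fun (j : Fin n) _ => hmul i j,
        Finset.sum_eq_single i (fun j _ hj => e2 _ _ fun h => hj (Fin.val_injective h.symm))
          (by simp), ← e1 i]
      simp only [sq]
    simp only [e3, ← sq]
    simp
  refine boundedInProb_of_integral_le (C := √(∫ x, h x ^ 2 ∂Q))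
    (fun n => ((hS n).integrable one_le_two).const_mul _) fun n => ?_
  simp only [abs_mul, integral_const_mul]
  refine (mul_le_mul_of_nonneg_left (integral_abs_le_sqrt (hS n)) (abs_nonneg _)).trans ?_
  rw [hsq, Real.sqrt_mul (Nat.cast_nonneg n), abs_of_nonneg (by positivity), ← mul_assoc]
  exact (mul_le_mul_of_nonneg_right (inv_mul_le_one) (Real.sqrt_nonneg _)).trans_eq (one_mul _)

lemma nullInProb_inv_sqrt : NullInProb μ fun n _ => (√(n : ℝ))⁻¹ := by
  have hinv := tendsto_inv_sqrt
  refine nullInProb_of_integral_tendsto (fun n => integrable_const _) ?_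
  simpa [abs_of_nonneg (Real.sqrt_nonneg _)] using hinv

/-- The weak law of large numbers for V-statistics with square integrable kernels. -/
lemma nullInProb_vstat_sub_of_memLp (hf : Measurable f)
    (h2 : MemLp f 2 (Measure.pi fun _ => Q)) (hp : PatternIntegrable Q f)
    (hW : ∀ i, HasLaw (W i) Q μ) (hind : iIndepFun W μ) :
    NullInProb μ fun n ω => (vstat f n fun i => W i ω) - ∫ w, f w ∂(Measure.pi fun _ => Q) := by
  have h1 := (nullInProb_hoeffding hf h2 hp hW hind).boundedInProb
  have h3 := boundedInProb_inv_sqrt_mul_sum (μ := μ) (W := W) (h := fun x => ∑ i, proj Q f i x)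
    (memLp_finsetSum _ fun i _ => memLp_proj hf h2 i) (by
      rw [integral_finsetSum _ fun i _ => (memLp_proj hf h2 i).integrable one_le_two]
      simp [integral_proj (h2.integrable one_le_two)]) hW hind
    (Finset.measurable_fun_sum _ fun i _ => measurable_proj hf i)
  -- The deviation is `n^(-1/2)` times a quantity bounded in probability. This fails for `n = 0`,
  -- where the inverse is zero by convention.
  refine (nullInProb_inv_sqrt.mul (h1.add h3)).mono_on (G := fun n => {ω | 0 < n}) ?_
    fun n ω hn => le_of_eq ?_
  · refine tendsto_const_nhds.congr' ?_
    filter_upwards [eventually_gt_atTop 0] with n hn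
    simp [hn]
  · have hn' : (0 : ℝ) < n := by exact_mod_cast hn
    have hs : 0 < √(n : ℝ) := Real.sqrt_pos.mpr hn'
    have hss : √(n : ℝ) ^ 2 = n := Real.sq_sqrt hn'.le
    congr 1
    generalize ∑ j : Fin n, ∑ i, proj Q f i (W j ω) = s
    generalize vstat f n (fun i => W i ω) = v
    rw [show ((n : ℝ))⁻¹ = (√(n : ℝ))⁻¹ * (√(n : ℝ))⁻¹ by rw [← mul_inv, ← sq, hss]]
    field_simp
    ring

lemma vstat_sub (f f' : (Fin 4 → E) → ℝ) (n : ℕ) (w : ℕ → E) :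
    vstat (fun v => f v - f' v) n w = vstat f n w - vstat f' n w := by
  simp only [vstat, Finset.sum_sub_distrib, mul_sub]

/-- The weak law of large numbers for V-statistics. -/
theorem nullInProb_vstat_sub (hf : Measurable f) (hp : PatternIntegrable Q f)
    (hW : ∀ i, HasLaw (W i) Q μ) (hind : iIndepFun W μ) :
    NullInProb μ fun n ω => (vstat f n fun i => W i ω) - ∫ w, f w ∂(Measure.pi fun _ => Q) := by
  -- Truncation at level `M` gives a bounded, hence square integrable, kernel. The error is
  -- controlled in `L¹`, uniformly in `n`, by `patternNorm`, which tends to zero by dominated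
  -- convergence.
  let F : ℕ → (Fin 4 → E) → ℝ := fun M w => max (-(M : ℝ)) (min (f w) M)
  have hFm : ∀ M, Measurable (F M) := fun M => by fun_prop
  have hFb : ∀ M w, |F M w| ≤ M := fun M w => by
    have : (0 : ℝ) ≤ M := Nat.cast_nonneg M
    exact abs_le.mpr ⟨le_max_left _ _, max_le (by linarith) (min_le_right _ _)⟩
  have hFf : ∀ M w, |f w - F M w| ≤ |f w| := fun M w => by
    have : (0 : ℝ) ≤ M := Nat.cast_nonneg M
    simp only [F]
    rcases le_total (f w) M with h1 | h1
    · rw [min_eq_left h1]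
      rcases le_total (-(M : ℝ)) (f w) with h2 | h2
      · rw [max_eq_right h2, sub_self, abs_zero]; exact abs_nonneg _
      · rw [max_eq_left h2, abs_of_nonpos (by linarith), abs_of_nonpos (by linarith)]
        linarith
    · rw [min_eq_right h1, max_eq_right (by linarith), abs_of_nonneg (by linarith),
        abs_of_nonneg (by linarith)]
      linarith
  have hFlim : ∀ w, Tendsto (fun M : ℕ => |f w - F M w|) atTop (𝓝 0) := fun w => by
    refine tendsto_const_nhds.congr' ?_
    filter_upwards [tendsto_natCast_atTop_atTop.eventually_ge_atTop |f w|] with M hM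
    have := abs_le.mp hM
    simp only [F]
    rw [min_eq_left this.2, max_eq_right this.1, sub_self, abs_zero]
  have hFp : ∀ M, PatternIntegrable Q (F M) := fun M =>
    (patternIntegrable_const (M : ℝ)).mono (hFm M) fun w => (hFb M w).trans (le_abs_self _)
  have hdp : ∀ M, PatternIntegrable Q fun w => f w - F M w := fun M => hp.sub (hFp M)
  -- The factor `2` accounts for the V-statistic of `f - F M` and for its mean.
  have hnorm : Tendsto (fun M => 2 * patternNorm Q fun w => f w - F M w) atTop (𝓝 0) := by
    rw [← mul_zero (2 : ℝ)]
    refine Tendsto.const_mul _ ?_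
    simp only [patternNorm]
    rw [← Finset.sum_const_zero (s := (Finset.univ : Finset (Fin 4 → Fin 4)))]
    refine tendsto_finsetSum _ fun p _ => ?_
    rw [← integral_zero (Fin 4 → E) ℝ (μ := Measure.pi fun _ => Q)]
    refine tendsto_integral_of_dominated_convergence (fun w => |f fun i => w (p i)|)
      (fun M => (hdp M p).abs.aestronglyMeasurable) (hp p).abs
      (fun M => ae_of_all _ fun w => ?_) (ae_of_all _ fun w => hFlim _)
    rw [Real.norm_eq_abs, abs_abs]
    exact hFf M _
  have hFY : ∀ M, NullInProb μ fun n ω => (vstat (F M) n fun i => W i ω) -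
      ∫ w, F M w ∂(Measure.pi fun _ => Q) := fun M =>
    nullInProb_vstat_sub_of_memLp (hFm M)
      (MemLp.of_bound (hFm M).aestronglyMeasurable M (ae_of_all _ fun w => hFb M w)) (hFp M) hW hind
  have heq : ∀ M n ω, (vstat f n fun i => W i ω) - ∫ w, f w ∂(Measure.pi fun _ => Q) -
      ((vstat (F M) n fun i => W i ω) - ∫ w, F M w ∂(Measure.pi fun _ => Q)) =
      (vstat (fun w => f w - F M w) n fun i => W i ω) -
        ∫ w, (f w - F M w) ∂(Measure.pi fun _ => Q) := fun M n ω => by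
    rw [vstat_sub, integral_sub hp.integrable (hFp M).integrable]
    ring
  have hi : ∀ M n, Integrable (fun ω => (vstat (fun w => f w - F M w) n fun i => W i ω) -
      ∫ w, (f w - F M w) ∂(Measure.pi fun _ => Q)) μ := fun M n =>
    ((hdp M).integrable_vstat hW hind n).sub (integrable_const _)
  refine nullInProb_of_approx hFY (fun M n => ?_) (fun M n => ?_) hnorm
  · simp_rw [heq]
    exact hi M n
  · simp_rw [heq]
    have h1 : |∫ w, (f w - F M w) ∂(Measure.pi fun _ => Q)| ≤
        patternNorm Q fun w => f w - F M w := by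
      refine abs_integral_le_integral_abs.trans ?_
      exact Finset.single_le_sum (f := fun p : Fin 4 → Fin 4 =>
        ∫ w : Fin 4 → E, |(fun w => f w - F M w) fun i => w (p i)| ∂(Measure.pi fun _ => Q))
        (fun q _ => integral_nonneg fun w => abs_nonneg _) (Finset.mem_univ id)
    calc _ ≤ ∫ ω, (|vstat (fun w => f w - F M w) n fun i => W i ω| +
          |∫ w, (f w - F M w) ∂(Measure.pi fun _ => Q)|) ∂μ :=
          integral_mono (hi M n).abs
            (((hdp M).integrable_vstat hW hind n).abs.add (integrable_const _))
            fun ω => abs_sub _ _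
      _ = ∫ ω, |vstat (fun w => f w - F M w) n fun i => W i ω| ∂μ +
          |∫ w, (f w - F M w) ∂(Measure.pi fun _ => Q)| := by
          rw [integral_add ((hdp M).integrable_vstat hW hind n).abs (integrable_const _)]
          simp
      _ ≤ _ := by
          rw [two_mul]
          exact add_le_add ((hdp M).integral_abs_vstat_le hW hind n) h1

end Projection

/-! ### Second-order expansion of a bivariate function -/

section Taylor

/-- The mean value inequality is applied first to `deriv f` and then to `f` minus its linear part;
the constant `1/2` of Taylor's formula is not needed. -/
lemma abs_sub_sub_deriv_mul_le {f : ℝ → ℝ} (hf : Differentiable ℝ f)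
    (hf' : Differentiable ℝ (deriv f)) {x h B : ℝ} (hB : 0 ≤ B)
    (hbound : ∀ t, |t - x| ≤ |h| → |deriv (deriv f) t| ≤ B) :
    |f (x + h) - f x - deriv f x * h| ≤ B * h ^ 2 := by
  have hs : Convex ℝ (Metric.closedBall x |h|) := convex_closedBall x |h|
  have hx : x ∈ Metric.closedBall x |h| := Metric.mem_closedBall_self (abs_nonneg h)
  have hxh : x + h ∈ Metric.closedBall x |h| := by simp [Metric.mem_closedBall]
  have h1 : ∀ t ∈ Metric.closedBall x |h|, |deriv f t - deriv f x| ≤ B * |h| := by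
    intro t ht
    have h2 := hs.norm_image_sub_le_of_norm_deriv_le (f := deriv f) (C := B)
      (fun s _ => hf' s) (fun s hs' => hbound s (by simpa [Real.dist_eq] using hs')) hx ht
    refine h2.trans (mul_le_mul_of_nonneg_left ?_ hB)
    simpa [Real.dist_eq] using ht
  have h3 := hs.norm_image_sub_le_of_norm_deriv_le (f := fun t => f t - deriv f x * t)
    (C := B * |h|) (fun s _ => (hf s).sub ((differentiableAt_id).const_mul _))
    (fun s hs' => by
      have : deriv (fun t => f t - deriv f x * t) s = deriv f s - deriv f x := by
        have h4 : HasDerivAt (fun t => f t - deriv f x * t) (deriv f s - deriv f x * 1) s :=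
          (hf s).hasDerivAt.sub ((hasDerivAt_id s).const_mul _)
        rw [h4.deriv, mul_one]
      rw [this]
      exact h1 s hs') hx hxh
  simp only [Real.norm_eq_abs, add_sub_cancel_left] at h3
  calc |f (x + h) - f x - deriv f x * h|
      = |f (x + h) - deriv f x * (x + h) - (f x - deriv f x * x)| := by congr 1; ring
    _ ≤ B * |h| * |h| := h3
    _ = B * h ^ 2 := by rw [mul_assoc, ← sq, sq_abs]

variable {l : ℝ → ℝ → ℝ}

lemma dx_eq_fderiv (hl : Differentiable ℝ (Function.uncurry l)) (x y : ℝ) :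
    dx l x y = fderiv ℝ (Function.uncurry l) (x, y) (1, 0) := by
  have h1 : HasDerivAt (fun s : ℝ => ((s, y) : ℝ × ℝ)) (1, 0) x :=
    (hasDerivAt_id x).prodMk (hasDerivAt_const x y)
  exact ((hl (x, y)).hasFDerivAt.comp_hasDerivAt x h1).deriv

lemma dy_eq_fderiv (hl : Differentiable ℝ (Function.uncurry l)) (x y : ℝ) :
    dy l x y = fderiv ℝ (Function.uncurry l) (x, y) (0, 1) := by
  have h1 : HasDerivAt (fun s : ℝ => ((x, s) : ℝ × ℝ)) (0, 1) y :=
    (hasDerivAt_const y x).prodMk (hasDerivAt_id y)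
  exact ((hl (x, y)).hasFDerivAt.comp_hasDerivAt y h1).deriv

lemma contDiff_dx (hl : ContDiff ℝ 2 (Function.uncurry l)) :
    ContDiff ℝ 1 (Function.uncurry (dx l)) := by
  have h1 : Function.uncurry (dx l) = fun p => fderiv ℝ (Function.uncurry l) p (1, 0) := by
    ext ⟨x, y⟩
    exact dx_eq_fderiv (hl.differentiable (by norm_num)) x y
  rw [h1]
  exact (hl.fderiv_right (m := 1) (by norm_num)).clm_apply contDiff_const

lemma contDiff_dy (hl : ContDiff ℝ 2 (Function.uncurry l)) :
    ContDiff ℝ 1 (Function.uncurry (dy l)) := by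
  have h1 : Function.uncurry (dy l) = fun p => fderiv ℝ (Function.uncurry l) p (0, 1) := by
    ext ⟨x, y⟩
    exact dy_eq_fderiv (hl.differentiable (by norm_num)) x y
  rw [h1]
  exact (hl.fderiv_right (m := 1) (by norm_num)).clm_apply contDiff_const

lemma differentiable_left {f : ℝ → ℝ → ℝ} (hf : Differentiable ℝ (Function.uncurry f)) (y : ℝ) :
    Differentiable ℝ fun x => f x y :=
  hf.comp (differentiable_id.prodMk (differentiable_const y))

lemma differentiable_right {f : ℝ → ℝ → ℝ} (hf : Differentiable ℝ (Function.uncurry f)) (x : ℝ) :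
    Differentiable ℝ fun y => f x y :=
  hf.comp ((differentiable_const x).prodMk differentiable_id)

lemma abs_le_add_of_lipschitz {F : ℝ → ℝ → ℝ} {L : ℝ≥0} (hF : LipschitzWith L (Function.uncurry F))
    (x y x' y' : ℝ) : |F x' y'| ≤ |F x y| + L * (|x' - x| + |y' - y|) := by
  have h1 := hF.dist_le_mul (x', y') (x, y)
  rw [Real.dist_eq, Prod.dist_eq] at h1
  simp only [Function.uncurry, Real.dist_eq] at h1
  have h2 : max |x' - x| |y' - y| ≤ |x' - x| + |y' - y| :=
    max_le (le_add_of_nonneg_right (abs_nonneg _)) (le_add_of_nonneg_left (abs_nonneg _))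
  have h3 := abs_sub_abs_le_abs_sub (F x' y') (F x y)
  have h4 : (L : ℝ) * max |x' - x| |y' - y| ≤ L * (|x' - x| + |y' - y|) :=
    mul_le_mul_of_nonneg_left h2 L.2
  linarith

lemma hessSup_nonneg (x y : ℝ) : 0 ≤ hessSup l x y := (abs_nonneg _).trans (le_max_left _ _)

lemma gradSup_nonneg (x y : ℝ) : 0 ≤ gradSup l x y := (abs_nonneg _).trans (le_max_left _ _)

/-- The error of the linear approximation of `l` is controlled by its Hessian at the base point and
by the Lipschitz constant of its second derivatives. -/
theorem abs_taylor_remainder_le (hl : ContDiff ℝ 2 (Function.uncurry l)) {L : ℝ≥0}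
    (hxx : LipschitzWith L (Function.uncurry (dx (dx l))))
    (hxy : LipschitzWith L (Function.uncurry (dx (dy l))))
    (hyy : LipschitzWith L (Function.uncurry (dy (dy l)))) (x y u v : ℝ) :
    |l (x - u) (y - v) - l x y + (dx l x y * u + dy l x y * v)| ≤
      2 * hessSup l x y * (u ^ 2 + v ^ 2) + 4 * L * (|u| ^ 3 + |v| ^ 3) := by
  have hd := hl.differentiable (by norm_num : (2 : WithTop ℕ∞) ≠ 0)
  have hdx := (contDiff_dx hl).differentiable (by norm_num : (1 : WithTop ℕ∞) ≠ 0)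
  have hdy := (contDiff_dy hl).differentiable (by norm_num : (1 : WithTop ℕ∞) ≠ 0)
  -- A common bound for the second derivatives needed along the path `(x, y)`, `(x - u, y)`, `(x -
  -- u, y - v)`: their size at the base point plus the Lipschitz variation.
  set K := hessSup l x y + L * (|u| + |v|) with hK
  have hK0 : 0 ≤ K := add_nonneg (hessSup_nonneg x y) (by positivity)
  have bxx : ∀ t, |t - x| ≤ |-u| → |dx (dx l) t y| ≤ K := fun t ht => by
    have h1 := abs_le_add_of_lipschitz hxx x y t y
    have h2 : |dx (dx l) x y| ≤ hessSup l x y := le_max_left _ _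
    rw [abs_neg] at ht
    rw [sub_self, abs_zero, add_zero] at h1
    have h3 : (L : ℝ) * |t - x| ≤ L * (|u| + |v|) :=
      mul_le_mul_of_nonneg_left (by linarith [abs_nonneg v]) L.2
    linarith
  have bxy : ∀ t, |t - x| ≤ |-u| → |dx (dy l) t y| ≤ K := fun t ht => by
    have h1 := abs_le_add_of_lipschitz hxy x y t y
    have h2 : |dx (dy l) x y| ≤ hessSup l x y := (le_max_left _ _).trans (le_max_right _ _)
    rw [abs_neg] at ht
    rw [sub_self, abs_zero, add_zero] at h1
    have h3 : (L : ℝ) * |t - x| ≤ L * (|u| + |v|) :=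
      mul_le_mul_of_nonneg_left (by linarith [abs_nonneg v]) L.2
    linarith
  have byy : ∀ t, |t - y| ≤ |-v| → |dy (dy l) (x - u) t| ≤ K := fun t ht => by
    have h1 := abs_le_add_of_lipschitz hyy x y (x - u) t
    have h2 : |dy (dy l) x y| ≤ hessSup l x y := (le_max_right _ _).trans (le_max_right _ _)
    rw [abs_neg] at ht
    have h3 : (L : ℝ) * (|x - u - x| + |t - y|) ≤ L * (|u| + |v|) :=
      mul_le_mul_of_nonneg_left (by rw [sub_sub_cancel_left, abs_neg]; linarith) L.2
    linarith
  have e1 : |l (x + -u) y - l x y - dx l x y * -u| ≤ K * (-u) ^ 2 :=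
    abs_sub_sub_deriv_mul_le (differentiable_left hd y) (differentiable_left hdx y) hK0 bxx
  have e2 : |l (x - u) (y + -v) - l (x - u) y - dy l (x - u) y * -v| ≤ K * (-v) ^ 2 :=
    abs_sub_sub_deriv_mul_le (differentiable_right hd (x - u)) (differentiable_right hdy (x - u))
      hK0 byy
  have e3 : |dy l (x - u) y - dy l x y| ≤ K * |u| := by
    have h2 := (convex_closedBall x |u|).norm_image_sub_le_of_norm_deriv_le
      (f := fun s => dy l s y) (C := K) (fun s _ => differentiable_left hdy y s)
      (fun s hs' => bxy s (by simpa [Real.dist_eq] using hs'))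
      (Metric.mem_closedBall_self (abs_nonneg u))
      (show x - u ∈ _ by simp [Metric.mem_closedBall])
    simpa using h2
  have e4 : |(dy l (x - u) y - dy l x y) * -v| ≤ K * |u| * |v| := by
    rw [abs_mul, abs_neg]
    exact mul_le_mul_of_nonneg_right e3 (abs_nonneg _)
  rw [← sub_eq_add_neg] at e1 e2
  -- The increment is split along the path. The vertical leg is expanded at `(x - u, y)`, and the
  -- last term corrects its slope to the one at `(x, y)` at the cost of the mixed derivative.
  have e5 : l (x - u) (y - v) - l x y + (dx l x y * u + dy l x y * v) =
      (l (x - u) (y - v) - l (x - u) y - dy l (x - u) y * -v) +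
      (l (x - u) y - l x y - dx l x y * -u) + (dy l (x - u) y - dy l x y) * -v := by ring
  rw [e5]
  have e6 : K * v ^ 2 + K * u ^ 2 + K * |u| * |v| ≤
      2 * hessSup l x y * (u ^ 2 + v ^ 2) + 4 * L * (|u| ^ 3 + |v| ^ 3) := by
    rw [hK, ← sq_abs u, ← sq_abs v]
    have hu := abs_nonneg u
    have hv := abs_nonneg v
    generalize |u| = p at *
    generalize |v| = q at *
    have hH := hessSup_nonneg (l := l) x y
    have hL : (0 : ℝ) ≤ L := L.2
    have i1 : q ^ 2 + p ^ 2 + p * q ≤ 2 * (p ^ 2 + q ^ 2) := by nlinarith [sq_nonneg (p - q)]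
    have i2 : (p + q) * (q ^ 2 + p ^ 2 + p * q) ≤ 4 * (p ^ 3 + q ^ 3) := by
      nlinarith [mul_nonneg (add_nonneg hu hv) (sq_nonneg (p - q)),
        mul_nonneg (mul_nonneg hu hv) (add_nonneg hu hv), pow_nonneg hu 3, pow_nonneg hv 3]
    have i3 := mul_le_mul_of_nonneg_left i1 hH
    have i4 := mul_le_mul_of_nonneg_left i2 hL
    calc _ = hessSup l x y * (q ^ 2 + p ^ 2 + p * q) +
          L * ((p + q) * (q ^ 2 + p ^ 2 + p * q)) := by ring
      _ ≤ _ := by linarith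
  calc _ ≤ K * (-v) ^ 2 + K * (-u) ^ 2 + K * |u| * |v| :=
        (abs_add_le _ _).trans (add_le_add ((abs_add_le _ _).trans (add_le_add e2 e1)) e4)
    _ = K * v ^ 2 + K * u ^ 2 + K * |u| * |v| := by ring
    _ ≤ _ := e6

end Taylor

/-! ### The test statistic as a V-statistic -/

section Algebra

variable {U V : Type*} {k : U → U → ℝ}

/-- The kernel of order four behind the empirical HSIC, before symmetrization. -/
def hsicKernel (k : U → U → ℝ) (ℓ : U × V → U × V → ℝ) (w : Fin 4 → U × V) : ℝ :=
  k (w 0).1 (w 1).1 * (ℓ (w 0) (w 1) + ℓ (w 2) (w 3) - 2 * ℓ (w 0) (w 2))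

/-- A kernel of order four that dominates `hsicKernel`. -/
def hsicMajorant (k : U → U → ℝ) (ℓ : U × V → U × V → ℝ) (w : Fin 4 → U × V) : ℝ :=
  |k (w 0).1 (w 1).1| * (ℓ (w 0) (w 1) + ℓ (w 2) (w 3) + 2 * ℓ (w 0) (w 2))

lemma symKernel_eq (ℓ : U × V → U × V → ℝ) (w : Fin 4 → U × V) :
    symKernel k ℓ w = (1 / 24 : ℝ) * ∑ σ : Equiv.Perm (Fin 4), hsicKernel k ℓ fun i => w (σ i) := by
  simp only [symKernel, hsicKernel, smul_eq_mul]

lemma symKernel_apply {d : ℕ} (ℓ : U × V → U × V → Fin d → ℝ) (w : Fin 4 → U × V) (a : Fin d) :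
    symKernel k ℓ w a = symKernel k (fun w w' => ℓ w w' a) w := by
  simp [symKernel, Finset.sum_apply]

lemma symKernel_perm (ℓ : U × V → U × V → ℝ) (w : Fin 4 → U × V) (τ : Equiv.Perm (Fin 4)) :
    symKernel k ℓ (fun i => w (τ i)) = symKernel k ℓ w := by
  rw [symKernel_eq, symKernel_eq]
  congr 1
  exact Fintype.sum_equiv (Equiv.mulLeft τ) _ _ fun σ => rfl

/-- The sum runs over all index tuples, so permuting the arguments merely reindexes it and
symmetrization changes nothing. -/
lemma vstat_symKernel (ℓ : U × V → U × V → ℝ) (n : ℕ) (w : ℕ → U × V) :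
    vstat (symKernel k ℓ) n w = vstat (hsicKernel k ℓ) n w := by
  simp only [vstat, symKernel_eq]
  rw [← Finset.mul_sum, Finset.sum_comm]
  have h1 : ∀ σ : Equiv.Perm (Fin 4), ∑ a : Fin 4 → Fin n, hsicKernel k ℓ (fun i => w (a (σ i))) =
      ∑ a : Fin 4 → Fin n, hsicKernel k ℓ fun i => w (a i) := fun σ =>
    Fintype.sum_equiv (Equiv.arrowCongr σ.symm (Equiv.refl (Fin n))) _ _ fun a => rfl
  simp only [h1, Finset.sum_const, Finset.card_univ, Fintype.card_perm, Fintype.card_fin,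
    nsmul_eq_mul]
  rw [show ((Nat.factorial 4 : ℕ) : ℝ) = 24 by norm_num [Nat.factorial]]
  ring

lemma sum_fin_four {n : ℕ} (F : Fin n → Fin n → Fin n → Fin n → ℝ) :
    ∑ a : Fin 4 → Fin n, F (a 0) (a 1) (a 2) (a 3) = ∑ i, ∑ j, ∑ q, ∑ r, F i j q r := by
  rw [← (Fin.consEquiv fun _ : Fin 4 => Fin n).sum_comp, Fintype.sum_prod_type]
  refine Finset.sum_congr rfl fun i _ => ?_
  rw [← (Fin.consEquiv fun _ : Fin 3 => Fin n).sum_comp, Fintype.sum_prod_type]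
  refine Finset.sum_congr rfl fun j _ => ?_
  rw [← (Fin.consEquiv fun _ : Fin 2 => Fin n).sum_comp, Fintype.sum_prod_type]
  refine Finset.sum_congr rfl fun q _ => ?_
  rw [← (Equiv.funUnique (Fin 1) (Fin n)).symm.sum_comp]
  rfl

/-- A term that does not involve all four indices gains a factor `n` for each free one, which turns
`n⁻⁴` into `n⁻²` and `n⁻³`. For `n = 0` both sides vanish. -/
lemma empiricalHSIC_eq_vstat (l : V → V → ℝ) (n : ℕ) (u : ℕ → U) (v : ℕ → V) :
    empiricalHSIC k l n (fun i => u i) (fun i => v i) =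
      vstat (hsicKernel k fun w w' => l w.2 w'.2) n fun i => (u i, v i) := by
  rcases Nat.eq_zero_or_pos n with rfl | hn
  · simp [empiricalHSIC, vstat]
  have hn' : (n : ℝ) ≠ 0 := by exact_mod_cast hn.ne'
  have e1 : ∑ a : Fin 4 → Fin n, k (u (a 0)) (u (a 1)) * l (v (a 0)) (v (a 1)) =
      (n : ℝ) ^ 2 * ∑ i : Fin n, ∑ j : Fin n, k (u i) (u j) * l (v i) (v j) := by
    rw [sum_fin_four fun a b _ _ => k (u a) (u b) * l (v a) (v b)]
    simp only [Finset.sum_const, Finset.card_univ, Fintype.card_fin, nsmul_eq_mul, Finset.mul_sum]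
    refine Finset.sum_congr rfl fun i _ => Finset.sum_congr rfl fun j _ => by ring
  have e2 : ∑ a : Fin 4 → Fin n, k (u (a 0)) (u (a 1)) * l (v (a 2)) (v (a 3)) =
      ∑ i : Fin n, ∑ j : Fin n, ∑ q : Fin n, ∑ r : Fin n, k (u i) (u j) * l (v q) (v r) :=
    sum_fin_four fun a b c e => k (u a) (u b) * l (v c) (v e)
  have e3 : ∑ a : Fin 4 → Fin n, k (u (a 0)) (u (a 1)) * l (v (a 0)) (v (a 2)) =
      n * ∑ i : Fin n, ∑ j : Fin n, ∑ q : Fin n, k (u i) (u j) * l (v i) (v q) := by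
    rw [sum_fin_four fun a b c _ => k (u a) (u b) * l (v a) (v c)]
    simp only [Finset.sum_const, Finset.card_univ, Fintype.card_fin, nsmul_eq_mul, Finset.mul_sum]
  have e4 : ∑ a : Fin 4 → Fin n, hsicKernel k (fun w w' => l w.2 w'.2)
      (fun i => (u (a i), v (a i))) =
      ∑ a : Fin 4 → Fin n, k (u (a 0)) (u (a 1)) * l (v (a 0)) (v (a 1)) +
      ∑ a : Fin 4 → Fin n, k (u (a 0)) (u (a 1)) * l (v (a 2)) (v (a 3)) -
      2 * ∑ a : Fin 4 → Fin n, k (u (a 0)) (u (a 1)) * l (v (a 0)) (v (a 2)) := by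
    rw [Finset.mul_sum, ← Finset.sum_add_distrib, ← Finset.sum_sub_distrib]
    exact Finset.sum_congr rfl fun a _ => by simp only [hsicKernel]; ring
  rw [vstat, e4, e1, e2, e3, empiricalHSIC]
  field_simp

lemma abs_vstat_le {E : Type*} {f F : (Fin 4 → E) → ℝ} (h : ∀ w, |f w| ≤ F w) (n : ℕ)
    (w : ℕ → E) : |vstat f n w| ≤ vstat F n w := by
  rw [vstat, vstat, abs_mul, abs_of_nonneg (by positivity)]
  exact mul_le_mul_of_nonneg_left
    ((Finset.abs_sum_le_sum_abs _ _).trans (Finset.sum_le_sum fun a _ => h _)) (by positivity)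

/-- If each residual is a perturbation of `ε` that is linear in `δ`, then the V-statistic of the
residuals is linear in `δ` up to terms of second and third order. -/
theorem abs_vstat_expansion_le {d : ℕ} {G : U → Fin d → ℝ} {l : ℝ → ℝ → ℝ}
    (hl : ContDiff ℝ 2 (Function.uncurry l)) {L : ℝ≥0}
    (hxx : LipschitzWith L (Function.uncurry (dx (dx l))))
    (hxy : LipschitzWith L (Function.uncurry (dx (dy l))))
    (hyy : LipschitzWith L (Function.uncurry (dy (dy l)))) (n : ℕ) (w : ℕ → U × ℝ)
    (δ : Fin d → ℝ) :
    |(vstat (hsicKernel k fun w w' => l w.2 w'.2) n fun i => ((w i).1, (w i).2 - G (w i).1 ⬝ᵥ δ)) -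
      vstat (hsicKernel k fun w w' => l w.2 w'.2) n w -
      ∑ a, δ a * vstat (hsicKernel k fun w w' =>
        (-(dx l w.2 w'.2 • G w.1 + dy l w.2 w'.2 • G w'.1)) a) n w| ≤
      (∑ a, |δ a|) ^ 2 * vstat (hsicMajorant k fun w w' =>
        2 * (hessSup l w.2 w'.2 * (‖G w.1‖ ^ 2 + ‖G w'.1‖ ^ 2))) n w +
      (∑ a, |δ a|) ^ 3 * vstat (hsicMajorant k fun w w' =>
        4 * L * (‖G w.1‖ ^ 3 + ‖G w'.1‖ ^ 3)) n w := by
  set D := ∑ a, |δ a| with hD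
  have hD0 : 0 ≤ D := Finset.sum_nonneg fun a _ => abs_nonneg _
  -- The pairwise Taylor remainder. Since `hsicKernel` is linear in its pair function, the whole
  -- difference to be bounded is the V-statistic built on `R`.
  let R : U × ℝ → U × ℝ → ℝ := fun p q =>
    l (p.2 - G p.1 ⬝ᵥ δ) (q.2 - G q.1 ⬝ᵥ δ) - l p.2 q.2 +
      (dx l p.2 q.2 * (G p.1 ⬝ᵥ δ) + dy l p.2 q.2 * (G q.1 ⬝ᵥ δ))
  have hdot : ∀ x, |G x ⬝ᵥ δ| ≤ ‖G x‖ * D := fun x => by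
    rw [dotProduct, hD, Finset.mul_sum]
    refine (Finset.abs_sum_le_sum_abs _ _).trans (Finset.sum_le_sum fun a _ => ?_)
    rw [abs_mul]
    exact mul_le_mul_of_nonneg_right (norm_le_pi_norm (G x) a) (abs_nonneg _)
  have hR : ∀ p q, |R p q| ≤ D ^ 2 * (2 * (hessSup l p.2 q.2 * (‖G p.1‖ ^ 2 + ‖G q.1‖ ^ 2))) +
      D ^ 3 * (4 * L * (‖G p.1‖ ^ 3 + ‖G q.1‖ ^ 3)) := fun p q => by
    refine (abs_taylor_remainder_le hl hxx hxy hyy p.2 q.2 _ _).trans ?_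
    have hp := hdot p.1
    have hq := hdot q.1
    have hp2 : (G p.1 ⬝ᵥ δ) ^ 2 ≤ (‖G p.1‖ * D) ^ 2 := by
      rw [← sq_abs]; exact pow_le_pow_left₀ (abs_nonneg _) hp 2
    have hq2 : (G q.1 ⬝ᵥ δ) ^ 2 ≤ (‖G q.1‖ * D) ^ 2 := by
      rw [← sq_abs]; exact pow_le_pow_left₀ (abs_nonneg _) hq 2
    have hp3 := pow_le_pow_left₀ (abs_nonneg _) hp 3
    have hq3 := pow_le_pow_left₀ (abs_nonneg _) hq 3
    have hH := hessSup_nonneg (l := l) p.2 q.2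
    have hL : (0 : ℝ) ≤ L := L.2
    calc _ ≤ 2 * hessSup l p.2 q.2 * ((‖G p.1‖ * D) ^ 2 + (‖G q.1‖ * D) ^ 2) +
          4 * L * ((‖G p.1‖ * D) ^ 3 + (‖G q.1‖ * D) ^ 3) := by gcongr
      _ = _ := by ring
  have hlin : (vstat (hsicKernel k fun w w' => l w.2 w'.2) n
        fun i => ((w i).1, (w i).2 - G (w i).1 ⬝ᵥ δ)) -
      vstat (hsicKernel k fun w w' => l w.2 w'.2) n w -
      ∑ a, δ a * vstat (hsicKernel k fun w w' =>
        (-(dx l w.2 w'.2 • G w.1 + dy l w.2 w'.2 • G w'.1)) a) n w =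
      vstat (hsicKernel k R) n w := by
    have hδ : ∀ p q : U × ℝ, ∑ a, δ a * (-(dx l p.2 q.2 • G p.1 + dy l p.2 q.2 • G q.1)) a =
        -(dx l p.2 q.2 * (G p.1 ⬝ᵥ δ) + dy l p.2 q.2 * (G q.1 ⬝ᵥ δ)) := fun p q => by
      simp only [Pi.neg_apply, Pi.add_apply, Pi.smul_apply, smul_eq_mul, dotProduct,
        Finset.mul_sum]
      rw [← Finset.sum_add_distrib, ← Finset.sum_neg_distrib]
      exact Finset.sum_congr rfl fun a _ => by ring
    have hker : ∀ v : Fin 4 → U × ℝ, ∑ a, δ a * hsicKernel k (fun w w' =>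
        (-(dx l w.2 w'.2 • G w.1 + dy l w.2 w'.2 • G w'.1)) a) v =
        hsicKernel k (fun p q => -(dx l p.2 q.2 * (G p.1 ⬝ᵥ δ) + dy l p.2 q.2 * (G q.1 ⬝ᵥ δ))) v :=
      fun v => by
        simp only [hsicKernel, ← hδ, Finset.mul_sum]
        rw [← Finset.sum_add_distrib, ← Finset.sum_sub_distrib, Finset.mul_sum]
        exact Finset.sum_congr rfl fun a _ => by ring
    have hsum : ∑ a, δ a * vstat (hsicKernel k fun w w' =>
        (-(dx l w.2 w'.2 • G w.1 + dy l w.2 w'.2 • G w'.1)) a) n w =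
        vstat (hsicKernel k fun p q =>
          -(dx l p.2 q.2 * (G p.1 ⬝ᵥ δ) + dy l p.2 q.2 * (G q.1 ⬝ᵥ δ))) n w := by
      simp only [vstat, ← hker]
      rw [Finset.sum_comm, Finset.mul_sum]
      refine Finset.sum_congr rfl fun a _ => ?_
      rw [← Finset.mul_sum]
      ring
    rw [hsum]
    simp only [vstat]
    rw [← mul_sub, ← mul_sub, ← Finset.sum_sub_distrib, ← Finset.sum_sub_distrib]
    congr 1
    refine Finset.sum_congr rfl fun a _ => ?_
    simp only [hsicKernel, R]
    ring
  rw [hlin]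
  have hmaj : ∀ v, |hsicKernel k R v| ≤ hsicMajorant k (fun p q =>
      D ^ 2 * (2 * (hessSup l p.2 q.2 * (‖G p.1‖ ^ 2 + ‖G q.1‖ ^ 2))) +
      D ^ 3 * (4 * L * (‖G p.1‖ ^ 3 + ‖G q.1‖ ^ 3))) v := fun v => by
    rw [hsicKernel, hsicMajorant, abs_mul]
    refine mul_le_mul_of_nonneg_left ?_ (abs_nonneg _)
    have h1 := hR (v 0) (v 1)
    have h2 := hR (v 2) (v 3)
    have h3 := hR (v 0) (v 2)
    rw [abs_le] at *
    constructor <;> linarith [h1.1, h1.2, h2.1, h2.2, h3.1, h3.2]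
  refine (abs_vstat_le hmaj n w).trans_eq ?_
  simp only [vstat]
  rw [mul_left_comm, mul_left_comm (D ^ 3), ← mul_add, Finset.mul_sum _ _ (D ^ 2),
    Finset.mul_sum _ _ (D ^ 3), ← Finset.sum_add_distrib]
  congr 1
  refine Finset.sum_congr rfl fun a _ => ?_
  simp only [hsicMajorant]
  ring

end Algebra

/-! ### Least squares -/

section LeastSquares

/-- Testing `t = p / (q + 1)` rather than the minimizer `p / q` avoids separating the case `q = 0`.
-/
lemma eq_zero_of_forall_quadratic_nonneg {p q : ℝ} (hq : 0 ≤ q)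
    (h : ∀ t : ℝ, 0 ≤ t ^ 2 * q - 2 * t * p) : p = 0 := by
  have h1 := h (p / (q + 1))
  have hq1 : 0 < q + 1 := by linarith
  have h2 : (p / (q + 1)) ^ 2 * q - 2 * (p / (q + 1)) * p = -(p ^ 2 * (q + 2)) / (q + 1) ^ 2 := by
    field_simp
    ring
  rw [h2, le_div_iff₀ (by positivity), zero_mul] at h1
  have h3 : p ^ 2 ≤ 0 := by nlinarith [sq_nonneg p]
  exact pow_eq_zero_iff two_ne_zero |>.mp (le_antisymm h3 (sq_nonneg p))

/-- The normal equations. -/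
lemma IsLSE.normal_equations {d₀ d : ℕ} {g : (Fin d₀ → ℝ) → Fin d → ℝ} {n : ℕ}
    {x : Fin n → Fin d₀ → ℝ} {y : Fin n → ℝ} {b : Fin d → ℝ} (h : IsLSE g n x y b) (a : Fin d) :
    ∑ i, g (x i) a * (y i - g (x i) ⬝ᵥ b) = 0 := by
  refine eq_zero_of_forall_quadratic_nonneg (q := ∑ i, g (x i) a ^ 2)
    (Finset.sum_nonneg fun i _ => sq_nonneg _) fun t => ?_
  -- Moving the minimizer by `t` in coordinate `a` changes the sum of squares by a quadratic in `t`
  -- whose linear coefficient is the normal equation.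
  have h1 := isMinOn_iff.mp h (b + t • Pi.single a 1) (Set.mem_univ _)
  rw [← sub_nonneg, ← Finset.sum_sub_distrib] at h1
  refine h1.trans_eq ?_
  rw [Finset.mul_sum, Finset.mul_sum, ← Finset.sum_sub_distrib]
  refine Finset.sum_congr rfl fun i _ => ?_
  rw [dotProduct_add, dotProduct_smul, dotProduct_single_one, smul_eq_mul]
  ring

lemma sum_abs_mulVec_le {d : ℕ} (M : Matrix (Fin d) (Fin d) ℝ) (x : Fin d → ℝ) :
    ∑ a, |(M *ᵥ x) a| ≤ (∑ a, ∑ b, |M a b|) * ∑ b, |x b| := by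
  rw [Finset.sum_mul]
  refine Finset.sum_le_sum fun a _ => ?_
  rw [Matrix.mulVec, dotProduct, Finset.sum_mul]
  refine (Finset.abs_sum_le_sum_abs _ _).trans (Finset.sum_le_sum fun b _ => ?_)
  rw [abs_mul]
  exact mul_le_mul_of_nonneg_left (Finset.single_le_sum (f := fun b => |x b|)
    (fun b _ => abs_nonneg _) (Finset.mem_univ b)) (abs_nonneg _)

variable {E Ω : Type*} [MeasurableSpace E] {mΩ : MeasurableSpace Ω} {μ : Measure Ω}
  [IsProbabilityMeasure μ] {Q : Measure E} [IsProbabilityMeasure Q] {W : ℕ → Ω → E}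

/-- A sample mean is the V-statistic of a kernel depending on one argument only. -/
lemma nullInProb_mean_sub {h : E → ℝ} (hm : Measurable h) (hi : Integrable h Q)
    (hW : ∀ i, HasLaw (W i) Q μ) (hind : iIndepFun W μ) :
    NullInProb μ fun n ω => (n : ℝ)⁻¹ * ∑ j : Fin n, h (W j ω) - ∫ x, h x ∂Q := by
  have h1 := nullInProb_vstat_sub (μ := μ) (W := W) (f := fun w => h (w 0))
    (hm.comp (measurable_pi_apply 0)) (patternIntegrable_coord hi 0) hW hind
  rw [integral_coord hi 0] at h1
  refine h1.mono fun n ω => le_of_eq ?_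
  congr 2
  rw [vstat, sum_tuple_apply n (fun j => h (W j ω)) 0]
  rcases Nat.eq_zero_or_pos n with rfl | hn
  · simp
  have hn' : (n : ℝ) ≠ 0 := by exact_mod_cast hn.ne'
  field_simp

/-- The Bahadur representation of the least squares estimator. -/
theorem leastSquares_expansion {d : ℕ} {G : E → Fin d → ℝ} (hG : Measurable G) {ε : E → ℝ}
    (hε : Measurable ε) (hG2 : Integrable (fun w => ‖G w‖ ^ 2) Q)
    (hGε : Integrable (fun w => ‖G w‖ ^ 2 * ε w ^ 2) Q) (h0 : ∀ a, ∫ w, G w a * ε w ∂Q = 0)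
    {A : Matrix (Fin d) (Fin d) ℝ} (hA : ∀ a b, A a b = ∫ w, G w a * G w b ∂Q) (hAu : IsUnit A)
    (hW : ∀ i, HasLaw (W i) Q μ) (hind : iIndepFun W μ) {δ : ℕ → Ω → Fin d → ℝ}
    (hδ : ∀ n ω a, ∑ i : Fin n, G (W i ω) a * (ε (W i ω) - G (W i ω) ⬝ᵥ δ n ω) = 0) :
    (BoundedInProb μ fun n ω => ∑ a, |√(n : ℝ) * δ n ω a|) ∧
    ∀ a, NullInProb μ fun n ω => √(n : ℝ) * δ n ω a -
      (A⁻¹ *ᵥ fun b => (√(n : ℝ))⁻¹ * ∑ i : Fin n, G (W i ω) b * ε (W i ω)) a := by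
  have hGa : ∀ a, Measurable fun w => G w a := fun a => (measurable_pi_apply a).comp hG
  let Ah : ℕ → Ω → Matrix (Fin d) (Fin d) ℝ := fun n ω =>
    Matrix.of fun a b => (n : ℝ)⁻¹ * ∑ i : Fin n, G (W i ω) a * G (W i ω) b
  let S : ℕ → Ω → Fin d → ℝ := fun n ω b => (√(n : ℝ))⁻¹ * ∑ i : Fin n, G (W i ω) b * ε (W i ω)
  let D : ℕ → Ω → Fin d → ℝ := fun n ω => √(n : ℝ) • δ n ω
  have hGi : ∀ a b, Integrable (fun w => G w a * G w b) Q := fun a b => by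
    refine hG2.mono' ((hGa a).mul (hGa b)).aestronglyMeasurable (ae_of_all _ fun w => ?_)
    rw [norm_mul, sq]
    exact mul_le_mul (norm_le_pi_norm _ a) (norm_le_pi_norm _ b) (norm_nonneg _) (norm_nonneg _)
  have hAh : ∀ a b, NullInProb μ fun n ω => (Ah n ω - A) a b := fun a b => by
    simp only [Matrix.sub_apply, hA, Ah, Matrix.of_apply]
    exact nullInProb_mean_sub (h := fun w => G w a * G w b) ((hGa a).mul (hGa b)) (hGi a b) hW hind
  have hS : ∀ b, BoundedInProb μ fun n ω => S n ω b := fun b => by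
    have hm : Measurable fun w => G w b * ε w := (hGa b).mul hε
    refine boundedInProb_inv_sqrt_mul_sum (h := fun w => G w b * ε w) ?_ (h0 b) hW hind hm
    rw [memLp_two_iff_integrable_sq hm.aestronglyMeasurable]
    refine hGε.mono' (hm.pow_const 2).aestronglyMeasurable (ae_of_all _ fun w => ?_)
    rw [Real.norm_eq_abs, abs_of_nonneg (sq_nonneg _), mul_pow]
    refine mul_le_mul_of_nonneg_right ?_ (sq_nonneg _)
    rw [← sq_abs]
    exact pow_le_pow_left₀ (abs_nonneg _) (norm_le_pi_norm (G w) b) 2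
  -- the normal equations in matrix form
  have hnormal : ∀ n ω, 0 < n → Ah n ω *ᵥ D n ω = S n ω := by
    intro n ω hn
    have hn' : (0 : ℝ) < n := by exact_mod_cast hn
    have hs : 0 < √(n : ℝ) := Real.sqrt_pos.mpr hn'
    have hss : √(n : ℝ) ^ 2 = n := Real.sq_sqrt hn'.le
    ext a
    have h1 := hδ n ω a
    simp only [mul_sub, Finset.sum_sub_distrib, sub_eq_zero] at h1
    simp only [S, D, h1, Matrix.mulVec_smul, Pi.smul_apply, smul_eq_mul]
    have h2 : (Ah n ω *ᵥ δ n ω) a = (n : ℝ)⁻¹ * ∑ i : Fin n, G (W i ω) a * G (W i ω) ⬝ᵥ δ n ω := by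
      simp only [Matrix.mulVec, dotProduct, Ah, Matrix.of_apply, Finset.mul_sum, Finset.sum_mul]
      rw [Finset.sum_comm]
      exact Finset.sum_congr rfl fun i _ => Finset.sum_congr rfl fun b _ => by ring
    rw [h2, show ((n : ℝ))⁻¹ = (√(n : ℝ))⁻¹ * (√(n : ℝ))⁻¹ by rw [← mul_inv, ← sq, hss]]
    field_simp
  -- Only the population matrix is inverted; the sample matrix may be singular.
  have hrep : ∀ n ω, 0 < n → D n ω - A⁻¹ *ᵥ S n ω = -(A⁻¹ *ᵥ ((Ah n ω - A) *ᵥ D n ω)) := by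
    intro n ω hn
    rw [Matrix.sub_mulVec, hnormal n ω hn, Matrix.mulVec_sub, Matrix.mulVec_mulVec,
      Matrix.nonsing_inv_mul _ ((Matrix.isUnit_iff_isUnit_det A).mp hAu), Matrix.one_mulVec]
    abel
  set κ := ∑ a, ∑ b, |A⁻¹ a b| with hκ
  have hκ0 : 0 ≤ κ := Finset.sum_nonneg fun a _ => Finset.sum_nonneg fun b _ => abs_nonneg _
  let ρ : ℕ → Ω → ℝ := fun n ω => ∑ a, ∑ b, |(Ah n ω - A) a b|
  have hρ : NullInProb μ ρ :=
    NullInProb.sum _ fun a _ => NullInProb.sum _ fun b _ => (hAh a b).abs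
  have hρ0 : ∀ n ω, 0 ≤ ρ n ω := fun n ω =>
    Finset.sum_nonneg fun a _ => Finset.sum_nonneg fun b _ => abs_nonneg _
  have hS1 : BoundedInProb μ fun n ω => ∑ a, |S n ω a| :=
    BoundedInProb.sum _ fun a _ => (hS a).abs
  have hpos : Tendsto (fun n : ℕ => μ {_ω : Ω | 0 < n}ᶜ) atTop (𝓝 0) := by
    refine tendsto_const_nhds.congr' ?_
    filter_upwards [eventually_gt_atTop 0] with n hn
    simp [hn]
  have hrem : ∀ n ω, 0 < n → ∑ a, |(D n ω - A⁻¹ *ᵥ S n ω) a| ≤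
      κ * (ρ n ω * ∑ a, |D n ω a|) := by
    intro n ω hn
    rw [hrep n ω hn]
    simp only [Pi.neg_apply, abs_neg]
    exact (sum_abs_mulVec_le _ _).trans
      (mul_le_mul_of_nonneg_left (sum_abs_mulVec_le _ _) hκ0)
  have hD : BoundedInProb μ fun n ω => ∑ a, |D n ω a| := by
    -- Self-bounding: `|D| ≤ κ ρ |D| + κ |S|` in `ℓ¹` norm, and where `κ ρ < 1/2` the first term is
    -- absorbed on the left, giving the constant `2 κ`. As `ρ` is `o_P(1)`, these events have
    -- probability tending to one.
    refine (hS1.const_mul (2 * κ)).mono_on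
      (G := fun n => {ω | 0 < n} ∩ {ω | κ * ρ n ω < 1 / 2}) ?_ ?_
    · have h1 := hρ.const_mul κ (1 / 2) (by norm_num)
      have h2 := hpos.add h1
      rw [add_zero] at h2
      refine tendsto_of_tendsto_of_tendsto_of_le_of_le tendsto_const_nhds h2 (fun _ => zero_le)
        fun n => ?_
      rw [Set.compl_inter]
      refine (measure_union_le _ _).trans (add_le_add le_rfl (measure_mono fun ω hω => ?_))
      simp only [Set.mem_compl_iff, Set.mem_ofPred_eq, not_lt] at hω
      exact hω.trans (le_abs_self _)
    · rintro n ω ⟨hn, hlt⟩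
      simp only [Set.mem_ofPred_eq] at hn hlt
      have h1 := hrem n ω hn
      have h2 := sum_abs_mulVec_le A⁻¹ (S n ω)
      have h3 : ∑ a, |D n ω a| ≤ ∑ a, |(D n ω - A⁻¹ *ᵥ S n ω) a| + ∑ a, |(A⁻¹ *ᵥ S n ω) a| := by
        rw [← Finset.sum_add_distrib]
        refine Finset.sum_le_sum fun a _ => ?_
        have := abs_add_le ((D n ω - A⁻¹ *ᵥ S n ω) a) ((A⁻¹ *ᵥ S n ω) a)
        simpa using this
      have hD0 : 0 ≤ ∑ a, |D n ω a| := Finset.sum_nonneg fun a _ => abs_nonneg _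
      have hS0 : 0 ≤ ∑ a, |S n ω a| := Finset.sum_nonneg fun a _ => abs_nonneg _
      have h4 := mul_le_mul_of_nonneg_right hlt.le hD0
      rw [abs_of_nonneg hD0, abs_of_nonneg (by positivity)]
      rw [← hκ] at h2
      linarith
  refine ⟨hD, fun a => ?_⟩
  refine ((hρ.mul hD).const_mul κ).mono_on (G := fun n => {_ω | 0 < n}) hpos fun n ω hn => ?_
  have hD0 : 0 ≤ ∑ a, |D n ω a| := Finset.sum_nonneg fun a _ => abs_nonneg _
  rw [abs_of_nonneg (mul_nonneg hκ0 (mul_nonneg (hρ0 n ω) hD0))]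
  refine le_trans ?_ (hrem n ω hn)
  exact Finset.single_le_sum (f := fun a => |(D n ω - A⁻¹ *ᵥ S n ω) a|)
    (fun a _ => abs_nonneg _) (Finset.mem_univ a)

end LeastSquares

/-! ### Laws of coordinates under the product measure -/

section Coordinates

variable {E : Type*} [MeasurableSpace E] {Q : Measure E} [IsProbabilityMeasure Q]
  {ι κ : Type*} [Fintype ι] [Fintype κ]

lemma iIndepFun_eval : iIndepFun (fun (i : ι) (w : ι → E) => w i) (Measure.pi fun _ => Q) :=
  iIndepFun_pi (X := fun _ x => x) fun _ => aemeasurable_id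

lemma hasLaw_eval (i : ι) : HasLaw (fun w : ι → E => w i) Q (Measure.pi fun _ => Q) :=
  (measurePreserving_eval (fun _ : ι => Q) i).hasLaw

lemma hasLaw_precomp {p : κ → ι} (hp : Function.Injective p) :
    HasLaw (fun (w : ι → E) j => w (p j)) (Measure.pi fun _ => Q) (Measure.pi fun _ => Q) :=
  (iIndepFun_eval.precomp hp).hasLaw_pi fun j => hasLaw_eval (p j)

lemma hasLaw_pair {i j : ι} (h : i ≠ j) :
    HasLaw (fun w : ι → E => (w i, w j)) (Q.prod Q) (Measure.pi fun _ => Q) :=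
  (iIndepFun_eval.indepFun h).hasLaw_prod (hasLaw_eval i) (hasLaw_eval j)

lemma hasLaw_triple {i j m : ι} (h : i ≠ j) (h' : i ≠ m) (h'' : j ≠ m) :
    HasLaw (fun w : ι → E => (w i, (w j, w m))) (Q.prod (Q.prod Q)) (Measure.pi fun _ => Q) :=
  (iIndepFun_eval.indepFun_prodMk (fun i => measurable_pi_apply i) j m i h.symm
    h'.symm).symm.hasLaw_prod (hasLaw_eval i) (hasLaw_pair h'')

/-- For a symmetric kernel, the projections on all the arguments coincide. -/
lemma integral_update_eq {f : (Fin 4 → E) → ℝ} (hf : Measurable f)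
    (hsymm : ∀ (τ : Equiv.Perm (Fin 4)) w, f (fun i => w (τ i)) = f w) (i : Fin 4) (x : E) :
    ∫ w, f (Function.update w i x) ∂(Measure.pi fun _ => Q) =
      ∫ v : Fin 3 → E, f (Matrix.vecCons x v) ∂(Measure.pi fun _ => Q) := by
  -- The three indices `swap 0 i j.succ` are those different from `i`; applying the same swap to the
  -- updated vector moves `x` to the front.
  have hl := hasLaw_precomp (E := E) (Q := Q) (p := fun j : Fin 3 => Equiv.swap 0 i j.succ)
    ((Equiv.injective _).comp (Fin.succ_injective _))
  have hm : Measurable fun v : Fin 3 → E => f (Matrix.vecCons x v) := by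
    refine hf.comp (measurable_pi_lambda _ fun j => ?_)
    refine Fin.cases ?_ (fun j => ?_) j
    · exact measurable_const
    · exact measurable_pi_apply j
  rw [← hl.integral_comp hm.aestronglyMeasurable]
  refine integral_congr_ae (ae_of_all _ fun w => ?_)
  change f (Function.update w i x) = f (Matrix.vecCons x fun j => w (Equiv.swap 0 i j.succ))
  rw [← hsymm (Equiv.swap 0 i) (Function.update w i x)]
  congr 1
  ext j
  refine Fin.cases ?_ (fun j => ?_) j
  · simp
  · have : Equiv.swap 0 i j.succ ≠ i := fun h => by
      have h1 := (Equiv.swap (0 : Fin 4) i).injective (h.trans (Equiv.swap_apply_left 0 i).symm)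
      exact Fin.succ_ne_zero j h1
    rw [Function.update_of_ne this]
    rfl

end Coordinates

/-! ### Integrability and means of the kernel of order four -/

section KernelIntegrals

variable {U V : Type*} [MeasurableSpace U] [MeasurableSpace V] {Q : Measure (U × V)}
  [IsProbabilityMeasure Q] {k : U → U → ℝ} {ℓ : U × V → U × V → ℝ}

lemma patternIntegrable_hsicKernel (h : ∀ q r s t : Fin 4,
      Integrable (fun w : Fin 4 → U × V => k (w q).1 (w r).1 * ℓ (w s) (w t))
        (Measure.pi fun _ => Q)) : PatternIntegrable Q (hsicKernel k ℓ) := fun p => by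
  simp only [hsicKernel]
  refine (((h (p 0) (p 1) (p 0) (p 1)).add (h (p 0) (p 1) (p 2) (p 3))).sub
    ((h (p 0) (p 1) (p 0) (p 2)).const_mul 2)).congr (ae_of_all _ fun w => ?_)
  simp only [Pi.add_apply, Pi.sub_apply]
  ring

lemma patternIntegrable_hsicMajorant (h : ∀ q r s t : Fin 4,
      Integrable (fun w : Fin 4 → U × V => |k (w q).1 (w r).1| * ℓ (w s) (w t))
        (Measure.pi fun _ => Q)) : PatternIntegrable Q (hsicMajorant k ℓ) := fun p => by
  simp only [hsicMajorant]
  refine (((h (p 0) (p 1) (p 0) (p 1)).add (h (p 0) (p 1) (p 2) (p 3))).add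
    ((h (p 0) (p 1) (p 0) (p 2)).const_mul 2)).congr (ae_of_all _ fun w => ?_)
  simp only [Pi.add_apply]
  ring

lemma patternIntegrable_symKernel (h : ∀ q r s t : Fin 4,
      Integrable (fun w : Fin 4 → U × V => k (w q).1 (w r).1 * ℓ (w s) (w t))
        (Measure.pi fun _ => Q)) : PatternIntegrable Q (symKernel k ℓ) := fun p => by
  simp only [symKernel_eq]
  exact (integrable_finsetSum _ fun σ _ =>
    patternIntegrable_hsicKernel h fun i => p ((σ : Equiv.Perm (Fin 4)) i)).const_mul _

lemma memLp_hsicKernel {p : Fin 4 → Fin 4} (h : ∀ q r s t : Fin 4,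
      MemLp (fun w : Fin 4 → U × V => k (w q).1 (w r).1 * ℓ (w s) (w t)) 2
        (Measure.pi fun _ => Q)) :
    MemLp (fun w : Fin 4 → U × V => hsicKernel k ℓ fun i => w (p i)) 2
      (Measure.pi fun _ => Q) := by
  simp only [hsicKernel]
  refine (((h (p 0) (p 1) (p 0) (p 1)).add (h (p 0) (p 1) (p 2) (p 3))).sub
    ((h (p 0) (p 1) (p 0) (p 2)).const_mul 2)).ae_eq (ae_of_all _ fun w => ?_)
  simp only [Pi.add_apply, Pi.sub_apply]
  ring

lemma memLp_symKernel (h : ∀ q r s t : Fin 4,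
      MemLp (fun w : Fin 4 → U × V => k (w q).1 (w r).1 * ℓ (w s) (w t)) 2
        (Measure.pi fun _ => Q)) : MemLp (symKernel k ℓ) 2 (Measure.pi fun _ => Q) := by
  have h1 : symKernel k ℓ = fun w => (1 / 24 : ℝ) * ∑ σ : Equiv.Perm (Fin 4),
      hsicKernel k ℓ fun i => w (σ i) := funext fun w => symKernel_eq ℓ w
  rw [h1]
  exact (memLp_finsetSum Finset.univ (f := fun (σ : Equiv.Perm (Fin 4)) (w : Fin 4 → U × V) =>
    hsicKernel k ℓ fun i => w (σ i)) fun σ _ => memLp_hsicKernel (p := σ) h).const_mul _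

lemma measurable_hsicKernel (hk : Measurable (Function.uncurry k))
    (hℓ : Measurable (Function.uncurry ℓ)) : Measurable (hsicKernel k ℓ) := by
  have h1 : ∀ i j : Fin 4, Measurable fun w : Fin 4 → U × V => k (w i).1 (w j).1 := fun i j =>
    hk.comp ((measurable_pi_apply i).fst.prodMk (measurable_pi_apply j).fst)
  have h2 : ∀ i j : Fin 4, Measurable fun w : Fin 4 → U × V => ℓ (w i) (w j) := fun i j =>
    hℓ.comp (f := fun w : Fin 4 → U × V => (w i, w j))
      ((measurable_pi_apply i).prodMk (measurable_pi_apply j))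
  exact (h1 0 1).mul (((h2 0 1).add (h2 2 3)).sub ((h2 0 2).const_mul 2))

lemma measurable_symKernel (hk : Measurable (Function.uncurry k))
    (hℓ : Measurable (Function.uncurry ℓ)) : Measurable (symKernel k ℓ) := by
  have h1 : symKernel k ℓ = fun w => (1 / 24 : ℝ) * ∑ σ : Equiv.Perm (Fin 4),
      hsicKernel k ℓ fun i => w (σ i) := funext fun w => symKernel_eq ℓ w
  rw [h1]
  refine Measurable.const_mul (Finset.measurable_fun_sum _ fun σ _ => ?_) _
  exact (measurable_hsicKernel hk hℓ).comp (measurable_pi_lambda _ fun i => measurable_pi_apply _)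

/-- Permuting i.i.d. coordinates preserves their law, so all `24` summands have the same mean. -/
lemma integral_symKernel (hk : Measurable (Function.uncurry k))
    (hℓ : Measurable (Function.uncurry ℓ)) (h : ∀ q r s t : Fin 4,
      Integrable (fun w : Fin 4 → U × V => k (w q).1 (w r).1 * ℓ (w s) (w t))
        (Measure.pi fun _ => Q)) :
    ∫ w, symKernel k ℓ w ∂(Measure.pi fun _ => Q) =
      ∫ w, hsicKernel k ℓ w ∂(Measure.pi fun _ => Q) := by
  simp only [symKernel_eq]
  rw [integral_const_mul, integral_finsetSum _ fun σ _ =>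
    patternIntegrable_hsicKernel h fun i => (σ : Equiv.Perm (Fin 4)) i]
  have h1 : ∀ σ : Equiv.Perm (Fin 4), ∫ w : Fin 4 → U × V, hsicKernel k ℓ (fun i => w (σ i))
      ∂(Measure.pi fun _ => Q) = ∫ w, hsicKernel k ℓ w ∂(Measure.pi fun _ => Q) := fun σ =>
    (hasLaw_precomp σ.injective).integral_comp (measurable_hsicKernel hk hℓ).aestronglyMeasurable
  simp only [h1, Finset.sum_const, Finset.card_univ, Fintype.card_perm, Fintype.card_fin,
    nsmul_eq_mul]
  rw [show ((Nat.factorial 4 : ℕ) : ℝ) = 24 by norm_num [Nat.factorial]]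
  ring

/-- The mean of the kernel of order four is the HSIC. -/
theorem integral_hsicKernel {l : V → V → ℝ} (hk : Measurable (Function.uncurry k))
    (hl : Measurable (Function.uncurry l)) (h : ∀ q r s t : Fin 4,
      Integrable (fun w : Fin 4 → U × V => k (w q).1 (w r).1 * l (w s).2 (w t).2)
        (Measure.pi fun _ => Q)) :
    ∫ w, hsicKernel k (fun w w' => l w.2 w'.2) w ∂(Measure.pi fun _ => Q) = hsic k l Q := by
  have hk1 : Measurable fun p : (U × V) × (U × V) => k p.1.1 p.2.1 :=
    hk.comp (measurable_fst.fst.prodMk measurable_snd.fst)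
  have hl1 : Measurable fun p : (U × V) × (U × V) => l p.1.2 p.2.2 :=
    hl.comp (measurable_fst.snd.prodMk measurable_snd.snd)
  have e1 : ∫ w : Fin 4 → U × V, k (w 0).1 (w 1).1 * l (w 0).2 (w 1).2 ∂(Measure.pi fun _ => Q) =
      ∫ p, k p.1.1 p.2.1 * l p.1.2 p.2.2 ∂(Q.prod Q) :=
    (hasLaw_pair (by decide : (0 : Fin 4) ≠ 1)).integral_comp
      (f := fun p : (U × V) × (U × V) => k p.1.1 p.2.1 * l p.1.2 p.2.2)
      (hk1.mul hl1).aestronglyMeasurable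
  have e2 : ∫ w : Fin 4 → U × V, k (w 0).1 (w 1).1 * l (w 2).2 (w 3).2 ∂(Measure.pi fun _ => Q) =
      (∫ p, k p.1.1 p.2.1 ∂(Q.prod Q)) * ∫ p, l p.1.2 p.2.2 ∂(Q.prod Q) := by
    have hi := (iIndepFun_eval (E := U × V) (ι := Fin 4) (Q := Q)).indepFun_prodMk_prodMk
      (fun i => measurable_pi_apply i) 0 1 2 3 (by decide) (by decide) (by decide) (by decide)
    have h01 := (hasLaw_pair (E := U × V) (Q := Q) (by decide : (0 : Fin 4) ≠ 1)).integral_comp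
      hk1.aestronglyMeasurable
    have h23 := (hasLaw_pair (E := U × V) (Q := Q) (by decide : (2 : Fin 4) ≠ 3)).integral_comp
      hl1.aestronglyMeasurable
    rw [← h01, ← h23]
    have hi' := hi.comp hk1 hl1
    exact hi'.integral_fun_mul_eq_mul_integral
      (hk1.comp ((measurable_pi_apply 0).prodMk (measurable_pi_apply 1))).aestronglyMeasurable
      (hl1.comp ((measurable_pi_apply 2).prodMk (measurable_pi_apply 3))).aestronglyMeasurable
  have e3 : ∫ w : Fin 4 → U × V, k (w 0).1 (w 1).1 * l (w 0).2 (w 2).2 ∂(Measure.pi fun _ => Q) =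
      ∫ p, k p.1.1 p.2.1.1 * l p.1.2 p.2.2.2 ∂(Q.prod (Q.prod Q)) :=
    (hasLaw_triple (by decide : (0 : Fin 4) ≠ 1) (by decide : (0 : Fin 4) ≠ 2)
      (by decide : (1 : Fin 4) ≠ 2)).integral_comp
      (f := fun p : (U × V) × (U × V) × (U × V) => k p.1.1 p.2.1.1 * l p.1.2 p.2.2.2)
      ((hk.comp (measurable_fst.fst.prodMk measurable_snd.fst.fst)).mul
        (hl.comp (measurable_fst.snd.prodMk measurable_snd.snd.snd))).aestronglyMeasurable
  have hadd : Integrable (fun w : Fin 4 → U × V => k (w 0).1 (w 1).1 * l (w 0).2 (w 1).2 +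
      k (w 0).1 (w 1).1 * l (w 2).2 (w 3).2) (Measure.pi fun _ => Q) :=
    (h 0 1 0 1).add (h 0 1 2 3)
  rw [hsic, ← e1, ← e2, ← e3, ← integral_const_mul, ← integral_add (h 0 1 0 1) (h 0 1 2 3),
    ← integral_sub hadd ((h 0 1 0 2).const_mul 2)]
  refine integral_congr_ae (ae_of_all _ fun w => ?_)
  simp only [hsicKernel]
  ring

end KernelIntegrals

/-- Symmetry of `h0` makes its four projections equal; this is the origin of the factor `4` in the
influence function. -/
lemma sum_proj_h0 {d₀ : ℕ} {k : (Fin d₀ → ℝ) → (Fin d₀ → ℝ) → ℝ} {l : ℝ → ℝ → ℝ}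
    {Q : Measure ((Fin d₀ → ℝ) × ℝ)} [IsProbabilityMeasure Q]
    (hk : Measurable (Function.uncurry k)) (hl : Measurable (Function.uncurry l))
    (h : ∫ w, h0 k l w ∂(Measure.pi fun _ => Q) = hsic k l Q) (x : (Fin d₀ → ℝ) × ℝ) :
    ∑ i, proj Q (h0 k l) i x = 4 * h0proj k l Q x := by
  have hm : Measurable (h0 k l) := measurable_symKernel hk
    (hl.comp (measurable_fst.snd.prodMk measurable_snd.snd))
  have h1 : ∀ i, proj Q (h0 k l) i x = h0proj k l Q x := fun i => by
    rw [proj, h, h0proj, integral_update_eq hm (fun τ w => symKernel_perm _ w τ)]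
  simp [h1]

/-! ### Dependence under the alternatives -/

section Alternatives

/-- By Cauchy–Schwarz, `k x x = 0` makes `k · x` vanish identically. The Dirac masses at `x` and `y`
then both embed to zero, and injectivity identifies them. So the diagonal has at most one zero. -/
lemma IsCharacteristicKernel.eq_of_self_eq_zero {U : Type*} [MeasurableSpace U]
    [MeasurableSingletonClass U] {k : U → U → ℝ} (hk : IsCharacteristicKernel k)
    (hkm : Measurable (Function.uncurry k)) {x y : U} (hx : k x x = 0) (hy : k y y = 0) :
    x = y := by
  have hdiag : Measurable fun x => k x x := hkm.comp (measurable_id.prodMk measurable_id)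
  have hrow : ∀ a, Measurable fun x => k a x := fun a =>
    hkm.comp (measurable_const.prodMk measurable_id)
  have h0 : ∀ z, k z z = 0 → ∀ v, k v z = 0 := fun z hz v => by
    have := abs_kernel_le hk.posSemidef v z
    rw [hz, Real.sqrt_zero, mul_zero] at this
    exact abs_nonpos_iff.mp this
  have hi : ∀ z, Integrable (fun u => k u u) (Measure.dirac z) := fun z =>
    (integrable_dirac (f := fun u => k u u) (by simp))
  have := hk.injective (Measure.dirac x) (Measure.dirac y) inferInstance inferInstance
    (hi x) (hi y) fun v => by
      rw [integral_dirac, integral_dirac, h0 x hx, h0 y hy]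
  exact dirac_eq_dirac_iff.mp this

variable {d₀ d : ℕ} {P : Measure ((Fin d₀ → ℝ) × ℝ)} [IsProbabilityMeasure P]
  {g : (Fin d₀ → ℝ) → Fin d → ℝ} {m : (Fin d₀ → ℝ) → ℝ}

lemma measurable_misfit (hg : Measurable g) (hm : Measurable m) :
    Measurable (misfit P g m) := by
  have h1 : ∀ a, Measurable fun x => g x a := fun a => (measurable_pi_apply a).comp hg
  change Measurable fun x => m x - ∑ a, g x a * bestCoef P g m a
  exact hm.sub (Finset.measurable_fun_sum _ fun a _ => (h1 a).mul_const _)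

lemma measurable_errorMap (hg : Measurable g) (hm : Measurable m) :
    Measurable fun z : (Fin d₀ → ℝ) × ℝ => (z.1, misfit P g m z.1 + z.2) :=
  measurable_fst.prodMk (((measurable_misfit hg hm).comp measurable_fst).add measurable_snd)

lemma isProbabilityMeasure_errorLaw (hg : Measurable g) (hm : Measurable m) :
    IsProbabilityMeasure (errorLaw P g m) :=
  Measure.isProbabilityMeasure_map (measurable_errorMap hg hm).aemeasurable

/-- A function of `X` can be pulled out of the conditional expectation given `X`, which vanishes on
`η`. -/
lemma integral_mul_eq_zero_of_condExp {f : (Fin d₀ → ℝ) → ℝ} (hf : Measurable f)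
    (hi : Integrable (fun z : (Fin d₀ → ℝ) × ℝ => f z.1 * z.2) P)
    (hηi : Integrable (fun z : (Fin d₀ → ℝ) × ℝ => z.2) P)
    (hη : P[fun z => z.2 | MeasurableSpace.comap (fun z : (Fin d₀ → ℝ) × ℝ => z.1) inferInstance]
      =ᵐ[P] 0) : ∫ z, f z.1 * z.2 ∂P = 0 := by
  have hle : MeasurableSpace.comap (fun z : (Fin d₀ → ℝ) × ℝ => z.1) inferInstance ≤
      (inferInstance : MeasurableSpace ((Fin d₀ → ℝ) × ℝ)) := measurable_fst.comap_le
  have hsm : StronglyMeasurable[MeasurableSpace.comap (fun z : (Fin d₀ → ℝ) × ℝ => z.1)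
      inferInstance] fun z : (Fin d₀ → ℝ) × ℝ => f z.1 :=
    (hf.comp (comap_measurable _)).stronglyMeasurable
  have h1 := condExp_mul_of_stronglyMeasurable_left hsm (g := fun z : (Fin d₀ → ℝ) × ℝ => z.2)
    hi hηi
  rw [← integral_condExp hle]
  refine integral_eq_zero_of_ae ?_
  filter_upwards [h1, hη] with z hz1 hz2
  have hz1' : P[fun z : (Fin d₀ → ℝ) × ℝ => f z.1 * z.2 | MeasurableSpace.comap
      (fun z : (Fin d₀ → ℝ) × ℝ => z.1) inferInstance] z = f z.1 *
      P[fun z : (Fin d₀ → ℝ) × ℝ => z.2 | MeasurableSpace.comap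
      (fun z : (Fin d₀ → ℝ) × ℝ => z.1) inferInstance] z := hz1
  rw [hz1', hz2]
  simp

lemma memLp_coord (hg : Measurable g) (hg2 : Integrable (fun z => ‖g z.1‖ ^ 2) P) (a : Fin d) :
    MemLp (fun z : (Fin d₀ → ℝ) × ℝ => g z.1 a) 2 P := by
  have h1 : Measurable fun z : (Fin d₀ → ℝ) × ℝ => g z.1 a :=
    ((measurable_pi_apply a).comp hg).comp measurable_fst
  rw [memLp_two_iff_integrable_sq h1.aestronglyMeasurable]
  refine hg2.mono' (h1.pow_const 2).aestronglyMeasurable (ae_of_all _ fun z => ?_)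
  rw [Real.norm_eq_abs, abs_of_nonneg (sq_nonneg _), ← sq_abs]
  exact pow_le_pow_left₀ (abs_nonneg _) (norm_le_pi_norm (g z.1) a) 2

lemma memLp_misfit (hg : Measurable g) (hm : Measurable m)
    (hg2 : Integrable (fun z => ‖g z.1‖ ^ 2) P) (hm2 : Integrable (fun z => m z.1 ^ 2) P) :
    MemLp (fun z : (Fin d₀ → ℝ) × ℝ => misfit P g m z.1) 2 P := by
  simp only [misfit, dotProduct]
  refine ((memLp_two_iff_integrable_sq
    (hm.comp measurable_fst).aestronglyMeasurable).mpr hm2).sub (memLp_finsetSum _ fun a _ => ?_)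
  exact (memLp_coord hg hg2 a).mul_const _

lemma memLp_eta (hη2 : Integrable (fun z => z.2 ^ 2) P) :
    MemLp (fun z : (Fin d₀ → ℝ) × ℝ => z.2) 2 P :=
  (memLp_two_iff_integrable_sq measurable_snd.aestronglyMeasurable).mpr hη2

/-- The error is uncorrelated with the predictors. -/
lemma integral_mul_error_eq_zero (hg : Measurable g) (hm : Measurable m)
    (hg2 : Integrable (fun z => ‖g z.1‖ ^ 2) P) (hm2 : Integrable (fun z => m z.1 ^ 2) P)
    (hη2 : Integrable (fun z => z.2 ^ 2) P)
    (hη : P[fun z => z.2 | MeasurableSpace.comap (fun z : (Fin d₀ → ℝ) × ℝ => z.1) inferInstance]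
      =ᵐ[P] 0) (hI : IsUnit (designMatrix P g)) (a : Fin d) :
    ∫ w, g w.1 a * w.2 ∂(errorLaw P g m) = 0 := by
  have hga : ∀ a, Measurable fun x => g x a := fun a => (measurable_pi_apply a).comp hg
  have hmm : Measurable fun w : (Fin d₀ → ℝ) × ℝ => g w.1 a * w.2 :=
    ((hga a).comp measurable_fst).mul measurable_snd
  rw [errorLaw, integral_map (measurable_errorMap hg hm).aemeasurable hmm.aestronglyMeasurable]
  have i1 : Integrable (fun z : (Fin d₀ → ℝ) × ℝ => g z.1 a * m z.1) P :=
    (memLp_coord hg hg2 a).integrable_mul ((memLp_two_iff_integrable_sq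
      (hm.comp measurable_fst).aestronglyMeasurable).mpr hm2)
  have i2 : ∀ b, Integrable (fun z : (Fin d₀ → ℝ) × ℝ => g z.1 a * g z.1 b) P := fun b =>
    (memLp_coord hg hg2 a).integrable_mul (memLp_coord hg hg2 b)
  have i3 : Integrable (fun z : (Fin d₀ → ℝ) × ℝ => g z.1 a * z.2) P :=
    (memLp_coord hg hg2 a).integrable_mul (memLp_eta hη2)
  have h1 : ∀ z : (Fin d₀ → ℝ) × ℝ, g z.1 a * (misfit P g m z.1 + z.2) =
      g z.1 a * m z.1 - ∑ b, g z.1 a * g z.1 b * bestCoef P g m b + g z.1 a * z.2 := fun z => by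
    rw [misfit, dotProduct, mul_add, mul_sub, Finset.mul_sum]
    simp only [mul_assoc]
  have i4 : Integrable (fun z : (Fin d₀ → ℝ) × ℝ =>
      ∑ b, g z.1 a * g z.1 b * bestCoef P g m b) P :=
    integrable_finsetSum _ fun b _ => (i2 b).mul_const _
  have i5 : Integrable (fun z : (Fin d₀ → ℝ) × ℝ => g z.1 a * m z.1 -
      ∑ b, g z.1 a * g z.1 b * bestCoef P g m b) P := i1.sub i4
  simp only [h1]
  rw [integral_add i5 i3, integral_sub i1 i4, integral_finsetSum _ fun b _ => (i2 b).mul_const _,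
    integral_mul_eq_zero_of_condExp (hga a) i3 ((memLp_eta hη2).integrable one_le_two) hη]
  -- The sum is `A` applied to `bestCoef`, that is `A A⁻¹ E[m g]`, and cancels the first term.
  have h2 : ∑ b, ∫ z, g z.1 a * g z.1 b * bestCoef P g m b ∂P =
      (designMatrix P g *ᵥ bestCoef P g m) a := by
    simp only [integral_mul_const, Matrix.mulVec, dotProduct, designMatrix, Matrix.of_apply]
  rw [h2, bestCoef, Matrix.mulVec_mulVec,
    Matrix.mul_nonsing_inv _ ((Matrix.isUnit_iff_isUnit_det _).mp hI), Matrix.one_mulVec]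
  simp only [mul_comm (g _ a)]
  ring

/-- Under each of the alternatives, the covariates and the error are dependent. -/
theorem errorLaw_ne_prod (hg : Measurable g) (hm : Measurable m)
    (hg2 : Integrable (fun z => ‖g z.1‖ ^ 2) P) (hm2 : Integrable (fun z => m z.1 ^ 2) P)
    (hη2 : Integrable (fun z => z.2 ^ 2) P)
    (hη : P[fun z => z.2 | MeasurableSpace.comap (fun z : (Fin d₀ → ℝ) × ℝ => z.1) inferInstance]
      =ᵐ[P] 0) (hH : H1 P g m ∨ H2 P g m ∨ H3 P g m)
    (hH2 : H2 P g m → ¬ ∃ c : ℝ, ∀ᵐ z ∂P, misfit P g m z.1 = c) :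
    ¬ IndepFun (fun z : (Fin d₀ → ℝ) × ℝ => z.1) (fun z => misfit P g m z.1 + z.2) P := by
  intro hind
  set f := misfit P g m with hf
  have hfm : Measurable f := measurable_misfit hg hm
  have hf2 : MemLp (fun z : (Fin d₀ → ℝ) × ℝ => f z.1) 2 P := memLp_misfit hg hm hg2 hm2
  have hη2' := memLp_eta hη2
  have hηi : Integrable (fun z : (Fin d₀ → ℝ) × ℝ => z.2) P := hη2'.integrable one_le_two
  have hfi : Integrable (fun z : (Fin d₀ → ℝ) × ℝ => f z.1) P := hf2.integrable one_le_two
  have hfη : Integrable (fun z : (Fin d₀ → ℝ) × ℝ => f z.1 * z.2) P := hf2.integrable_mul hη2'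
  have hff : Integrable (fun z : (Fin d₀ → ℝ) × ℝ => f z.1 * f z.1) P := hf2.integrable_mul hf2
  have e1 : ∫ z, f z.1 * z.2 ∂P = 0 := integral_mul_eq_zero_of_condExp hfm hfη hηi hη
  have e2 : ∫ z, z.2 ∂P = 0 := by
    have := integral_mul_eq_zero_of_condExp (P := P) (f := fun _ => 1) measurable_const
      (by simpa using hηi) hηi hη
    simpa using this
  -- Independence factorizes `E[f ε]`. As `η` is centred and orthogonal to `f`, this reads `E[f²] =
  -- (E f)²`, so the misfit is almost surely constant.
  have e3 : ∫ z, f z.1 * (f z.1 + z.2) ∂P = (∫ z, f z.1 ∂P) * ∫ z, (f z.1 + z.2) ∂P :=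
    (hind.comp hfm measurable_id).integral_fun_mul_eq_mul_integral
      (hfm.comp measurable_fst).aestronglyMeasurable
      ((hfm.comp measurable_fst).add measurable_snd).aestronglyMeasurable
  simp only [mul_add] at e3
  rw [integral_add hff hfη, integral_add hfi hηi, e1, e2, add_zero, add_zero] at e3
  have hvar : variance (fun z : (Fin d₀ → ℝ) × ℝ => f z.1) P = 0 := by
    rw [variance_eq_sub hf2, sub_eq_zero]
    simp only [Pi.pow_apply, sq]
    exact e3
  have hconst := ae_eq_integral_of_variance_eq_zero hf2 hvar
  -- With a constant misfit, `η` is `ε` shifted by a constant and inherits independence from `X`.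
  -- That contradicts the first and third alternatives; the constant misfit itself is excluded under
  -- the second.
  have hindη : ErrorIndep P := by
    have h1 := hind.comp (measurable_id) (measurable_id.sub_const (∫ z, f z.1 ∂P))
    refine h1.congr (ae_of_all _ fun z => rfl) ?_
    filter_upwards [hconst] with z hz
    simp only [Function.comp_apply, id_eq, hz]
    ring
  rcases hH with h | h | h
  · exact h.1 hindη
  · exact hH2 h ⟨_, hconst⟩
  · exact h.1 hindη

end Alternatives

/-! ### Integrability of the kernels -/

/-- By Fubini almost every section `f · h y` is integrable, and some such `y` has `h y ≠ 0` to
divide by. -/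
lemma integrable_of_integrable_mul_prod {E F : Type*} [MeasurableSpace E] [MeasurableSpace F]
    {Q : Measure E} {ν : Measure F} [SFinite Q] [SFinite ν] {f : E → ℝ} {h : F → ℝ}
    (hi : Integrable (fun p : E × F => f p.1 * h p.2) (Q.prod ν)) (h0 : ¬ ∀ᵐ y ∂ν, h y = 0) :
    Integrable f Q := by
  obtain ⟨y, hy0, hy⟩ := ((not_eventually.mp h0).and_eventually hi.prod_left_ae).exists
  refine (hy.mul_const (h y)⁻¹).congr (ae_of_all _ fun x => ?_)
  exact mul_inv_cancel_right₀ hy0 _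

lemma integrable_of_integrable_sq {E : Type*} [MeasurableSpace E] {Q : Measure E}
    [IsFiniteMeasure Q] {f : E → ℝ} (hf : Measurable f) (hi : Integrable (fun x => f x ^ 2) Q) :
    Integrable f Q :=
  ((memLp_two_iff_integrable_sq hf.aestronglyMeasurable).mpr hi).integrable one_le_two

lemma indepFun_of_ae_eq_const_left {Ω U V : Type*} [MeasurableSpace Ω] [MeasurableSpace U]
    [MeasurableSpace V] {μ : Measure Ω} [IsProbabilityMeasure μ] {X : Ω → U} {Y : Ω → V} {c : U}
    (h : ∀ᵐ ω ∂μ, X ω = c) : IndepFun X Y μ :=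
  (indepFun_const_left c Y).congr (h.mono fun _ hω => hω.symm) (ae_of_all _ fun _ => rfl)

/-- The moment condition controls only products of the two kernels. With the arguments of `k` and of
`l` taken from independent copies the factors separate, provided neither diagonal vanishes almost
surely. A vanishing diagonal would make the corresponding coordinate almost surely constant, hence
independent of the other. -/
lemma integrable_diag {U V : Type*} [MeasurableSpace U] [MeasurableSpace V]
    [MeasurableSingletonClass U] [MeasurableSingletonClass V] {Q : Measure (U × V)}
    [IsProbabilityMeasure Q] {k : U → U → ℝ} {l : V → V → ℝ} (hk : IsCharacteristicKernel k)
    (hl : IsCharacteristicKernel l) (hkm : Measurable (Function.uncurry k))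
    (hlm : Measurable (Function.uncurry l)) (hi : ∀ q r s t : Fin 4,
      Integrable (fun w : Fin 4 → U × V => k (w q).1 (w r).1 ^ 2 * l (w s).2 (w t).2 ^ 2)
        (Measure.pi fun _ => Q)) (hind : ¬ IndepFun (Prod.fst : U × V → U) Prod.snd Q) :
    Integrable (fun w => k w.1 w.1) Q ∧ Integrable (fun w => l w.2 w.2) Q := by
  have hkd : Measurable fun w : U × V => k w.1 w.1 :=
    hkm.comp (measurable_fst.prodMk measurable_fst)
  have hld : Measurable fun w : U × V => l w.2 w.2 :=
    hlm.comp (measurable_snd.prodMk measurable_snd)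
  have hprod : Integrable (fun p : (U × V) × (U × V) => k p.1.1 p.1.1 ^ 2 * l p.2.2 p.2.2 ^ 2)
      (Q.prod Q) := by
    have hm : Measurable fun p : (U × V) × (U × V) => k p.1.1 p.1.1 ^ 2 * l p.2.2 p.2.2 ^ 2 :=
      ((hkd.comp measurable_fst).pow_const 2).mul ((hld.comp measurable_snd).pow_const 2)
    have hp := hasLaw_pair (Q := Q) (by decide : (0 : Fin 4) ≠ 1)
    rw [← hp.map_eq, integrable_map_measure hm.aestronglyMeasurable hp.aemeasurable]
    exact hi 0 0 1 1
  have hk0 : ¬ ∀ᵐ w ∂Q, k w.1 w.1 ^ 2 = 0 := fun h => by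
    obtain ⟨w₀, hw₀⟩ := h.exists
    refine hind (indepFun_of_ae_eq_const_left (c := w₀.1) (h.mono fun w hw => ?_))
    exact hk.eq_of_self_eq_zero hkm (pow_eq_zero_iff two_ne_zero |>.mp hw)
      (pow_eq_zero_iff two_ne_zero |>.mp hw₀)
  have hl0 : ¬ ∀ᵐ w ∂Q, l w.2 w.2 ^ 2 = 0 := fun h => by
    obtain ⟨w₀, hw₀⟩ := h.exists
    refine hind (indepFun_of_ae_eq_const_left (c := w₀.2) (h.mono fun w hw => ?_)).symm
    exact hl.eq_of_self_eq_zero hlm (pow_eq_zero_iff two_ne_zero |>.mp hw)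
      (pow_eq_zero_iff two_ne_zero |>.mp hw₀)
  refine ⟨integrable_of_integrable_sq hkd
    (integrable_of_integrable_mul_prod (f := fun w : U × V => k w.1 w.1 ^ 2)
      (h := fun w : U × V => l w.2 w.2 ^ 2) hprod hl0), integrable_of_integrable_sq hld
    (integrable_of_integrable_mul_prod (f := fun w : U × V => l w.2 w.2 ^ 2)
      (h := fun w : U × V => k w.1 w.1 ^ 2) ?_ hk0)⟩
  exact hprod.swap.congr (ae_of_all _ fun p => mul_comm _ _)

lemma integrable_diag_mul {U V : Type*} [MeasurableSpace U] [MeasurableSpace V]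
    {Q : Measure (U × V)} [IsProbabilityMeasure Q] {k : U → U → ℝ} {l : V → V → ℝ}
    (hkm : Measurable (Function.uncurry k)) (hlm : Measurable (Function.uncurry l))
    (hi : Integrable (fun w : Fin 4 → U × V => k (w 0).1 (w 0).1 ^ 2 * l (w 0).2 (w 0).2 ^ 2)
      (Measure.pi fun _ => Q)) : Integrable (fun w => k w.1 w.1 * l w.2 w.2) Q := by
  have hm : Measurable fun w : U × V => k w.1 w.1 * l w.2 w.2 :=
    (hkm.comp (measurable_fst.prodMk measurable_fst)).mul
      (hlm.comp (measurable_snd.prodMk measurable_snd))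
  refine integrable_of_integrable_sq hm ?_
  have hp := hasLaw_eval (Q := Q) (0 : Fin 4)
  rw [← hp.map_eq, integrable_map_measure (hm.pow_const 2).aestronglyMeasurable hp.aemeasurable]
  exact hi.congr (ae_of_all _ fun w => (mul_pow _ _ 2).symm)

/-! ### The kernels of order four in the regression model -/

section Regression

variable {d₀ d : ℕ} {P : Measure ((Fin d₀ → ℝ) × ℝ)} [IsProbabilityMeasure P]
  {g : (Fin d₀ → ℝ) → Fin d → ℝ} {m : (Fin d₀ → ℝ) → ℝ}
  {k : (Fin d₀ → ℝ) → (Fin d₀ → ℝ) → ℝ} {l : ℝ → ℝ → ℝ}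

lemma KernelConditions.measurable_k (hK : KernelConditions k l) :
    Measurable (Function.uncurry k) := hK.continuous_k.measurable

lemma KernelConditions.measurable_l (hK : KernelConditions k l) :
    Measurable (Function.uncurry l) := hK.contDiff_l.continuous.measurable

lemma not_indepFun_errorLaw (hg : Measurable g) (hm : Measurable m)
    (h : ¬ IndepFun (fun z : (Fin d₀ → ℝ) × ℝ => z.1) (fun z => misfit P g m z.1 + z.2) P) :
    ¬ IndepFun (Prod.fst : (Fin d₀ → ℝ) × ℝ → (Fin d₀ → ℝ)) Prod.snd (errorLaw P g m) := by
  have hφ := measurable_errorMap (P := P) hg hm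
  have := isProbabilityMeasure_errorLaw (P := P) hg hm
  contrapose h
  rw [indepFun_iff_map_prod_eq_prod_map_map measurable_fst.aemeasurable
    measurable_snd.aemeasurable] at h
  rw [indepFun_iff_map_prod_eq_prod_map_map measurable_fst.aemeasurable
    hφ.snd.aemeasurable]
  rw [errorLaw, Measure.map_map measurable_fst hφ, Measure.map_map measurable_snd hφ,
    Measure.map_map (measurable_fst.prodMk measurable_snd) hφ] at h
  exact h

lemma hsic_pos {U V : Type*} [MeasurableSpace U] [MeasurableSpace V]
    [TopologicalSpace U] [SecondCountableTopology U] [BorelSpace U]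
    [TopologicalSpace V] [SecondCountableTopology V] [BorelSpace V] {Q : Measure (U × V)}
    [IsProbabilityMeasure Q] {k : U → U → ℝ} {l : V → V → ℝ} (hk : IsCharacteristicKernel k)
    (hl : IsCharacteristicKernel l) (hkc : Continuous (Function.uncurry k))
    (hlc : Continuous (Function.uncurry l)) (hki : Integrable (fun w => k w.1 w.1) Q)
    (hli : Integrable (fun w => l w.2 w.2) Q)
    (hkl : Integrable (fun w => k w.1 w.1 * l w.2 w.2) Q)
    (hind : ¬ IndepFun (Prod.fst : U × V → U) Prod.snd Q) : 0 < hsic k l Q := by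
  refine lt_of_le_of_ne
    (hsic_nonneg_and_integral_mul_eq hk.posSemidef hl.posSemidef hkc hlc hki hli hkl).1
    fun h0 => hind ?_
  have h := eq_prod_of_hsic_eq_zero hk hl hkc hlc hki hli hkl h0.symm
  rw [indepFun_iff_map_prod_eq_prod_map_map measurable_fst.aemeasurable
    measurable_snd.aemeasurable]
  exact (Measure.map_id (μ := Q)).trans h

/-! ### The kernel of order four and its derivative -/

lemma memLp_mul_kernels (hK : KernelConditions k l) (hM : MomentConditions P g m k l)
    (q r s t : Fin 4) :
    MemLp (fun w : Fin 4 → (Fin d₀ → ℝ) × ℝ => k (w q).1 (w r).1 * l (w s).2 (w t).2) 2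
      (Measure.pi fun _ => errorLaw P g m) := by
  have hm : Measurable fun w : Fin 4 → (Fin d₀ → ℝ) × ℝ =>
      k (w q).1 (w r).1 * l (w s).2 (w t).2 :=
    (hK.measurable_k.comp ((measurable_pi_apply q).fst.prodMk (measurable_pi_apply r).fst)).mul
      (hK.measurable_l.comp ((measurable_pi_apply s).snd.prodMk (measurable_pi_apply t).snd))
  rw [memLp_two_iff_integrable_sq hm.aestronglyMeasurable]
  exact (hM.c_i q r s t).congr (ae_of_all _ fun w => (mul_pow _ _ 2).symm)

lemma measurable_h0 (hK : KernelConditions k l) : Measurable (h0 k l) :=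
  measurable_symKernel hK.measurable_k
    (hK.measurable_l.comp (measurable_fst.snd.prodMk measurable_snd.snd))

/-- The `a`-th component of `ℓ⁽¹⁾`. -/
noncomputable def gradKernel (g : (Fin d₀ → ℝ) → Fin d → ℝ) (l : ℝ → ℝ → ℝ) (a : Fin d)
    (w w' : (Fin d₀ → ℝ) × ℝ) : ℝ :=
  (-(dx l w.2 w'.2 • g w.1 + dy l w.2 w'.2 • g w'.1)) a

lemma h1_apply (w : Fin 4 → (Fin d₀ → ℝ) × ℝ) (a : Fin d) :
    h1 g k l w a = symKernel k (gradKernel g l a) w := symKernel_apply _ w a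

lemma measurable_gradKernel (hg : Measurable g) (hK : KernelConditions k l) (a : Fin d) :
    Measurable (Function.uncurry (gradKernel g l a)) := by
  have hga : Measurable fun x => g x a := (measurable_pi_apply a).comp hg
  have h2 : Measurable fun p : ((Fin d₀ → ℝ) × ℝ) × ((Fin d₀ → ℝ) × ℝ) => (p.1.2, p.2.2) :=
    measurable_fst.snd.prodMk measurable_snd.snd
  exact ((((contDiff_dx hK.contDiff_l).continuous.measurable.comp h2).mul
    (hga.comp measurable_fst.fst)).add
    (((contDiff_dy hK.contDiff_l).continuous.measurable.comp h2).mul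
    (hga.comp measurable_snd.fst))).neg

lemma abs_gradKernel_le (a : Fin d) (w w' : (Fin d₀ → ℝ) × ℝ) :
    |gradKernel g l a w w'| ≤ gradSup l w.2 w'.2 * (‖g w.1‖ + ‖g w'.1‖) := by
  simp only [gradKernel, Pi.neg_apply, Pi.add_apply, Pi.smul_apply, smul_eq_mul, abs_neg]
  refine (abs_add_le _ _).trans ?_
  rw [abs_mul, abs_mul, mul_add]
  exact add_le_add
    (mul_le_mul (le_max_left _ _) (norm_le_pi_norm (g w.1) a) (abs_nonneg _) (gradSup_nonneg _ _))
    (mul_le_mul (le_max_right _ _) (norm_le_pi_norm (g w'.1) a) (abs_nonneg _)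
      (gradSup_nonneg _ _))

lemma integrable_mul_gradKernel (hg : Measurable g) (hK : KernelConditions k l)
    (hM : MomentConditions P g m k l) (a : Fin d) (q r s t : Fin 4) :
    Integrable (fun w : Fin 4 → (Fin d₀ → ℝ) × ℝ =>
      k (w q).1 (w r).1 * gradKernel g l a (w s) (w t))
      (Measure.pi fun _ => errorLaw P g m) := by
  have h1 : Measurable fun w : Fin 4 → (Fin d₀ → ℝ) × ℝ => k (w q).1 (w r).1 :=
    hK.measurable_k.comp ((measurable_pi_apply q).fst.prodMk (measurable_pi_apply r).fst)
  have h2 : Measurable fun w : Fin 4 → (Fin d₀ → ℝ) × ℝ => gradKernel g l a (w s) (w t) :=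
    (measurable_gradKernel hg hK a).comp (f := fun w : Fin 4 → (Fin d₀ → ℝ) × ℝ => (w s, w t))
      ((measurable_pi_apply s).prodMk (measurable_pi_apply t))
  refine (hM.c_ii q r s t).mono' (h1.mul h2).aestronglyMeasurable (ae_of_all _ fun w => ?_)
  rw [Real.norm_eq_abs, abs_mul, mul_assoc]
  exact mul_le_mul_of_nonneg_left (abs_gradKernel_le a _ _) (abs_nonneg _)

lemma integrable_h1 (hg : Measurable g) (hm : Measurable m) (hK : KernelConditions k l)
    (hM : MomentConditions P g m k l) :
    Integrable (h1 g k l) (Measure.pi fun _ => errorLaw P g m) := by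
  have := isProbabilityMeasure_errorLaw (P := P) hg hm
  refine Integrable.of_eval fun a => ?_
  simp only [h1_apply]
  exact (patternIntegrable_symKernel (integrable_mul_gradKernel hg hK hM a)).integrable

lemma gammaVec_apply (hg : Measurable g) (hm : Measurable m) (hK : KernelConditions k l)
    (hM : MomentConditions P g m k l) (a : Fin d) :
    gammaVec g k l (errorLaw P g m) a =
      ∫ w, hsicKernel k (gradKernel g l a) w ∂(Measure.pi fun _ => errorLaw P g m) := by
  have := isProbabilityMeasure_errorLaw (P := P) hg hm
  rw [gammaVec, eval_integral fun a => (integrable_h1 hg hm hK hM).eval a]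
  simp only [h1_apply]
  exact integral_symKernel hK.measurable_k (measurable_gradKernel hg hK a)
    (integrable_mul_gradKernel hg hK hM a)

lemma integral_h0 (hg : Measurable g) (hm : Measurable m) (hK : KernelConditions k l)
    (hM : MomentConditions P g m k l) :
    ∫ w, h0 k l w ∂(Measure.pi fun _ => errorLaw P g m) = hsic k l (errorLaw P g m) := by
  have := isProbabilityMeasure_errorLaw (P := P) hg hm
  have hi := fun q r s t => (memLp_mul_kernels hK hM q r s t).integrable one_le_two
  rw [← integral_hsicKernel hK.measurable_k hK.measurable_l hi]
  exact integral_symKernel hK.measurable_k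
    (hK.measurable_l.comp (measurable_fst.snd.prodMk measurable_snd.snd)) hi

lemma memLp_h0 (hg : Measurable g) (hm : Measurable m) (hK : KernelConditions k l)
    (hM : MomentConditions P g m k l) :
    MemLp (h0 k l) 2 (Measure.pi fun _ => errorLaw P g m) := by
  have := isProbabilityMeasure_errorLaw (P := P) hg hm
  exact memLp_symKernel (ℓ := fun w w' => l w.2 w'.2) (memLp_mul_kernels hK hM)

lemma patternIntegrable_h0 (hg : Measurable g) (hm : Measurable m) (hK : KernelConditions k l)
    (hM : MomentConditions P g m k l) : PatternIntegrable (errorLaw P g m) (h0 k l) := by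
  have := isProbabilityMeasure_errorLaw (P := P) hg hm
  exact patternIntegrable_symKernel (ℓ := fun w w' => l w.2 w'.2)
    fun q r s t => (memLp_mul_kernels hK hM q r s t).integrable one_le_two

/-! ### The influence function -/

/-- In this form the function is a sum of Hoeffding projections and of multiples of `g(X) ε`, which
gives measurability, square integrability and centring term by term. -/
lemma influence_eq (hg : Measurable g) (hm : Measurable m) (hK : KernelConditions k l)
    (hM : MomentConditions P g m k l) (w : (Fin d₀ → ℝ) × ℝ) :
    influence P g m k l w = ∑ i, proj (errorLaw P g m) (h0 k l) i w +
      ∑ b, (gammaVec g k l (errorLaw P g m) ᵥ* (designMatrix P g)⁻¹) b * (g w.1 b * w.2) := by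
  have := isProbabilityMeasure_errorLaw (P := P) hg hm
  rw [influence, sum_proj_h0 hK.measurable_k hK.measurable_l (integral_h0 hg hm hK hM),
    Matrix.dotProduct_mulVec, dotProduct, Finset.sum_mul]
  simp only [mul_assoc]

lemma memLp_mul_error (hg : Measurable g) (hM : MomentConditions P g m k l) (b : Fin d) :
    MemLp (fun w => g w.1 b * w.2) 2 (errorLaw P g m) := by
  have h1 : Measurable fun w : (Fin d₀ → ℝ) × ℝ => g w.1 b * w.2 :=
    (((measurable_pi_apply b).comp hg).comp measurable_fst).mul measurable_snd
  rw [memLp_two_iff_integrable_sq h1.aestronglyMeasurable]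
  refine hM.b_eps.mono' (h1.pow_const 2).aestronglyMeasurable (ae_of_all _ fun w => ?_)
  rw [Real.norm_eq_abs, abs_of_nonneg (sq_nonneg _), mul_pow, ← sq_abs (g w.1 b)]
  exact mul_le_mul_of_nonneg_right
    (pow_le_pow_left₀ (abs_nonneg _) (norm_le_pi_norm (g w.1) b) 2) (sq_nonneg _)

lemma measurable_influence (hg : Measurable g) (hm : Measurable m) (hK : KernelConditions k l)
    (hM : MomentConditions P g m k l) : Measurable (influence P g m k l) := by
  have := isProbabilityMeasure_errorLaw (P := P) hg hm
  rw [funext (influence_eq hg hm hK hM)]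
  exact (Finset.measurable_fun_sum _ fun i _ => measurable_proj (measurable_h0 hK) i).add
    (Finset.measurable_fun_sum _ fun b _ => Measurable.const_mul
      ((((measurable_pi_apply b).comp hg).comp measurable_fst).mul measurable_snd) _)

lemma memLp_influence (hg : Measurable g) (hm : Measurable m) (hK : KernelConditions k l)
    (hM : MomentConditions P g m k l) : MemLp (influence P g m k l) 2 (errorLaw P g m) := by
  have := isProbabilityMeasure_errorLaw (P := P) hg hm
  rw [funext (influence_eq hg hm hK hM)]
  exact (memLp_finsetSum _ fun i _ => memLp_proj (measurable_h0 hK) (memLp_h0 hg hm hK hM) i).add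
    (memLp_finsetSum _ fun b _ => (memLp_mul_error hg hM b).const_mul _)

lemma integral_influence (hg : Measurable g) (hm : Measurable m) (hK : KernelConditions k l)
    (hM : MomentConditions P g m k l)
    (h0 : ∀ a, ∫ w, g w.1 a * w.2 ∂(errorLaw P g m) = 0) :
    ∫ w, influence P g m k l w ∂(errorLaw P g m) = 0 := by
  have := isProbabilityMeasure_errorLaw (P := P) hg hm
  have i1 : ∀ i, Integrable (proj (errorLaw P g m) (HSICReg.h0 k l) i) (errorLaw P g m) := fun i =>
    (memLp_proj (measurable_h0 hK) (memLp_h0 hg hm hK hM) i).integrable one_le_two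
  have i2 : ∀ b, Integrable (fun w => (gammaVec g k l (errorLaw P g m) ᵥ* (designMatrix P g)⁻¹) b *
      (g w.1 b * w.2)) (errorLaw P g m) := fun b =>
    ((memLp_mul_error hg hM b).integrable one_le_two).const_mul _
  simp only [influence_eq hg hm hK hM]
  rw [integral_add (integrable_finsetSum _ fun i _ => i1 i)
    (integrable_finsetSum _ fun b _ => i2 b),
    integral_finsetSum _ fun i _ => i1 i, integral_finsetSum _ fun b _ => i2 b]
  simp [integral_proj (memLp_h0 hg hm hK hM |>.integrable one_le_two), integral_const_mul, h0]

end Regression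

/-! ### Asymptotic linearity of the test statistic -/

section AsymptoticLinearity

variable {d₀ d : ℕ} {P : Measure ((Fin d₀ → ℝ) × ℝ)} [IsProbabilityMeasure P]
  {g : (Fin d₀ → ℝ) → Fin d → ℝ} {m : (Fin d₀ → ℝ) → ℝ}
  {k : (Fin d₀ → ℝ) → (Fin d₀ → ℝ) → ℝ} {l : ℝ → ℝ → ℝ}

lemma patternIntegrable_hessMajorant (hg : Measurable g) (hm : Measurable m)
    (hM : MomentConditions P g m k l) :
    PatternIntegrable (errorLaw P g m) (hsicMajorant k fun w w' =>
      2 * (hessSup l w.2 w'.2 * (‖g w.1‖ ^ 2 + ‖g w'.1‖ ^ 2))) := by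
  have := isProbabilityMeasure_errorLaw (P := P) hg hm
  exact patternIntegrable_hsicMajorant fun q r s t =>
    ((hM.c_iv q r s t).const_mul 2).congr (ae_of_all _ fun w => by ring)

lemma patternIntegrable_cubicMajorant (hg : Measurable g) (hm : Measurable m)
    (hM : MomentConditions P g m k l) (L : ℝ) :
    PatternIntegrable (errorLaw P g m) (hsicMajorant k fun w w' =>
      4 * L * (‖g w.1‖ ^ 3 + ‖g w'.1‖ ^ 3)) := by
  have := isProbabilityMeasure_errorLaw (P := P) hg hm
  exact patternIntegrable_hsicMajorant fun q r s t =>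
    ((hM.c_iii q r s t).const_mul (4 * L)).congr (ae_of_all _ fun w => by ring)

lemma integrable_norm_sq_errorLaw (hg : Measurable g) (hm : Measurable m)
    (hM : MomentConditions P g m k l) : Integrable (fun w => ‖g w.1‖ ^ 2) (errorLaw P g m) := by
  have h1 : Measurable fun w : (Fin d₀ → ℝ) × ℝ => ‖g w.1‖ ^ 2 :=
    (hg.comp measurable_fst).norm.pow_const 2
  rw [errorLaw, integrable_map_measure h1.aestronglyMeasurable
    (measurable_errorMap hg hm).aemeasurable]
  exact hM.a_g

lemma designMatrix_apply_errorLaw (hg : Measurable g) (hm : Measurable m) (a b : Fin d) :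
    designMatrix P g a b = ∫ w, g w.1 a * g w.1 b ∂(errorLaw P g m) := by
  have h1 : ∀ a, Measurable fun w : (Fin d₀ → ℝ) × ℝ => g w.1 a := fun a =>
    ((measurable_pi_apply a).comp hg).comp measurable_fst
  have h2 : Measurable fun w : (Fin d₀ → ℝ) × ℝ => g w.1 a * g w.1 b := (h1 a).mul (h1 b)
  rw [errorLaw, integral_map (measurable_errorMap hg hm).aemeasurable h2.aestronglyMeasurable]
  rfl

/-- The statistic computed from residuals is asymptotically linear, with the influence function
`influence`. -/
theorem nullInProb_sqrt_mul_sub_influence (hg : Measurable g) (hm : Measurable m)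
    (hK : KernelConditions k l) (hM : MomentConditions P g m k l) (hI : IsUnit (designMatrix P g))
    (h0 : ∀ a, ∫ w, g w.1 a * w.2 ∂(errorLaw P g m) = 0)
    {Ω : Type*} [MeasurableSpace Ω] {μ : Measure Ω} [IsProbabilityMeasure μ]
    {W : ℕ → Ω → (Fin d₀ → ℝ) × ℝ} (hW : ∀ i, HasLaw (W i) (errorLaw P g m) μ)
    (hind : iIndepFun W μ) {δ : ℕ → Ω → Fin d → ℝ}
    (hδ : ∀ n ω a, ∑ i : Fin n, g (W i ω).1 a * ((W i ω).2 - g (W i ω).1 ⬝ᵥ δ n ω) = 0) :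
    NullInProb μ fun n ω => √(n : ℝ) *
      ((vstat (hsicKernel k fun w w' => l w.2 w'.2) n fun i =>
        ((W i ω).1, (W i ω).2 - g (W i ω).1 ⬝ᵥ δ n ω)) - hsic k l (errorLaw P g m)) -
      (√(n : ℝ))⁻¹ * ∑ j : Fin n, influence P g m k l (W j ω) := by
  have := isProbabilityMeasure_errorLaw (P := P) hg hm
  obtain ⟨L, hxx, hxy, hyy⟩ := hK.lipschitz_l
  obtain ⟨hB, hD⟩ := leastSquares_expansion (G := fun w : (Fin d₀ → ℝ) × ℝ => g w.1)
    (hg.comp measurable_fst) measurable_snd (integrable_norm_sq_errorLaw hg hm hM) hM.b_eps h0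
    (designMatrix_apply_errorLaw hg hm) hI hW hind hδ
  have hA := nullInProb_hoeffding (measurable_h0 hK) (memLp_h0 hg hm hK hM)
    (patternIntegrable_h0 hg hm hK hM) hW hind
  set γ := gammaVec g k l (errorLaw P g m) with hγ
  set B : ℕ → Ω → ℝ := fun n ω => ∑ a, |√(n : ℝ) * δ n ω a| with hBdef
  set v : Fin d → ℕ → Ω → ℝ := fun a n ω => vstat (hsicKernel k (gradKernel g l a)) n fun i => W i ω
    with hv
  set F₂ : ℕ → Ω → ℝ := fun n ω => vstat (hsicMajorant k fun w w' =>
    2 * (hessSup l w.2 w'.2 * (‖g w.1‖ ^ 2 + ‖g w'.1‖ ^ 2))) n fun i => W i ω with hF₂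
  set F₃ : ℕ → Ω → ℝ := fun n ω => vstat (hsicMajorant k fun w w' =>
    4 * L * (‖g w.1‖ ^ 3 + ‖g w'.1‖ ^ 3)) n fun i => W i ω with hF₃
  set R : ℕ → Ω → ℝ := fun n ω =>
    (vstat (hsicKernel k fun w w' => l w.2 w'.2) n fun i =>
        ((W i ω).1, (W i ω).2 - g (W i ω).1 ⬝ᵥ δ n ω)) -
      (vstat (hsicKernel k fun w w' => l w.2 w'.2) n fun i => W i ω) -
      ∑ a, δ n ω a * v a n ω with hR
  have hF₂b : BoundedInProb μ F₂ :=
    (patternIntegrable_hessMajorant hg hm hM).boundedInProb_vstat hW hind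
  have hF₃b : BoundedInProb μ F₃ :=
    (patternIntegrable_cubicMajorant hg hm hM L).boundedInProb_vstat hW hind
  -- Each power of `δ` is traded for `n^(-1/2)` times the bounded `√n δ`, so the quadratic and cubic
  -- remainders, multiplied by `√n`, are of order `n^(-1/2)` and `n⁻¹`.
  have hRn : NullInProb μ fun n ω => √(n : ℝ) * R n ω := by
    have h1 := (nullInProb_inv_sqrt (μ := μ)).mul ((hB.mul hB).mul hF₂b)
    have h2 := (nullInProb_inv_sqrt (μ := μ)).mul
      ((nullInProb_inv_sqrt (μ := μ)).boundedInProb.mul ((hB.mul (hB.mul hB)).mul hF₃b))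
    refine (h1.add h2).mono fun n ω => ?_
    refine le_trans ?_ (le_abs_self _)
    have h3 : |R n ω| ≤ (∑ a, |δ n ω a|) ^ 2 * F₂ n ω + (∑ a, |δ n ω a|) ^ 3 * F₃ n ω :=
      abs_vstat_expansion_le hK.contDiff_l hxx hxy hyy n (fun i => W i ω) (δ n ω)
    rw [abs_mul, abs_of_nonneg (Real.sqrt_nonneg _)]
    refine (mul_le_mul_of_nonneg_left h3 (Real.sqrt_nonneg _)).trans_eq ?_
    have h4 : B n ω = √(n : ℝ) * ∑ a, |δ n ω a| := by
      simp only [hBdef, abs_mul, abs_of_nonneg (Real.sqrt_nonneg _), Finset.mul_sum]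
    rw [h4]
    rcases Nat.eq_zero_or_pos n with rfl | hn
    · simp
    · have : √(n : ℝ) ≠ 0 := (Real.sqrt_pos.mpr (by exact_mod_cast hn)).ne'
      field_simp
  have hv0 : ∀ a, NullInProb μ fun n ω => v a n ω - γ a := fun a => by
    rw [hγ, gammaVec_apply hg hm hK hM]
    exact nullInProb_vstat_sub
      (measurable_hsicKernel hK.measurable_k (measurable_gradKernel hg hK a))
      (patternIntegrable_hsicKernel (integrable_mul_gradKernel hg hK hM a)) hW hind
  have hDb : ∀ a, BoundedInProb μ fun n ω => √(n : ℝ) * δ n ω a := fun a =>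
    hB.mono fun n ω => (Finset.single_le_sum (f := fun a => |√(n : ℝ) * δ n ω a|)
      (fun _ _ => abs_nonneg _) (Finset.mem_univ a)).trans (le_abs_self _)
  -- Two replacements in the linear term: the random coefficients by their limit `γ` (`hC`), then
  -- `√n δ` by its i.i.d. representation (`hE`).
  have hC := NullInProb.sum Finset.univ fun a _ => (hv0 a).mul (hDb a)
  have hE := NullInProb.sum Finset.univ fun a _ => (hD a).const_mul (γ a)
  refine (((hRn.add hA).add hC).add hE).mono fun n ω => le_of_eq (congrArg abs ?_)
  have e1 : (vstat (HSICReg.h0 k l) n fun i => W i ω) =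
      vstat (hsicKernel k fun w w' => l w.2 w'.2) n fun i => W i ω := vstat_symKernel _ n _
  have e2 : (√(n : ℝ))⁻¹ * ∑ j : Fin n, influence P g m k l (W j ω) =
      √(n : ℝ) * ((n : ℝ)⁻¹ * ∑ j : Fin n, ∑ i, proj (errorLaw P g m) (HSICReg.h0 k l) i (W j ω)) +
      ∑ a, γ a * ((designMatrix P g)⁻¹ *ᵥ fun b =>
        (√(n : ℝ))⁻¹ * ∑ i : Fin n, g (W i ω).1 b * (W i ω).2) a := by
    have h1 : √(n : ℝ) * (n : ℝ)⁻¹ = (√(n : ℝ))⁻¹ := by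
      rw [← div_eq_mul_inv, Real.sqrt_div_self]
    have h2 : ∑ a, γ a * ((designMatrix P g)⁻¹ *ᵥ fun b =>
        (√(n : ℝ))⁻¹ * ∑ i : Fin n, g (W i ω).1 b * (W i ω).2) a =
        (√(n : ℝ))⁻¹ * ∑ j : Fin n, ∑ b, (γ ᵥ* (designMatrix P g)⁻¹) b *
          (g (W j ω).1 b * (W j ω).2) := by
      change γ ⬝ᵥ _ = _
      rw [Matrix.dotProduct_mulVec, dotProduct, Finset.sum_comm, Finset.mul_sum]
      refine Finset.sum_congr rfl fun b _ => ?_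
      rw [← Finset.mul_sum]
      ring
    rw [h2, ← mul_assoc, h1, ← mul_add, ← Finset.sum_add_distrib]
    simp only [influence_eq hg hm hK hM, hγ]
  rw [e2, e1, integral_h0 hg hm hK hM]
  have e3 : √(n : ℝ) * ∑ a, δ n ω a * v a n ω = ∑ a, (v a n ω - γ a) * (√(n : ℝ) * δ n ω a) +
      ∑ a, γ a * (√(n : ℝ) * δ n ω a) := by
    rw [Finset.mul_sum, ← Finset.sum_add_distrib]
    exact Finset.sum_congr rfl fun a _ => by ring
  have e4 : ∑ a, γ a * (√(n : ℝ) * δ n ω a - ((designMatrix P g)⁻¹ *ᵥ fun b =>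
        (√(n : ℝ))⁻¹ * ∑ i : Fin n, g (W i ω).1 b * (W i ω).2) a) =
      ∑ a, γ a * (√(n : ℝ) * δ n ω a) - ∑ a, γ a * ((designMatrix P g)⁻¹ *ᵥ fun b =>
        (√(n : ℝ))⁻¹ * ∑ i : Fin n, g (W i ω).1 b * (W i ω).2) a := by
    rw [← Finset.sum_sub_distrib]
    exact Finset.sum_congr rfl fun a _ => by ring
  rw [e4]
  simp only [hR]
  linear_combination e3

end AsymptoticLinearity

end HSICReg

/-! ### Positivity and the central limit theorem -/

theorem theorem2 {d₀ d : ℕ}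
    -- the law `P` of `(X, η)`, with `E(η | X) = 0`; the predictors `g`, the regression function `m`
    (P : Measure ((Fin d₀ → ℝ) × ℝ)) [IsProbabilityMeasure P]
    (g : (Fin d₀ → ℝ) → Fin d → ℝ) (hg : Measurable g)
    (m : (Fin d₀ → ℝ) → ℝ) (hm : Measurable m)
    (hη : P[fun z => z.2 | MeasurableSpace.comap (fun z : (Fin d₀ → ℝ) × ℝ => z.1) inferInstance]
      =ᵐ[P] 0)
    -- the kernels
    (k : (Fin d₀ → ℝ) → (Fin d₀ → ℝ) → ℝ) (l : ℝ → ℝ → ℝ)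
    -- conditions (I), (K) and (M')
    (hI : IsUnit (designMatrix P g))
    (hK : KernelConditions k l)
    (hM : MomentConditions P g m k l)
    -- one of the alternatives holds; under `H₂` the misfit is not almost surely constant
    (hH : H1 P g m ∨ H2 P g m ∨ H3 P g m)
    (hH2 : H2 P g m → ¬ ∃ c : ℝ, ∀ᵐ z ∂P, misfit P g m z.1 = c)
    -- i.i.d. data `(X_i, η_i) ~ P`, `Y_i = m(X_i) + η_i`
    {Ω : Type*} [MeasurableSpace Ω] (μ : Measure Ω) [IsProbabilityMeasure μ]
    (X : ℕ → Ω → Fin d₀ → ℝ) (η Y : ℕ → Ω → ℝ)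
    (hindep : iIndepFun (fun i ω => (X i ω, η i ω)) μ)
    (hlaw : ∀ i, HasLaw (fun ω => (X i ω, η i ω)) P μ)
    (hY : ∀ i ω, Y i ω = m (X i ω) + η i ω)
    -- the least squares estimators
    (betaHat : ℕ → Ω → Fin d → ℝ) (hmeas : ∀ n, AEMeasurable (betaHat n) μ)
    (hLSE : ∀ n ω, IsLSE g n (fun i => X i ω) (fun i => Y i ω) (betaHat n ω)) :
    -- the quantities `θ`, `h₁⁽⁰⁾`, `γ` and `σ²` are well defined
    Integrable (fun w => k w.1 w.1) (errorLaw P g m) ∧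
    Integrable (fun w => l w.2 w.2) (errorLaw P g m) ∧
    Integrable (h0 k l) (Measure.pi fun _ => errorLaw P g m) ∧
    Integrable (h1 g k l) (Measure.pi fun _ => errorLaw P g m) ∧
    MemLp (influence P g m k l) 2 (errorLaw P g m) ∧
    -- `θ(X, ε) > 0`
    0 < hsic k l (errorLaw P g m) ∧
    -- `√n (T_n - θ) → N(0, σ²)` in distribution
    TendstoInDistribution
      (fun (n : ℕ) ω => √(n : ℝ) *
        (testStat g k l n (fun i => X i ω) (fun i => Y i ω) (betaHat n ω)
          - hsic k l (errorLaw P g m)))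
      atTop (fun x : ℝ => x) (fun _ => μ)
      (gaussianReal 0 (variance (influence P g m k l) (errorLaw P g m)).toNNReal) := by
  have := isProbabilityMeasure_errorLaw (P := P) hg hm
  have hdep := not_indepFun_errorLaw hg hm
    (errorLaw_ne_prod hg hm hM.a_g hM.a_m hM.b_eta hη hH hH2)
  obtain ⟨hki, hli⟩ := integrable_diag hK.char_k hK.char_l hK.measurable_k hK.measurable_l hM.c_i
    hdep
  have hkl := integrable_diag_mul hK.measurable_k hK.measurable_l (hM.c_i 0 0 0 0)
  have h0 := integral_mul_error_eq_zero hg hm hM.a_g hM.a_m hM.b_eta hη hI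
  refine ⟨hki, hli, (memLp_h0 hg hm hK hM).integrable one_le_two, integrable_h1 hg hm hK hM,
    memLp_influence hg hm hK hM, hsic_pos hK.char_k hK.char_l hK.continuous_k
      hK.contDiff_l.continuous hki hli hkl hdep, ?_⟩
  have hφ := measurable_errorMap (P := P) hg hm
  let W : ℕ → Ω → (Fin d₀ → ℝ) × ℝ := fun i ω => (X i ω, misfit P g m (X i ω) + η i ω)
  have hW : ∀ i, HasLaw (W i) (errorLaw P g m) μ := fun i =>
    HasLaw.comp ⟨hφ.aemeasurable, rfl⟩ (hlaw i)
  have hWind : iIndepFun W μ :=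
    hindep.comp (fun _ z => (z.1, misfit P g m z.1 + z.2)) fun _ => hφ
  -- The residual is the misspecified error minus a term linear in the estimation error of
  -- `bestCoef`; the form of the model enters only here.
  have hres : ∀ n ω (i : ℕ), (W i ω).2 - g (W i ω).1 ⬝ᵥ (betaHat n ω - bestCoef P g m) =
      Y i ω - g (X i ω) ⬝ᵥ betaHat n ω := fun n ω i => by
    simp only [W, misfit, hY, dotProduct_sub]
    ring
  have hlin := nullInProb_sqrt_mul_sub_influence hg hm hK hM hI h0 hW hWind
    (δ := fun n ω => betaHat n ω - bestCoef P g m) fun n ω a => by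
      simp only [hres]
      exact (hLSE n ω).normal_equations a
  have hψ := measurable_influence hg hm hK hM
  have hvar : variance (fun ω => influence P g m k l (W 0 ω)) μ =
      variance (influence P g m k l) (errorLaw P g m) :=
    by rw [← (hW 0).map_eq, variance_map hψ.aemeasurable (hW 0).aemeasurable]; rfl
  have hmean : ∫ ω, influence P g m k l (W 0 ω) ∂μ = 0 :=
    ((hW 0).integral_comp hψ.aestronglyMeasurable).trans (integral_influence hg hm hK hM h0)
  have hclt := tendstoInDistribution_inv_sqrt_mul_sum_sub (P := μ)
    (X := fun i ω => influence P g m k l (W i ω)) (Y := fun x : ℝ => x)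
    (P' := gaussianReal 0 (variance (influence P g m k l) (errorLaw P g m)).toNNReal)
    (by rw [hvar]; exact HasLaw.id)
    (by
      have h1 := memLp_influence hg hm hK hM
      rw [← (hW 0).map_eq] at h1
      exact h1.comp_of_map (hW 0).aemeasurable)
    (hWind.comp (fun _ => influence P g m k l) fun _ => hψ)
    (fun i => ((hW i).identDistrib (hW 0)).comp hψ)
  simp only [hmean, mul_zero, sub_zero] at hclt
  -- Slutsky: the statistic differs from the normalized sum of influence values by `o_P(1)`.
  refine tendstoInDistribution_of_tendstoInMeasure_sub _ _ hclt ?_ fun n => ?_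
  · rw [← nullInProb_iff_tendstoInMeasure]
    refine hlin.mono fun n ω => le_of_eq (congrArg abs ?_)
    have e1 : testStat g k l n (fun i => X i ω) (fun i => Y i ω) (betaHat n ω) =
        vstat (hsicKernel k fun w w' => l w.2 w'.2) n fun i =>
          ((W i ω).1, (W i ω).2 - g (W i ω).1 ⬝ᵥ (betaHat n ω - bestCoef P g m)) := by
      simp only [hres]
      exact empiricalHSIC_eq_vstat l n (fun i => X i ω)
        fun i => Y i ω - g (X i ω) ⬝ᵥ betaHat n ω
    simp only [Pi.sub_apply, e1, Finset.sum_range]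
  -- Convergence in distribution also requires the statistic to be almost everywhere measurable;
  -- this is where measurability of the estimator is used.
  · have hX : ∀ i, AEMeasurable (X i) μ := fun i => (hlaw i).aemeasurable.fst
    have hYm : ∀ i, AEMeasurable (Y i) μ := fun i => by
      rw [funext (hY i)]
      exact (hm.comp_aemeasurable (hX i)).add (hlaw i).aemeasurable.snd
    have hr : ∀ i, AEMeasurable (fun ω => Y i ω - g (X i ω) ⬝ᵥ betaHat n ω) μ := fun i => by
      refine (hYm i).sub (Finset.aemeasurable_fun_sum _ fun a _ => ?_)
      exact ((measurable_pi_apply a).comp_aemeasurable (hg.comp_aemeasurable (hX i))).mul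
        ((measurable_pi_apply a).comp_aemeasurable (hmeas n))
    have hkk : ∀ i j : ℕ, AEMeasurable (fun ω => k (X i ω) (X j ω)) μ := fun i j =>
      hK.measurable_k.comp_aemeasurable ((hX i).prodMk (hX j))
    have hll : ∀ i j : ℕ, AEMeasurable (fun ω => l (Y i ω - g (X i ω) ⬝ᵥ betaHat n ω)
        (Y j ω - g (X j ω) ⬝ᵥ betaHat n ω)) μ := fun i j =>
      hK.measurable_l.comp_aemeasurable ((hr i).prodMk (hr j))
    refine (AEMeasurable.sub_const ?_ _).const_mul _
    simp only [testStat, empiricalHSIC]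
    refine ((AEMeasurable.const_mul ?_ _).add (AEMeasurable.const_mul ?_ _)).sub
      (AEMeasurable.const_mul ?_ _)
    · exact Finset.aemeasurable_fun_sum _ fun i _ => Finset.aemeasurable_fun_sum _ fun j _ =>
        (hkk i j).mul (hll i j)
    · exact Finset.aemeasurable_fun_sum _ fun i _ => Finset.aemeasurable_fun_sum _ fun j _ =>
        Finset.aemeasurable_fun_sum _ fun q _ => Finset.aemeasurable_fun_sum _ fun r _ =>
        (hkk i j).mul (hll q r)
    · exact Finset.aemeasurable_fun_sum _ fun i _ => Finset.aemeasurable_fun_sum _ fun j _ =>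
        Finset.aemeasurable_fun_sum _ fun q _ => (hkk i j).mul (hll i q)
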